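/- **Setting.** All vector spaces are complex. Let $\Phi=\bigcup_{n}\Phi_n$ be a (strict) (LB)-space: $(\Phi_n)$ is an increasing sequence of Banach spaces, the norm of $\Phi_{n+1}$ restricts to the norm of $\Phi_n$, and $\Phi$ carries the locally convex inductive limit topology. Let $\Phi'$ be its dual. For (LB)-spaces $\Phi,\Psi$ the space $\mathcal L(\Phi,\Psi)$ of continuous linear operators carries the topology of $\operatorname{proj\,lim}_n\operatorname{ind\,lim}_m\mathcal L(\Phi_n,\Psi_m)$, where each $\mathcal L(\Phi_n,\Psi_m)$ has the operator norm. For a Banach space $B$, $B^{\hat\odot k}$ is the range of the symmetrization $\operatorname{Sym}_k$ in the $k$-th injective tensor power of $B$; $\Phi^{\hat\odot k}$ is the (LB)-space $\bigcup_n\Phi_n^{\hat\odot k}$, with $\Phi^{\hat\odot0}=\mathbb C$ and $\Phi^{\hat\odot 1}=\Phi$. For $A_1\in\mathcal L(\Phi^{\hat\odot i_1},\Phi^{\hat\odot j_1})$ and $A_2\in\mathcal L(\Phi^{\hat\odot i_2},\Phi^{\hat\odot j_2})$, $A_1\odot A_2\in\mathcal L(\Phi^{\hat\odot(i_1+i_2)},\Phi^{\hat\odot(j_1+j_2)})$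 is the restriction of $\operatorname{Sym}(A_1\otimes A_2)$. Write $\mathbf 1_k$ for the identity of $\Phi^{\hat\odot k}$ and $\langle\cdot,\cdot\rangle$ for the dual pairing. **Formal tensor power series.** A series $C(\xi)=\sum_k C_k\xi^{\otimes k}$ with values in $\Phi^{\hat\odot i}$ is a sequence of operators $C_k\in\mathcal L(\Phi^{\hat\odot k},\Phi^{\hat\odot i})$; the space of these sequences has the product topology. Products are $B(\xi)\odot C(\xi)=\sum_k\big(\sum_{a+b=k}B_a\odot C_b\big)\xi^{\otimes k}$, written without $\odot$ if a factor is scalar ($i=0$). For $B(\xi)=\sum_{k\ge1}B_k\xi^{\otimes k}$ with values in $\Phi$, put $C(B(\xi))=\sum_l C_l\,B(\xi)^{\odot l}$, and let $D_BC$ be the derivative of $C$ in the direction $B$: its $k$-th coefficient is $\sum_{l=1}^{k}l\,C_l(\mathbf 1_{l-1}\odot B_{k-l+1})$. Let - $\mathcal W_0(\Phi)$ be the set of scalar series $\sum_{k\ge1}\alpha_k\xi^{\otimes k}$, $\mathcal W_1(\Phi)$ the set of $\Phi$-valued series $\sum_{k\ge2}\beta_k\xi^{\otimes k}$, and $\mathcal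 W(\Phi)=\mathcal W_0(\Phi)\times\mathcal W_1(\Phi)$; - $\mathcal S(\Phi)$ be the set of pairs $(A(\xi),B(\xi))=(1+\alpha(\xi),\,\xi+\beta(\xi))$ with $(\alpha,\beta)\in\mathcal W(\Phi)$. It is a Lie group, globally parametrized by $\mathcal W(\Phi)$, with the product $(A^{(1)},B^{(1)})*(A^{(2)},B^{(2)})=\big(A^{(1)}(B^{(2)}(\xi))A^{(2)}(\xi),\,B^{(1)}(B^{(2)}(\xi))\big)$. $\operatorname{EXP}:\mathcal W(\Phi)\to\mathcal S(\Phi)$ is the exponential map: $\operatorname{EXP}(\alpha,\beta)$ is the value at $t=1$ of the smooth one-parameter subgroup $(\gamma(t))_{t\in\mathbb R}$ with $\gamma'(0)=(\alpha,\beta)$. **Operators on polynomials.** $\mathcal P(\Phi')$ is the space of polynomials $p(\omega)=\sum_{k=0}^K\langle\omega^{\otimes k},f^{(k)}\rangle$, $f^{(k)}\in\Phi^{\hat\odot k}$, on $\Phi'$, with the topology of the locally convex direct sum of the spaces $\Phi^{\hat\odot k}$; $\mathcal P^{(n)}(\Phi')$ is the subspace of polynomials of degree $\le n$, and $\mathcal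 P^{(-1)}(\Phi')=\{0\}$. $\mathbb V(\Phi)$ is the set of continuous linear operators $V$ on $\mathcal P(\Phi')$ with $V\mathcal P^{(n)}(\Phi')\subset\mathcal P^{(n-1)}(\Phi')$ for all $n\ge0$, and $\mathbb M(\Phi)=\mathbf 1+\mathbb V(\Phi)$. An operator that maps every $\mathcal P^{(n)}(\Phi')$ into itself is identified with its block matrix $[V_{ik}]$, $V_{ik}\in\mathcal L(\Phi^{\hat\odot k},\Phi^{\hat\odot i})$, and such operators carry the product topology. The maps $\exp(V)=\sum_{n\ge0}V^n/n!$ and $\log(P)=\sum_{n\ge1}\frac{(-1)^{n+1}}n(P-\mathbf 1)^n$ between $\mathbb V(\Phi)$ and $\mathbb M(\Phi)$ are given by sums that are finite on every polynomial. An operator $P\in\mathbb M(\Phi)$ is a Sheffer operator if there is $(A,B)\in\mathcal S(\Phi)$ with $$\sum_{k=0}^\infty\frac1{k!}\big(P\langle\cdot^{\otimes k},\xi^{\otimes k}\rangle\big)(\omega)=\exp\big[\langle\omega,B(\xi)\rangle\big]A(\xi)\qquad\text{for all }\omega\in\Phi',$$ and then $P=:\mathcal I(A,B)$. Let $\mathbb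 S(\Phi)$ be the set of Sheffer operators, $\mathfrak s(\Phi)=\log(\mathbb S(\Phi))$, and $\mathcal R=\log\circ\,\mathcal I\circ\operatorname{EXP}:\mathcal W(\Phi)\to\mathfrak s(\Phi)$. The set $\mathbb S(\Phi)$ is a Lie group under composition with the global parametrization $\exp:\mathfrak s(\Phi)\to\mathbb S(\Phi)$. The Lie bracket on its Lie algebra $\mathfrak s(\Phi)$ is $[V,W]=b(V,W)-b(W,V)$, where $b(V,W)\in\mathfrak s(\Phi)$ is the coefficient of $s_1s_2$ in the Taylor expansion $\log\big(\exp(s_1V)\exp(s_2W)\big)=s_1V+s_2W+s_1s_2\,b(V,W)+\cdots$ in $\mathfrak s(\Phi)$, $s_1,s_2\in\mathbb C$. **The operators $\alpha(\nabla)$ and $M(\beta(\nabla))$.** For $\sigma\in\Phi'$ let $D_\sigma$ be the derivative of functions on $\Phi'$ in the direction $\sigma$. For $p\in\mathcal P(\Phi')$ and $\omega\in\Phi'$, $\nabla^kp(\omega)$ is the element of $\Phi^{\hat\odot k}$ with $(D_{\sigma_1}\cdots D_{\sigma_k}p)(\omega)=\langle\sigma_1\odot\cdots\odot\sigma_k,\nabla^kp(\omega)\rangle$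 for all $\sigma_1,\dots,\sigma_k\in\Phi'$. For $(\alpha,\beta)\in\mathcal W(\Phi)$ put $$(\alpha(\nabla)p)(\omega)=\sum_{k\ge1}\alpha_k\big(\nabla^kp(\omega)\big),\qquad (M(\beta(\nabla))p)(\omega)=\sum_{k\ge2}\big\langle\omega,\beta_k\big(\nabla^kp(\omega)\big)\big\rangle,$$ where both sums are finite. **Theorem 4.8.** Let $\Phi$ be a (strict) (LB)-space. (i) For each $(\alpha(\xi),\beta(\xi))\in\mathcal W(\Phi)$, $$\mathcal R(\alpha(\xi),\beta(\xi))=\alpha(\nabla)+M(\beta(\nabla)),$$ and this operator belongs to $\mathfrak s(\Phi)$. (ii) The space $\mathfrak s(\Phi)$ is closed under commutators, and the Lie bracket on $\mathfrak s(\Phi)$ is the commutator of operators, $[V,W]=VW-WV$. Furthermore, for any $(\alpha^{(m)}(\xi),\beta^{(m)}(\xi))\in\mathcal W(\Phi)$, $m=1,2$, $$\big[\alpha^{(1)}(\nabla)+M(\beta^{(1)}(\nabla)),\ \alpha^{(2)}(\nabla)+M(\beta^{(2)}(\nabla))\big]=D_{\beta^{(2)}}\alpha^{(1)}(\nabla)-D_{\beta^{(1)}}\alpha^{(2)}(\nabla)+M\big(D_{\beta^{(2)}}\beta^{(1)}(\nabla)-D_{\beta^{(1)}}\beta^{(2)}(\nabla)\big).$$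 -/

import Mathlib

open Filter Topology

universe u v

noncomputable section

/-! ### Locally convex inductive limit topologies -/

/-- The finest locally convex vector space topology on `Y` for which all the linear maps
`j i : X i → Y` are continuous. For the inclusions of an increasing sequence it is the inductive
limit topology; for the injections of the summands it is the locally convex direct sum. -/
@[reducible] def finestLC {ι : Type*} {Y : Type*} [AddCommGroup Y] [Module ℂ Y] (X : ι → Type*)
    [∀ i, AddCommGroup (X i)] [∀ i, Module ℂ (X i)] [∀ i, TopologicalSpace (X i)]
    (j : ∀ i, X i →ₗ[ℂ] Y) : TopologicalSpace Y :=
  sInf {t : TopologicalSpace Y |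
    @IsTopologicalAddGroup Y t _ ∧ @ContinuousSMul ℂ Y _ _ t ∧
    @LocallyConvexSpace ℝ Y _ _ _ _ t ∧ ∀ i, Continuous[_, t] (j i)}

/-! ### (LB)-spaces -/

/-- A (strict) (LB)-space: an increasing sequence of complex Banach spaces `step n`, each a
subspace of the next one with the restricted norm, and their union `E`. As the norms are
compatible, they amount to one norm on the union `E`, for which every `step n` is complete.
(This norm is *not* the topology of the (LB)-space: see `LBSpace.Sp`.) -/
structure LBSpace where
  E : Type u
  [normedAddCommGroup : NormedAddCommGroup E]
  [normedSpace : NormedSpace ℂ E]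
  step : ℕ → Submodule ℂ E
  step_mono : Monotone step
  exists_mem_step : ∀ x : E, ∃ n, x ∈ step n
  isComplete_step : ∀ n, IsComplete (step n : Set E)

attribute [instance] LBSpace.normedAddCommGroup LBSpace.normedSpace

namespace LBSpace

/-- The (LB)-space as a locally convex space: the union `E` with the inductive limit topology. -/
def Sp (Φ : LBSpace.{u}) : Type u := Φ.E

instance (Φ : LBSpace.{u}) : AddCommGroup Φ.Sp := inferInstanceAs (AddCommGroup Φ.E)

instance (Φ : LBSpace.{u}) : Module ℂ Φ.Sp := inferInstanceAs (Module ℂ Φ.E)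

/-- The identity map from the normed space `E` to the locally convex space. -/
def toSp (Φ : LBSpace.{u}) : Φ.E ≃ₗ[ℂ] Φ.Sp := LinearEquiv.refl ℂ Φ.E

/-- The inclusion of the `n`-th Banach space. -/
def stepIncl (Φ : LBSpace.{u}) (n : ℕ) : Φ.step n →ₗ[ℂ] Φ.Sp :=
  Φ.toSp.toLinearMap ∘ₗ (Φ.step n).subtype

/-- The inductive limit topology. -/
instance (Φ : LBSpace.{u}) : TopologicalSpace Φ.Sp :=
  finestLC (fun n => Φ.step n) Φ.stepIncl

instance (Φ : LBSpace.{u}) : IsTopologicalAddGroup Φ.Sp :=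
  topologicalAddGroup_sInf fun _ ht => ht.1

instance (Φ : LBSpace.{u}) : ContinuousSMul ℂ Φ.Sp :=
  continuousSMul_sInf fun _ ht => ht.2.1

instance (Φ : LBSpace.{u}) : LocallyConvexSpace ℝ Φ.Sp :=
  LocallyConvexSpace.sInf fun _ ht => ht.2.2.1

lemma continuous_stepIncl (Φ : LBSpace.{u}) (n : ℕ) : Continuous (Φ.stepIncl n) :=
  continuous_sInf_rng.2 fun _ ht => ht.2.2.2 n

/-- The inclusion of the `n`-th Banach space, as a continuous linear map. -/
def stepInclL (Φ : LBSpace.{u}) (n : ℕ) : Φ.step n →L[ℂ] Φ.Sp :=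
  ⟨Φ.stepIncl n, Φ.continuous_stepIncl n⟩

/-- The topology of `𝓛(Φₙ, Ψ) = ind lim_m 𝓛(Φₙ, Ψₘ)`, where every `𝓛(Φₙ, Ψₘ)` carries the
operator norm. -/
@[reducible] def stepHomTopology (Φ : LBSpace.{u}) (Ψ : LBSpace.{v}) (n : ℕ) :
    TopologicalSpace (Φ.step n →L[ℂ] Ψ.Sp) :=
  finestLC (fun m => Φ.step n →L[ℂ] Ψ.step m) fun m =>
    { toFun := fun A => (Ψ.stepInclL m).comp A
      map_add' := fun _ _ => ContinuousLinearMap.comp_add _ _ _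
      map_smul' := fun _ _ => ContinuousLinearMap.comp_smul _ _ _ }

/-- The topology of `𝓛(Φ, Ψ) = proj lim_n 𝓛(Φₙ, Ψ)`. (It is used explicitly; the instance that
Mathlib puts on continuous linear maps is never used between (LB)-spaces.) -/
@[reducible] def homTopology (Φ : LBSpace.{u}) (Ψ : LBSpace.{v}) :
    TopologicalSpace (Φ.Sp →L[ℂ] Ψ.Sp) :=
  ⨅ n, TopologicalSpace.induced (fun A => A.comp (Φ.stepInclL n)) (stepHomTopology Φ Ψ n)

variable (Φ : LBSpace.{u})

/-- The dual space `Φ'`. -/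
abbrev Dual : Type u := Φ.Sp →L[ℂ] ℂ

/-! ### Symmetric injective tensor powers -/

/-- The dual of the normed space `E`, a Banach space. -/
def NDual : Type u := Φ.E →L[ℂ] ℂ

instance : NormedAddCommGroup Φ.NDual := inferInstanceAs (NormedAddCommGroup (Φ.E →L[ℂ] ℂ))

instance : NormedSpace ℂ Φ.NDual := inferInstanceAs (NormedSpace ℂ (Φ.E →L[ℂ] ℂ))

/-- The evaluation `ν ↦ ν(b)`. -/
def evalL (b : Φ.E) : Φ.NDual →L[ℂ] ℂ := ContinuousLinearMap.apply ℂ ℂ b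

/-- Bounded `k`-linear forms on the dual of the normed space `E`, with the supremum norm over the
unit balls. The algebraic tensor power `B ⊗ ⋯ ⊗ B` of a subspace `B` of `E` embeds into this
Banach space, and the induced norm is the injective norm (by the Hahn-Banach theorem it does not
matter whether functionals on `B` or on `E` are used). -/
abbrev Form (k : ℕ) : Type u :=
  ContinuousMultilinearMap ℂ (fun _ : Fin k => Φ.NDual) ℂ

/-- The elementary tensor `b₁ ⊗ ⋯ ⊗ bₖ`, i.e. the form `(ν₁, …, νₖ) ↦ ν₁(b₁) ⋯ νₖ(bₖ)`. -/
def pureTensor {k : ℕ} (b : Fin k → Φ.E) : Φ.Form k :=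
  (ContinuousMultilinearMap.mkPiAlgebra ℂ (Fin k) ℂ).compContinuousLinearMap
    fun i => Φ.evalL (b i)

lemma pureTensor_apply {k : ℕ} (b : Fin k → Φ.E) (ν : Fin k → Φ.NDual) :
    Φ.pureTensor b ν = ∏ i, Φ.evalL (b i) (ν i) := by
  simp [pureTensor]

/-- The `k`-th injective tensor power of the Banach space `Φₙ`: the completion (closure) of the
algebraic tensor power in the injective norm. -/
def tensorStep (k n : ℕ) : Submodule ℂ (Φ.Form k) :=
  (Submodule.span ℂ
    {f | ∃ b : Fin k → Φ.E, (∀ i, b i ∈ Φ.step n) ∧ Φ.pureTensor b = f}).topologicalClosure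

/-- The symmetrization operator. -/
def sym {k : ℕ} (f : Φ.Form k) : Φ.Form k :=
  (k.factorial : ℂ)⁻¹ • ∑ π : Equiv.Perm (Fin k), f.domDomCongr π

/-- Symmetric forms, i.e. those that are fixed by all permutations (the range of `sym`). -/
def symForms (k : ℕ) : Submodule ℂ (Φ.Form k) where
  carrier := {f | ∀ π : Equiv.Perm (Fin k), f.domDomCongr π = f}
  zero_mem' := fun _ => rfl
  add_mem' := by
    intro f g hf hg π
    ext ν
    have h₁ := DFunLike.congr_fun (hf π) ν
    have h₂ := DFunLike.congr_fun (hg π) ν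
    simp only [ContinuousMultilinearMap.domDomCongr_apply] at h₁ h₂
    simp [h₁, h₂]
  smul_mem' := by
    intro c f hf π
    ext ν
    have h₁ := DFunLike.congr_fun (hf π) ν
    simp only [ContinuousMultilinearMap.domDomCongr_apply] at h₁
    simp [h₁]

/-- The `k`-th symmetric injective tensor power of the Banach space `Φₙ`. -/
def symStep (k n : ℕ) : Submodule ℂ (Φ.Form k) := Φ.tensorStep k n ⊓ Φ.symForms k

lemma symStep_mono (k : ℕ) : Monotone (Φ.symStep k) := by
  intro m n hmn
  refine inf_le_inf_right _ (Submodule.topologicalClosure_mono (Submodule.span_mono ?_))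
  rintro _ ⟨b, hb, rfl⟩
  exact ⟨b, fun i => Φ.step_mono hmn (hb i), rfl⟩

lemma isClosed_symStep (k n : ℕ) : IsClosed (Φ.symStep k n : Set (Φ.Form k)) := by
  refine IsClosed.inter (Submodule.isClosed_topologicalClosure _) ?_
  have : (Φ.symForms k : Set (Φ.Form k)) =
      ⋂ π : Equiv.Perm (Fin k), {f | f.domDomCongr π = f} := by
    ext f
    rw [Set.mem_iInter]
    exact Iff.rfl
  change IsClosed (Φ.symForms k : Set (Φ.Form k))
  rw [this]
  refine isClosed_iInter fun π => isClosed_eq ?_ continuous_id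
  exact (ContinuousMultilinearMap.domDomCongrₗᵢ ℂ Φ.NDual ℂ π).continuous

/-- The symmetric tensor power `Φ^{⊙k}`, the inductive limit of the Banach spaces `Φₙ^{⊙k}`.
`Φ^{⊙0}` is `ℂ` (see `scalar`) and `Φ^{⊙1}` is `Φ` (see `tpow`). -/
def symPow (k : ℕ) : LBSpace.{u} where
  E := ↥(⨆ n, Φ.symStep k n)
  step := fun n => (Φ.symStep k n).comap (⨆ n, Φ.symStep k n).subtype
  step_mono := fun _ _ h => Submodule.comap_mono (Φ.symStep_mono k h)
  exists_mem_step := by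
    rintro ⟨x, hx⟩
    obtain ⟨n, hn⟩ :=
      (Submodule.mem_iSup_of_directed _ (Φ.symStep_mono k).directed_le).1 hx
    exact ⟨n, hn⟩
  isComplete_step := by
    intro n
    have hu : IsUniformInducing ((↑) : ↥(⨆ n, Φ.symStep k n) → Φ.Form k) :=
      isUniformEmbedding_subtype_val.isUniformInducing
    rw [← hu.isComplete_iff]
    have : (Subtype.val '' (((Φ.symStep k n).comap (⨆ n, Φ.symStep k n).subtype :
        Submodule ℂ ↥(⨆ n, Φ.symStep k n)) : Set ↥(⨆ n, Φ.symStep k n))) =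
        (Φ.symStep k n : Set (Φ.Form k)) := by
      ext f
      constructor
      · rintro ⟨g, hg, rfl⟩
        exact hg
      · intro hf
        exact ⟨⟨f, Submodule.mem_iSup_of_mem n hf⟩, hf, rfl⟩
    rw [this]
    exact (Φ.isClosed_symStep k n).isComplete

/-- An element of `Φ^{⊙k}`, regarded as a form. -/
def toForm {k : ℕ} : (Φ.symPow k).Sp →ₗ[ℂ] Φ.Form k :=
  (⨆ n, Φ.symStep k n).subtype ∘ₗ (Φ.symPow k).toSp.symm.toLinearMap

lemma pureTensor_const_mem (k : ℕ) (ξ : Φ.E) :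
    Φ.pureTensor (fun _ : Fin k => ξ) ∈ ⨆ n, Φ.symStep k n := by
  obtain ⟨n, hn⟩ := Φ.exists_mem_step ξ
  refine Submodule.mem_iSup_of_mem n ⟨?_, ?_⟩
  · exact Submodule.le_topologicalClosure _ (Submodule.subset_span ⟨_, fun _ => hn, rfl⟩)
  · intro π
    ext ν
    simp only [ContinuousMultilinearMap.domDomCongr_apply, pureTensor_apply]
    exact Equiv.prod_comp π fun i => Φ.evalL ξ (ν i)

/-- The tensor power `ξ^{⊗k}`. For `k = 1` this is the identification of `Φ` with `Φ^{⊙1}`. -/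
def tpow (k : ℕ) (ξ : Φ.E) : (Φ.symPow k).Sp :=
  (Φ.symPow k).toSp ⟨Φ.pureTensor (fun _ : Fin k => ξ), Φ.pureTensor_const_mem k ξ⟩

/-- The identification of `Φ^{⊙0}` with `ℂ`. -/
def scalar (c : (Φ.symPow 0).Sp) : ℂ := Φ.toForm c 0

/-- The tensor product of two forms. -/
def tmul {i j : ℕ} (f : Φ.Form i) (g : Φ.Form j) : Φ.Form (i + j) where
  toFun := fun ν => f (fun a => ν (Fin.castAdd j a)) * g (fun b => ν (Fin.natAdd i b))
  map_update_add' := by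
    intro d ν c x y
    obtain rfl : d = instDecidableEqFin (i + j) := Subsingleton.elim _ _
    induction c using Fin.addCases with
    | left a =>
      have h : ∀ z, (fun b => Function.update ν (Fin.castAdd j a) z (Fin.castAdd j b)) =
          Function.update (fun b => ν (Fin.castAdd j b)) a z := fun z =>
        Function.update_comp_eq_of_injective' ν (Fin.castAdd_injective i j) a z
      have h' : ∀ z, (fun b => Function.update ν (Fin.castAdd j a) z (Fin.natAdd i b)) =
          fun b => ν (Fin.natAdd i b) := fun z => by
        funext b
        refine Function.update_of_ne (fun e => ?_) _ _
        have := congrArg Fin.val e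
        simp at this
        omega
      simp only [h, h', ContinuousMultilinearMap.map_update_add, add_mul]
    | right a =>
      have h : ∀ z, (fun b => Function.update ν (Fin.natAdd i a) z (Fin.natAdd i b)) =
          Function.update (fun b => ν (Fin.natAdd i b)) a z := fun z =>
        Function.update_comp_eq_of_injective' ν (Fin.natAdd_injective j i) a z
      have h' : ∀ z, (fun b => Function.update ν (Fin.natAdd i a) z (Fin.castAdd j b)) =
          fun b => ν (Fin.castAdd j b) := fun z => by
        funext b
        refine Function.update_of_ne (fun e => ?_) _ _
        have := congrArg Fin.val e
        simp at this
        omega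
      simp only [h, h', ContinuousMultilinearMap.map_update_add, mul_add]
  map_update_smul' := by
    intro d ν c r x
    obtain rfl : d = instDecidableEqFin (i + j) := Subsingleton.elim _ _
    induction c using Fin.addCases with
    | left a =>
      have h : ∀ z, (fun b => Function.update ν (Fin.castAdd j a) z (Fin.castAdd j b)) =
          Function.update (fun b => ν (Fin.castAdd j b)) a z := fun z =>
        Function.update_comp_eq_of_injective' ν (Fin.castAdd_injective i j) a z
      have h' : ∀ z, (fun b => Function.update ν (Fin.castAdd j a) z (Fin.natAdd i b)) =
          fun b => ν (Fin.natAdd i b) := fun z => by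
        funext b
        refine Function.update_of_ne (fun e => ?_) _ _
        have := congrArg Fin.val e
        simp at this
        omega
      simp only [h, h', ContinuousMultilinearMap.map_update_smul, smul_eq_mul, mul_assoc]
    | right a =>
      have h : ∀ z, (fun b => Function.update ν (Fin.natAdd i a) z (Fin.natAdd i b)) =
          Function.update (fun b => ν (Fin.natAdd i b)) a z := fun z =>
        Function.update_comp_eq_of_injective' ν (Fin.natAdd_injective j i) a z
      have h' : ∀ z, (fun b => Function.update ν (Fin.natAdd i a) z (Fin.castAdd j b)) =
          fun b => ν (Fin.castAdd j b) := fun z => by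
        funext b
        refine Function.update_of_ne (fun e => ?_) _ _
        have := congrArg Fin.val e
        simp at this
        omega
      simp only [h, h', ContinuousMultilinearMap.map_update_smul, smul_eq_mul]
      ring
  cont := by
    refine Continuous.mul (f.cont.comp ?_) (g.cont.comp ?_)
    · exact continuous_pi fun a => continuous_apply _
    · exact continuous_pi fun a => continuous_apply _

/-- The space `𝓛(Φ^{⊙k}, Φ^{⊙i})`. -/
abbrev Op (k i : ℕ) : Type u := (Φ.symPow k).Sp →L[ℂ] (Φ.symPow i).Sp

/-- The continuous linear operator `Φ^{⊙k} → Φ^{⊙i}` with the prescribed values `g ξ` on the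
tensor powers `ξ^{⊗k}`. (A continuous linear operator on `Φ^{⊙k}` is determined by its values
on them.) -/
def ofPowers (k i : ℕ) (g : Φ.E → Φ.Form i) : Φ.Op k i :=
  Classical.epsilon fun C : Φ.Op k i => ∀ ξ, Φ.toForm (C (Φ.tpow k ξ)) = g ξ

/-- The symmetric tensor product `A₁ ⊙ A₂ ∈ 𝓛(Φ^{⊙k}, Φ^{⊙(j₁+j₂)})` of
`A₁ ∈ 𝓛(Φ^{⊙i₁}, Φ^{⊙j₁})` and `A₂ ∈ 𝓛(Φ^{⊙i₂}, Φ^{⊙j₂})`, the restriction of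
`Sym (A₁ ⊗ A₂)`, which maps `ξ^{⊗(i₁+i₂)}` to `Sym (A₁ ξ^{⊗i₁} ⊗ A₂ ξ^{⊗i₂})`. It is only used
with `k = i₁ + i₂`; the separate index `k` avoids casts between equal indices. -/
def odot (k : ℕ) {i₁ i₂ j₁ j₂ : ℕ} (A₁ : Φ.Op i₁ j₁) (A₂ : Φ.Op i₂ j₂) : Φ.Op k (j₁ + j₂) :=
  Φ.ofPowers k (j₁ + j₂) fun ξ =>
    Φ.sym (Φ.tmul (Φ.toForm (A₁ (Φ.tpow i₁ ξ))) (Φ.toForm (A₂ (Φ.tpow i₂ ξ))))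

/-- The functional `σ₁ ⊙ ⋯ ⊙ σₖ ∈ (Φ^{⊙k})'`, with `⟨σ₁ ⊙ ⋯ ⊙ σₖ, ξ^{⊗k}⟩ = σ₁(ξ) ⋯ σₖ(ξ)`. -/
def dualTensor {k : ℕ} (σ : Fin k → Φ.Dual) : Φ.Op k 0 :=
  Φ.ofPowers k 0 fun ξ =>
    ContinuousMultilinearMap.constOfIsEmpty ℂ _ (∏ i, σ i (Φ.toSp ξ))

/-- The functional `ω^{⊗k} ∈ (Φ^{⊙k})'`. -/
def dualPow (ω : Φ.Dual) (k : ℕ) : Φ.Op k 0 := Φ.dualTensor fun _ : Fin k => ω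

/-! ### Formal tensor power series -/

/-- Sequences `(Cₖ)` of operators `Cₖ ∈ 𝓛(Φ^{⊙k}, Φ^{⊙i})`, the coefficients of the formal tensor
power series `C(ξ) = ∑ₖ Cₖ ξ^{⊗k}` with values in `Φ^{⊙i}`. -/
def Series (i : ℕ) : Type u := ∀ k : ℕ, Φ.Op k i

instance (i : ℕ) : AddCommGroup (Φ.Series i) := inferInstanceAs (AddCommGroup (∀ k, Φ.Op k i))

instance (i : ℕ) : Module ℂ (Φ.Series i) := inferInstanceAs (Module ℂ (∀ k, Φ.Op k i))

/-- The product of the topologies of the spaces `𝓛(Φ^{⊙k}, Φ^{⊙i})`. -/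
instance (i : ℕ) : TopologicalSpace (Φ.Series i) :=
  ⨅ k, TopologicalSpace.induced (fun C : Φ.Series i => C k)
    (homTopology (Φ.symPow k) (Φ.symPow i))

/-- The scalar series `1`. -/
def oneS : Φ.Series 0
  | 0 => ContinuousLinearMap.id ℂ _
  | _ + 1 => 0

/-- The series `ξ` with values in `Φ`. -/
def idS : Φ.Series 1
  | 0 => 0
  | 1 => ContinuousLinearMap.id ℂ _
  | _ + 2 => 0

/-- The symmetric tensor product `B(ξ) ⊙ C(ξ)`; for `i = j = 0` this is the usual product. -/
def mulS {i j : ℕ} (B : Φ.Series i) (C : Φ.Series j) : Φ.Series (i + j) := fun k =>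
  ∑ a ∈ Finset.HasAntidiagonal.antidiagonal k, Φ.odot k (B a.1) (C a.2)

/-- The powers `B(ξ)^{⊙l}` of a series with values in `Φ`. -/
def powS (B : Φ.Series 1) : (l : ℕ) → Φ.Series l
  | 0 => Φ.oneS
  | l + 1 => Φ.mulS (powS B l) B

/-- The composition `C(B(ξ)) = ∑ₗ Cₗ B(ξ)^{⊙l}`, for `B` without constant term. -/
def compS {i : ℕ} (C : Φ.Series i) (B : Φ.Series 1) : Φ.Series i := fun k =>
  ∑ l ∈ Finset.range (k + 1), (C l).comp (Φ.powS B l k)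

/-- The powers `α(ξ)ⁿ` of a scalar series. -/
def spowS (α : Φ.Series 0) : ℕ → Φ.Series 0
  | 0 => Φ.oneS
  | n + 1 => Φ.mulS (spowS α n) α

/-- The exponential `exp(α(ξ)) = ∑ₙ α(ξ)ⁿ / n!`, for `α` without constant term. -/
def expS (α : Φ.Series 0) : Φ.Series 0 := fun k =>
  ∑ n ∈ Finset.range (k + 1), (n.factorial : ℂ)⁻¹ • Φ.spowS α n k

/-- The derivative `D_B C(ξ) = ∑ₗ l Cₗ(ξ^{⊗(l-1)} ⊙ B(ξ))` of `C(ξ)` in the direction `B(ξ)`,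
for `B` without constant term; its `k`-th coefficient is
`∑_{l=1}^{k} l Cₗ (𝟏_{l-1} ⊙ B_{k-l+1})` (and `l = m + 1` below). -/
def derivS (B : Φ.Series 1) {i : ℕ} (C : Φ.Series i) : Φ.Series i := fun k =>
  ∑ m ∈ Finset.range k, ((m + 1 : ℕ) : ℂ) •
    (C (m + 1)).comp (Φ.odot k (ContinuousLinearMap.id ℂ (Φ.symPow m).Sp) (B (k - m)))

/-- The scalar series `⟨ω, B(ξ)⟩`. -/
def pairS (ω : Φ.Dual) (B : Φ.Series 1) : Φ.Series 0 := fun k => (Φ.dualPow ω 1).comp (B k)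

/-- `𝓦₀(Φ)`: the scalar series `∑_{k ≥ 1} αₖ ξ^{⊗k}`. -/
def W0 : Set (Φ.Series 0) := {α | α 0 = 0}

/-- `𝓦₁(Φ)`: the series `∑_{k ≥ 2} βₖ ξ^{⊗k}` with values in `Φ`. -/
def W1 : Set (Φ.Series 1) := {β | β 0 = 0 ∧ β 1 = 0}

/-- `𝓕₀(Φ)`: the scalar series with `A₀ = 1`. -/
def F0 : Set (Φ.Series 0) := {A | A 0 = ContinuousLinearMap.id ℂ _}

/-- `𝓕₁(Φ)`: the series `∑_{k ≥ 1} Bₖ ξ^{⊗k}` with values in `Φ` and with `B₁ = 𝟏`. -/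
def F1 : Set (Φ.Series 1) := {B | B 0 = 0 ∧ B 1 = ContinuousLinearMap.id ℂ _}

/-! ### The group `𝓢(Φ)` and its exponential map -/

/-- The product of the group `𝓢(Φ) = 𝓕₀(Φ) × 𝓕₁(Φ)`. -/
def mulPair (x y : Φ.Series 0 × Φ.Series 1) : Φ.Series 0 × Φ.Series 1 :=
  (Φ.mulS (Φ.compS x.1 y.2) y.1, Φ.compS x.2 y.2)

/-- `d` is the derivative at `t` of the curve `c` in a topological vector space. -/
def HasCurveDeriv {V : Type*} [AddCommGroup V] [Module ℂ V] [TopologicalSpace V]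
    (c : ℝ → V) (d : V) (t : ℝ) : Prop :=
  Tendsto (fun h : ℝ => (h : ℂ)⁻¹ • (c (t + h) - c t)) (𝓝[≠] 0) (𝓝 d)

/-- `γ` is a one-parameter subgroup of the Lie group `𝓢(Φ)` with tangent vector `v` at the
identity. Smoothness and tangent vectors refer to the global parametrization
`(α, β) ↦ (1 + α, ξ + β)`; `D n` is the `n`-th derivative. -/
def IsOneParamSubgroup (γ : ℝ → Φ.Series 0 × Φ.Series 1) (v : Φ.Series 0 × Φ.Series 1) : Prop :=
  (∀ t, γ t ∈ Φ.F0 ×ˢ Φ.F1) ∧ γ 0 = (Φ.oneS, Φ.idS) ∧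
  (∀ s t, γ (s + t) = Φ.mulPair (γ s) (γ t)) ∧
  ∃ D : ℕ → ℝ → Φ.Series 0 × Φ.Series 1,
    (∀ t, D 0 t = γ t - (Φ.oneS, Φ.idS)) ∧ (∀ n t, HasCurveDeriv (D n) (D (n + 1) t) t) ∧
    D 1 0 = v

/-- The exponential map `EXP : 𝓦(Φ) → 𝓢(Φ)`: the value at time `1` of the one-parameter subgroup
with the given tangent vector. -/
def EXP (v : Φ.Series 0 × Φ.Series 1) : Φ.Series 0 × Φ.Series 1 :=
  (Classical.epsilon fun γ : ℝ → Φ.Series 0 × Φ.Series 1 => Φ.IsOneParamSubgroup γ v) 1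

/-! ### Polynomials on `Φ'` and operators -/

/-- The monomial `ω ↦ ⟨ω^{⊗k}, f⟩`. -/
def monomialFun (k : ℕ) : (Φ.symPow k).Sp →ₗ[ℂ] (Φ.Dual → ℂ) where
  toFun := fun f ω => Φ.scalar (Φ.dualPow ω k f)
  map_add' := by
    intro f g
    funext ω
    simp [scalar]
  map_smul' := by
    intro c f
    funext ω
    simp [scalar]

/-- The space `𝓟⁽ⁿ⁾(Φ')` of the polynomials on `Φ'` of degree at most `n`. -/
def polyLE (n : ℕ) : Submodule ℂ (Φ.Dual → ℂ) :=
  ⨆ k : Fin (n + 1), LinearMap.range (Φ.monomialFun k)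

/-- The space `𝓟(Φ')` of the polynomials on `Φ'`. -/
def Poly : Submodule ℂ (Φ.Dual → ℂ) := ⨆ k, LinearMap.range (Φ.monomialFun k)

/-- The monomial `ω ↦ ⟨ω^{⊗k}, f⟩`, as an element of `𝓟(Φ')`. -/
def monomial (k : ℕ) : (Φ.symPow k).Sp →ₗ[ℂ] Φ.Poly :=
  (Φ.monomialFun k).codRestrict Φ.Poly fun f =>
    Submodule.mem_iSup_of_mem k ⟨f, rfl⟩

/-- The topology of `𝓟(Φ')`, that of the locally convex direct sum of the spaces `Φ^{⊙k}`. -/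
instance : TopologicalSpace Φ.Poly := finestLC (fun k => (Φ.symPow k).Sp) Φ.monomial

/-- The linear operators in `𝓟(Φ')`; their product is the composition. -/
abbrev PolyOp : Type u := Module.End ℂ Φ.Poly

/-- `𝕍(Φ)`: the continuous linear operators in `𝓟(Φ')` that map `𝓟⁽ⁿ⁾(Φ')` into `𝓟⁽ⁿ⁻¹⁾(Φ')` for
all `n`, with `𝓟⁽⁻¹⁾(Φ') = 0`. -/
def VV : Set Φ.PolyOp :=
  {V | Continuous V ∧ (∀ p : Φ.Poly, (p : Φ.Dual → ℂ) ∈ Φ.polyLE 0 → V p = 0) ∧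
    ∀ (n : ℕ) (p : Φ.Poly), (p : Φ.Dual → ℂ) ∈ Φ.polyLE (n + 1) →
      (V p : Φ.Dual → ℂ) ∈ Φ.polyLE n}

/-- `𝕄(Φ) = 𝟏 + 𝕍(Φ)`: the operators that define monic polynomial sequences. -/
def MM : Set Φ.PolyOp := {P | P - 1 ∈ Φ.VV}

/-- The block matrix `[Q_{ik}]` of an operator `Q`, with `Q_{ik} ∈ 𝓛(Φ^{⊙k}, Φ^{⊙i})`, for `Q`
that maps `𝓟⁽ⁿ⁾(Φ')` into itself for all `n`. -/
def block (Q : Φ.PolyOp) : ∀ i k : ℕ, Φ.Op k i :=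
  Classical.epsilon fun B : ∀ i k : ℕ, Φ.Op k i => (∀ i k, k < i → B i k = 0) ∧
    ∀ (k : ℕ) (f : (Φ.symPow k).Sp),
      Q (Φ.monomial k f) = ∑ i ∈ Finset.range (k + 1), Φ.monomial i (B i k f)

/-- The topology of the product of the spaces `𝓛(Φ^{⊙k}, Φ^{⊙i})` on operators with a block
matrix. -/
@[reducible] def opTopology : TopologicalSpace Φ.PolyOp :=
  ⨅ (i : ℕ) (k : ℕ), TopologicalSpace.induced (fun Q => Φ.block Q i k)
    (homTopology (Φ.symPow k) (Φ.symPow i))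

open Classical in
/-- The sum of a series of operators that is a finite sum on every polynomial. -/
def opSum (T : ℕ → Φ.PolyOp) : Φ.PolyOp :=
  if h : ∀ p, (Function.support fun n => T n p).Finite then
    { toFun := fun p => ∑ᶠ n, T n p
      map_add' := fun p q => by
        simp only [map_add]
        exact finsum_add_distrib (h p) (h q)
      map_smul' := fun c p => by
        simp only [map_smul, RingHom.id_apply]
        exact (smul_finsum' c (h p)).symm }
  else 0

/-- `exp(V) = ∑_{n ≥ 0} Vⁿ / n!`, for `V ∈ 𝕍(Φ)`. -/
def expOp (V : Φ.PolyOp) : Φ.PolyOp := Φ.opSum fun n => (n.factorial : ℂ)⁻¹ • V ^ n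

/-- `log(P) = ∑_{n ≥ 1} (-1)^{n+1} (P - 𝟏)ⁿ / n`, for `P ∈ 𝕄(Φ)`. -/
def logOp (P : Φ.PolyOp) : Φ.PolyOp :=
  Φ.opSum fun n => ((-1) ^ n / (n + 1 : ℂ)) • (P - 1) ^ (n + 1)

/-! ### The Sheffer group and its Lie algebra -/

/-- The generating function `∑ₖ (1/k!) (P⟨·^{⊗k}, ξ^{⊗k}⟩)(ω)` of the operator `P` is
`exp[⟨ω, B(ξ)⟩] A(ξ)`, as formal tensor power series, for all `ω ∈ Φ'`. -/
def HasGenFun (P : Φ.PolyOp) (A : Φ.Series 0) (B : Φ.Series 1) : Prop :=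
  ∀ (ω : Φ.Dual) (k : ℕ) (f : (Φ.symPow k).Sp),
    (k.factorial : ℂ)⁻¹ * (P (Φ.monomial k f) : Φ.Dual → ℂ) ω =
      Φ.scalar ((Φ.mulS (Φ.expS (Φ.pairS ω B)) A : Φ.Series 0) k f)

/-- The Sheffer group `𝕊(Φ)`. -/
def SS : Set Φ.PolyOp := {P | P ∈ Φ.MM ∧ ∃ A ∈ Φ.F0, ∃ B ∈ Φ.F1, Φ.HasGenFun P A B}

/-- `𝔰(Φ) = log(𝕊(Φ))`. -/
def lieS : Set Φ.PolyOp := Φ.logOp '' Φ.SS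

/-- The map `𝓘 : 𝓢(Φ) → 𝕊(Φ)` that sends `(A, B)` to the Sheffer operator with generating function
`exp[⟨ω, B(ξ)⟩] A(ξ)`. -/
def shefferOp (x : Φ.Series 0 × Φ.Series 1) : Φ.PolyOp :=
  Classical.epsilon fun P : Φ.PolyOp => P ∈ Φ.MM ∧ Φ.HasGenFun P x.1 x.2

/-- The map `𝓡 = log ∘ 𝓘 ∘ EXP : 𝓦(Φ) → 𝔰(Φ)`. -/
def R (α : Φ.Series 0) (β : Φ.Series 1) : Φ.PolyOp :=
  Φ.logOp (Φ.shefferOp (Φ.EXP (α, β)))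

/-- `b` is the coefficient of `s₁ s₂` in the Taylor expansion at `(0, 0)`, in the space `𝔰(Φ)`, of
the function `h(s₁, s₂) = log(exp(s₁ V) exp(s₂ W))`. -/
def IsMixedCoeff (V W b : Φ.PolyOp) : Prop :=
  ∃ c : ℕ × ℕ → Φ.PolyOp, (∀ m, c m ∈ Φ.lieS) ∧
    (∀ s₁ s₂ : ℂ, @HasSum _ _ _ Φ.opTopology (fun m : ℕ × ℕ => (s₁ ^ m.1 * s₂ ^ m.2) • c m)
      (Φ.logOp (Φ.expOp (s₁ • V) * Φ.expOp (s₂ • W))) (SummationFilter.unconditional _)) ∧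
    c (1, 1) = b

/-- `x` is the Lie bracket of `V` and `W` in the Lie algebra `𝔰(Φ)` of the Lie group `𝕊(Φ)` with
the global parametrization `exp : 𝔰(Φ) → 𝕊(Φ)`: `x = b(V, W) - b(W, V)`, where
`log(exp(s₁ V) exp(s₂ W)) = s₁ V + s₂ W + s₁ s₂ b(V, W) + ⋯`. -/
def IsLieBracket (V W x : Φ.PolyOp) : Prop :=
  ∃ b b' : Φ.PolyOp, Φ.IsMixedCoeff V W b ∧ Φ.IsMixedCoeff W V b' ∧ x = b - b'

/-! ### The operators `α(∇)` and `M(β(∇))` -/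

/-- The derivative `D_σ q` of a function on `Φ'` in the direction `σ ∈ Φ'`. -/
def dirDeriv (σ : Φ.Dual) (q : Φ.Dual → ℂ) : Φ.Dual → ℂ := fun ω =>
  deriv (fun t : ℂ => q (ω + t • σ)) 0

/-- The iterated derivative `D_{σ₁} ⋯ D_{σₖ} q`. -/
def iterDeriv (q : Φ.Dual → ℂ) : (k : ℕ) → (Fin k → Φ.Dual) → Φ.Dual → ℂ
  | 0, _ => q
  | k + 1, σ => Φ.dirDeriv (σ 0) (iterDeriv q k (Fin.tail σ))

/-- The `k`-th power of the gradient: for a polynomial `q`, the element `(∇ᵏ q)(ω)` of `Φ^{⊙k}` with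
`(D_{σ₁} ⋯ D_{σₖ} q)(ω) = ⟨σ₁ ⊙ ⋯ ⊙ σₖ, (∇ᵏ q)(ω)⟩` for all `σ₁, …, σₖ ∈ Φ'`. -/
def gradPow (k : ℕ) (q : Φ.Dual → ℂ) (ω : Φ.Dual) : (Φ.symPow k).Sp :=
  Classical.epsilon fun g : (Φ.symPow k).Sp =>
    ∀ σ : Fin k → Φ.Dual, Φ.iterDeriv q k σ ω = Φ.scalar (Φ.dualTensor σ g)

/-- The operator `α(∇) = ∑ₖ αₖ ∇ᵏ`; the sum is finite on polynomials. -/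
def nablaOp (α : Φ.Series 0) (q : Φ.Dual → ℂ) : Φ.Dual → ℂ := fun ω =>
  ∑ᶠ k : ℕ, Φ.scalar (α k (Φ.gradPow k q ω))

/-- The operator `M(β(∇)) = ∑ₖ M(βₖ ∇ᵏ)`, with `(M(βₖ ∇ᵏ) q)(ω) = ⟨ω, βₖ((∇ᵏ q)(ω))⟩`; the sum is
finite on polynomials. -/
def mulNablaOp (β : Φ.Series 1) (q : Φ.Dual → ℂ) : Φ.Dual → ℂ := fun ω =>
  ∑ᶠ k : ℕ, Φ.scalar (Φ.dualPow ω 1 (β k (Φ.gradPow k q ω)))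

/-- The operator `α(∇) + M(β(∇))`. -/
def diffOp (α : Φ.Series 0) (β : Φ.Series 1) (q : Φ.Dual → ℂ) : Φ.Dual → ℂ :=
  Φ.nablaOp α q + Φ.mulNablaOp β q

end LBSpace

end

/-! ### Universal property of inductive limits, and operators between (LB)-spaces -/

noncomputable section

/-! The proof transposes everything to scalar series. Pairing a series F with polynomials by
⟨ω^{⊗k}, f⟩ ↦ k! F_k f turns evaluation at ω into the pairing with exp⟨ω, ξ⟩
(`coe_apply_eq_pairing`). A Sheffer operator is then one whose transpose sends exp⟨ω, ξ⟩ to exp⟨ω,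
B(ξ)⟩ A(ξ) for every ω (`hasGenFun_iff`). The operator V = α(∇) + M(β(∇)), here `vOp`, has as its
transpose the first-order operator F ↦ Fα + D_β F, here `dualL` (`pairing_vOp`).

Since α has no constant term and β starts in degree two, `dualL` and D_β raise the order, and their
exponentials are finite sums in each degree. The exponential exp(t D_β) of a derivation is
multiplicative (`expSer_mulS`), hence it is substitution of the flow B_t = exp(t D_β) ξ
(`compS_flowB`). Likewise exp(t `dualL`) is this substitution followed by multiplication by A_t =
exp(t `dualL`) 1 (`expSer_dualL`). Two facts follow: (A_t, B_t) is a one-parameter subgroup with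
tangent vector (α, β), and exp(V) has the generating function exp⟨ω, B_1⟩ A_1. One-parameter
subgroups are unique, because their coefficients solve a triangular system of differential equations
(`IsOneParamSubgroup.unique`). So 𝓘(EXP(α, β)) = exp(V), and log undoes exp on operators that lower
the degree (`logOp_expOp`); this is `R_eq_vOp`. The description of V by gradients is `diffOp_coe`.

EXP is onto: B_1 has k-th coefficient β_k plus a term in lower coefficients of β, and for fixed β
the same holds for A_1 and α (`exists_flowB_eq`, `exists_flowA_eq`). Hence 𝔰(Φ) consists exactly of
the operators V (`mem_lieS_iff`) and is a linear space. A commutator of derivations is a derivation,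
which gives `dualL_commutator` and, by transposition, `vOp_commutator`. On polynomials of bounded
degree, log(exp(sV) exp(tW)) is a polynomial in s and t with st-coefficient VW − ½(VW + WV). Its
coefficients stay in 𝔰(Φ), the expansion is unique (`IsMixedCoeff.unique`), and antisymmetrization
leaves VW − WV.

All identities between tensor series are checked in ℂ[[z]] (`gen_ext`): operators are determined by
their values on the powers ξ^{⊗k} (`ext_powers`), and symmetric tensors by their values at ω^{⊗k}
(`ext_ev`). -/

/-- The topology induced by `φ` is itself a locally convex vector space topology that makes every `j
i` continuous, so it is one of those over which the infimum is taken. -/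
lemma continuous_of_finestLC {ι : Type*} {Y : Type*} [AddCommGroup Y] [Module ℂ Y] (X : ι → Type*)
    [∀ i, AddCommGroup (X i)] [∀ i, Module ℂ (X i)] [∀ i, TopologicalSpace (X i)]
    (j : ∀ i, X i →ₗ[ℂ] Y) {Z : Type*} [AddCommGroup Z] [Module ℂ Z] [tZ : TopologicalSpace Z]
    [IsTopologicalAddGroup Z] [ContinuousSMul ℂ Z] [LocallyConvexSpace ℝ Z] (φ : Y →ₗ[ℂ] Z)
    (h : ∀ i, Continuous fun x => φ (j i x)) : Continuous[finestLC X j, tZ] φ := by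
  rw [continuous_iff_le_induced]
  refine sInf_le ⟨topologicalAddGroup_induced φ, ?_, ?_, fun i => continuous_induced_rng.2 (h i)⟩
  · exact continuousSMul_induced φ
  · exact LocallyConvexSpace.induced (𝕜 := ℝ) (φ.restrictScalars ℝ)

lemma isTopologicalAddGroup_finestLC {ι : Type*} {Y : Type*} [AddCommGroup Y] [Module ℂ Y]
    (X : ι → Type*) [∀ i, AddCommGroup (X i)] [∀ i, Module ℂ (X i)] [∀ i, TopologicalSpace (X i)]
    (j : ∀ i, X i →ₗ[ℂ] Y) : @IsTopologicalAddGroup Y (finestLC X j) _ :=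
  topologicalAddGroup_sInf fun _ ht => ht.1

lemma continuousSMul_finestLC {ι : Type*} {Y : Type*} [AddCommGroup Y] [Module ℂ Y]
    (X : ι → Type*) [∀ i, AddCommGroup (X i)] [∀ i, Module ℂ (X i)] [∀ i, TopologicalSpace (X i)]
    (j : ∀ i, X i →ₗ[ℂ] Y) : @ContinuousSMul ℂ Y _ _ (finestLC X j) :=
  continuousSMul_sInf fun _ ht => ht.2.1

lemma locallyConvexSpace_finestLC {ι : Type*} {Y : Type*} [AddCommGroup Y] [Module ℂ Y]
    (X : ι → Type*) [∀ i, AddCommGroup (X i)] [∀ i, Module ℂ (X i)] [∀ i, TopologicalSpace (X i)]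
    (j : ∀ i, X i →ₗ[ℂ] Y) : @LocallyConvexSpace ℝ Y _ _ _ _ (finestLC X j) :=
  LocallyConvexSpace.sInf fun _ ht => ht.2.2.1

lemma continuous_finestLC_incl {ι : Type*} {Y : Type*} [AddCommGroup Y] [Module ℂ Y]
    (X : ι → Type*) [∀ i, AddCommGroup (X i)] [∀ i, Module ℂ (X i)] [∀ i, TopologicalSpace (X i)]
    (j : ∀ i, X i →ₗ[ℂ] Y) (i : ι) : Continuous[_, finestLC X j] (j i) :=
  continuous_sInf_rng.2 fun _ ht => ht.2.2.2 i

namespace LBSpace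

/-- The identity from the locally convex space to the normed space is continuous. -/
def ofSp (Φ : LBSpace.{u}) : Φ.Sp →L[ℂ] Φ.E where
  toLinearMap := Φ.toSp.symm.toLinearMap
  cont := continuous_of_finestLC (fun n => Φ.step n) Φ.stepIncl Φ.toSp.symm.toLinearMap
    fun _ => continuous_subtype_val

@[simp] lemma toSp_ofSp (Φ : LBSpace.{u}) (x : Φ.Sp) : Φ.toSp (Φ.ofSp x) = x := rfl

lemma ofSp_injective (Φ : LBSpace.{u}) : Function.Injective Φ.ofSp := fun _ _ h => h

lemma exists_ofSp_mem (Φ : LBSpace.{u}) (x : Φ.Sp) : ∃ n, Φ.ofSp x ∈ Φ.step n :=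
  Φ.exists_mem_step x

/-- A continuous linear operator maps every step boundedly into some step. -/
lemma exists_step_bound {Φ : LBSpace.{u}} {Ψ : LBSpace.{v}} (C : Φ.Sp →L[ℂ] Ψ.Sp) (n : ℕ) :
    ∃ (m : ℕ) (K : ℝ), 0 ≤ K ∧ ∀ x ∈ Φ.step n,
      Ψ.ofSp (C (Φ.toSp x)) ∈ Ψ.step m ∧ ‖Ψ.ofSp (C (Φ.toSp x))‖ ≤ K * ‖x‖ := by
  have hc : CompleteSpace (Φ.step n) := (Φ.isComplete_step n).completeSpace_coe
  let T : Φ.step n →L[ℂ] Ψ.E := (Ψ.ofSp.comp C).comp (Φ.stepInclL n)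
  have hcl : ∀ m, IsClosed ((((Ψ.step m).comap T.toLinearMap : Submodule ℂ (Φ.step n))) :
      Set (Φ.step n)) := fun m =>
    (Ψ.isComplete_step m).isClosed.preimage T.continuous
  -- Baire: the preimages of the steps are closed subspaces that cover the Banach space `Φ.step n`,
  -- and a subspace with interior points is everything.
  obtain ⟨m, hm⟩ := nonempty_interior_of_iUnion_of_closed hcl (by
    rw [Set.eq_univ_iff_forall]
    intro x
    obtain ⟨m, hm⟩ := Ψ.exists_mem_step (T x)
    exact Set.mem_iUnion.2 ⟨m, hm⟩)
  have htop := Submodule.eq_top_of_nonempty_interior' _ hm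
  refine ⟨m, ‖T‖, T.opNorm_nonneg, fun x hx => ⟨?_, T.le_opNorm ⟨x, hx⟩⟩⟩
  have : (⟨x, hx⟩ : Φ.step n) ∈ (Ψ.step m).comap T.toLinearMap := htop ▸ Submodule.mem_top
  exact this

/-- A linear map that maps every step boundedly into some step is continuous. -/
lemma continuous_of_step_bound {Φ : LBSpace.{u}} {Ψ : LBSpace.{v}} (C : Φ.Sp →ₗ[ℂ] Ψ.Sp)
    (h : ∀ n, ∃ (m : ℕ) (K : ℝ), ∀ x ∈ Φ.step n,
      Ψ.ofSp (C (Φ.toSp x)) ∈ Ψ.step m ∧ ‖Ψ.ofSp (C (Φ.toSp x))‖ ≤ K * ‖x‖) : Continuous C := by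
  refine continuous_of_finestLC (fun n => Φ.step n) Φ.stepIncl C fun n => ?_
  obtain ⟨m, K, hK⟩ := h n
  let L : Φ.step n →ₗ[ℂ] Ψ.step m :=
    { toFun := fun x => ⟨Ψ.ofSp (C (Φ.toSp x)), (hK x x.2).1⟩
      map_add' := fun x y => by ext; simp
      map_smul' := fun c x => by ext; simp }
  have hL : Continuous L := (L.mkContinuous K fun x => (hK x x.2).2).continuous
  exact (Ψ.continuous_stepIncl m).comp hL

/-- Continuous functionals extend from a step to the normed space. -/
lemma exists_extension (Φ : LBSpace.{u}) (n : ℕ) (σ : Φ.Dual) :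
    ∃ ν : Φ.NDual, ∀ x ∈ Φ.step n, Φ.evalL x ν = σ (Φ.toSp x) := by
  obtain ⟨g, hg, -⟩ := exists_extension_norm_eq (Φ.step n) (σ.comp (Φ.stepInclL n))
  exact ⟨g, fun x hx => hg ⟨x, hx⟩⟩

/-- Functionals on the normed space are continuous on the locally convex space. -/
def ofNDual (Φ : LBSpace.{u}) (ν : Φ.NDual) : Φ.Dual :=
  ContinuousLinearMap.comp (show Φ.E →L[ℂ] ℂ from ν) Φ.ofSp

/-- Uniqueness of limits is what allows continuous operators into `Φ.Sp` to be compared on a dense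
set of tensors. -/
instance (Φ : LBSpace.{u}) : T2Space Φ.Sp :=
  T2Space.of_injective_continuous Φ.ofSp_injective Φ.ofSp.continuous

end LBSpace
end

/-! ### Symmetric tensors as limits of combinations of powers -/

noncomputable section
namespace LBSpace

variable (Φ : LBSpace.{u})

instance (k : ℕ) : NormedAddCommGroup (Φ.Form k) := inferInstance

instance (k : ℕ) : NormedSpace ℂ (Φ.Form k) := inferInstance

/-! ### Polarization and density of the tensor powers -/

lemma domDomCongr_pureTensor {k : ℕ} (π : Equiv.Perm (Fin k)) (b : Fin k → Φ.E) :
    (Φ.pureTensor b).domDomCongr π = Φ.pureTensor fun i => b (π.symm i) := by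
  ext ν
  simp only [ContinuousMultilinearMap.domDomCongr_apply, pureTensor_apply]
  exact Fintype.prod_equiv π _ _ fun i => by rw [Equiv.symm_apply_apply]

/-- The symmetrization as a continuous linear operator. -/
def symL (k : ℕ) : Φ.Form k →L[ℂ] Φ.Form k :=
  (k.factorial : ℂ)⁻¹ • ∑ π : Equiv.Perm (Fin k),
    ((ContinuousMultilinearMap.domDomCongrₗᵢ ℂ Φ.NDual ℂ π).toContinuousLinearEquiv :
      Φ.Form k →L[ℂ] Φ.Form k)

lemma symL_apply {k : ℕ} (f : Φ.Form k) : Φ.symL k f = Φ.sym f := by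
  simp only [symL, sym, _root_.smul_apply, _root_.sum_apply]
  rfl

lemma sym_apply {k : ℕ} (f : Φ.Form k) (ν : Fin k → Φ.NDual) :
    Φ.sym f ν = (k.factorial : ℂ)⁻¹ * ∑ π : Equiv.Perm (Fin k), f fun i => ν (π i) := by
  simp [sym]

lemma sym_apply_const {k : ℕ} (f : Φ.Form k) (ν : Φ.NDual) :
    Φ.sym f (fun _ => ν) = f fun _ => ν := by
  rw [sym_apply]
  have : (k.factorial : ℂ) ≠ 0 := by exact_mod_cast k.factorial_ne_zero
  simp [Fintype.card_perm, this]

lemma sym_of_mem_symForms {k : ℕ} {f : Φ.Form k} (hf : f ∈ Φ.symForms k) : Φ.sym f = f := by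
  have h : ∀ π : Equiv.Perm (Fin k), f.domDomCongr π = f := hf
  have : (k.factorial : ℂ) ≠ 0 := by exact_mod_cast k.factorial_ne_zero
  simp only [sym, h, Finset.sum_const, Finset.card_univ, Fintype.card_perm, Fintype.card_fin]
  rw [← Nat.cast_smul_eq_nsmul ℂ, smul_smul, inv_mul_cancel₀ this, one_smul]

lemma sym_mem_symForms {k : ℕ} (f : Φ.Form k) : Φ.sym f ∈ Φ.symForms k := by
  intro π
  ext ν
  simp only [ContinuousMultilinearMap.domDomCongr_apply, sym_apply]
  congr 1
  exact Fintype.sum_equiv (Equiv.mulLeft π) _ _ fun ρ => by simp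

lemma norm_sym_le {k : ℕ} (f : Φ.Form k) : ‖Φ.sym f‖ ≤ ‖f‖ := by
  have h0 : (0 : ℝ) < k.factorial := by exact_mod_cast k.factorial_pos
  rw [sym, norm_smul, norm_inv, Complex.norm_natCast, inv_mul_le_iff₀ h0]
  refine (norm_sum_le _ _).trans ?_
  have : ∀ π : Equiv.Perm (Fin k), ‖f.domDomCongr π‖ = ‖f‖ := fun π =>
    (ContinuousMultilinearMap.domDomCongrₗᵢ ℂ Φ.NDual ℂ π).norm_map f
  simp [this, Fintype.card_perm]

/-- The permutation sum is the k-th derivative at 0 of the diagonal map x ↦ f(x, …, x), which is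
identically zero. -/
lemma sum_perm_eq_zero_of_diag {E F : Type*} [NormedAddCommGroup E] [NormedSpace ℂ E]
    [NormedAddCommGroup F] [NormedSpace ℂ F] {k : ℕ}
    (f : ContinuousMultilinearMap ℂ (fun _ : Fin k => E) F) (h : ∀ x, f (fun _ => x) = 0)
    (v : Fin k → E) : ∑ π : Equiv.Perm (Fin k), f (fun i => v (π i)) = 0 := by
  rw [← ContinuousMultilinearMap.iteratedFDeriv_comp_diagonal f 0 v]
  have : (fun x => f fun _ => x) = fun _ => 0 := funext h
  rw [this, iteratedFDeriv_fun_zero]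
  rfl

/-- Polarization: a symmetric form that vanishes on the diagonal is zero. -/
lemma eq_zero_of_diag {k : ℕ} {f : Φ.Form k} (hf : f ∈ Φ.symForms k)
    (h : ∀ ν : Φ.NDual, f (fun _ => ν) = 0) : f = 0 := by
  rw [← Φ.sym_of_mem_symForms hf]
  ext ν
  rw [sym_apply, sum_perm_eq_zero_of_diag f h, mul_zero]
  rfl

/-- The elementary tensors as a continuous multilinear map. -/
def pureTensorL (k : ℕ) : ContinuousMultilinearMap ℂ (fun _ : Fin k => Φ.E) (Φ.Form k) :=
  ((ContinuousLinearMap.apply ℂ (Φ.Form k)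
    (ContinuousMultilinearMap.mkPiAlgebra ℂ (Fin k) ℂ)).compContinuousMultilinearMap
    (ContinuousMultilinearMap.compContinuousLinearMapContinuousMultilinear ℂ
      (fun _ : Fin k => Φ.NDual) (fun _ => ℂ) ℂ)).compContinuousLinearMap
    fun _ => (ContinuousLinearMap.apply ℂ ℂ : Φ.E →L[ℂ] (Φ.E →L[ℂ] ℂ) →L[ℂ] ℂ)

/-- The span of the tensor powers of elements of the `n`-th step. -/
def powerSpan (k n : ℕ) : Submodule ℂ (Φ.Form k) :=
  Submodule.span ℂ {f | ∃ ξ ∈ Φ.step n, Φ.pureTensor (fun _ : Fin k => ξ) = f}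

/-- Polarization modulo the closed span `S` of the powers: in the quotient by `S` the tensor map
vanishes on the diagonal, so its symmetrization vanishes too. -/
lemma sym_pureTensor_mem {k n : ℕ} (b : Fin k → Φ.E) (hb : ∀ i, b i ∈ Φ.step n) :
    Φ.sym (Φ.pureTensor b) ∈ (Φ.powerSpan k n).topologicalClosure := by
  set S := (Φ.powerSpan k n).topologicalClosure with hS
  have hSc : IsClosed (S : Set (Φ.Form k)) := Submodule.isClosed_topologicalClosure _
  let F : ContinuousMultilinearMap ℂ (fun _ : Fin k => Φ.step n) (Φ.Form k ⧸ S) :=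
    (S.mkQL.compContinuousMultilinearMap (Φ.pureTensorL k)).compContinuousLinearMap
      fun _ => (Φ.step n).subtypeL
  have hF : ∀ c : Fin k → Φ.step n, F c = S.mkQ (Φ.pureTensor fun i => (c i : Φ.E)) :=
    fun c => rfl
  have h := sum_perm_eq_zero_of_diag (F := Φ.Form k ⧸ S) (E := Φ.step n) F (fun x => by
    rw [hF, Submodule.mkQ_apply, Submodule.Quotient.mk_eq_zero]
    exact Submodule.le_topologicalClosure _ (Submodule.subset_span ⟨x, x.2, rfl⟩))
    fun i => ⟨b i, hb i⟩
  simp only [hF] at h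
  rw [← map_sum, Submodule.mkQ_apply, Submodule.Quotient.mk_eq_zero] at h
  refine S.smul_mem _ ?_
  convert h using 1
  -- Permuting the slots of the form permutes the vectors by the inverse permutation.
  refine Fintype.sum_equiv (Equiv.inv _) _ _ fun π => ?_
  rw [domDomCongr_pureTensor]
  rfl

/-- Symmetrization is continuous and fixes symmetric forms, so it suffices to symmetrize elementary
tensors. This density of the powers in each Banach step underlies every later comparison of
operators. -/
lemma symStep_le_closure (k n : ℕ) :
    Φ.symStep k n ≤ (Φ.powerSpan k n).topologicalClosure := by
  rintro f ⟨hf, hs⟩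
  rw [← Φ.sym_of_mem_symForms hs, ← symL_apply]
  have hcl : IsClosed ((((Φ.powerSpan k n).topologicalClosure).comap (Φ.symL k).toLinearMap :
      Submodule ℂ (Φ.Form k)) : Set (Φ.Form k)) :=
    (Submodule.isClosed_topologicalClosure _).preimage (Φ.symL k).continuous
  refine Submodule.topologicalClosure_minimal _ ?_ hcl hf
  refine Submodule.span_le.2 ?_
  rintro _ ⟨b, hb, rfl⟩
  change Φ.symL k _ ∈ (Φ.powerSpan k n).topologicalClosure
  rw [symL_apply]
  exact Φ.sym_pureTensor_mem b hb

lemma power_mem_symStep {k n : ℕ} {ξ : Φ.E} (h : ξ ∈ Φ.step n) :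
    Φ.pureTensor (fun _ : Fin k => ξ) ∈ Φ.symStep k n := by
  refine ⟨Submodule.le_topologicalClosure (Submodule.span ℂ _)
    (Submodule.subset_span ⟨_, fun _ => h, rfl⟩), ?_⟩
  intro π
  rw [domDomCongr_pureTensor]

lemma powerSpan_le (k n : ℕ) : Φ.powerSpan k n ≤ Φ.symStep k n := by
  refine Submodule.span_le.2 ?_
  rintro _ ⟨ξ, h, rfl⟩
  exact Φ.power_mem_symStep h

/-! ### Elements of the symmetric powers -/

/-- An element of `Φ^{⊙k}` from its form. -/
def ofForm {k n : ℕ} (f : Φ.Form k) (h : f ∈ Φ.symStep k n) : (Φ.symPow k).Sp :=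
  (Φ.symPow k).toSp ⟨f, Submodule.mem_iSup_of_mem n h⟩

@[simp] lemma toForm_ofForm {k n : ℕ} (f : Φ.Form k) (h : f ∈ Φ.symStep k n) :
    Φ.toForm (Φ.ofForm f h) = f := rfl

lemma toForm_injective (k : ℕ) : Function.Injective (Φ.toForm (k := k)) :=
  fun _ _ h => Subtype.ext h

@[simp] lemma toForm_tpow (k : ℕ) (ξ : Φ.E) :
    Φ.toForm (Φ.tpow k ξ) = Φ.pureTensor fun _ => ξ := rfl

lemma ofSp_mem_step_iff {k n : ℕ} (f : (Φ.symPow k).Sp) :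
    (Φ.symPow k).ofSp f ∈ (Φ.symPow k).step n ↔ Φ.toForm f ∈ Φ.symStep k n := Iff.rfl

lemma norm_ofSp {k : ℕ} (f : (Φ.symPow k).Sp) : ‖(Φ.symPow k).ofSp f‖ = ‖Φ.toForm f‖ := rfl

lemma exists_toForm_mem {k : ℕ} (f : (Φ.symPow k).Sp) : ∃ n, Φ.toForm f ∈ Φ.symStep k n :=
  (Φ.symPow k).exists_ofSp_mem f

lemma toForm_mem_symForms {k : ℕ} (f : (Φ.symPow k).Sp) : Φ.toForm f ∈ Φ.symForms k := by
  obtain ⟨n, hn⟩ := Φ.exists_toForm_mem f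
  exact hn.2

/-- The form of an element of `Φ^{⊙k}` depends continuously on it. -/
def toFormL (k : ℕ) : (Φ.symPow k).Sp →L[ℂ] Φ.Form k :=
  (⨆ n, Φ.symStep k n).subtypeL.comp (Φ.symPow k).ofSp

/-- A continuous linear map on `Φ^{⊙k}` is determined by its values on the powers of the elements
of a step, on that step. -/
lemma eq_zero_of_powers_step {k n : ℕ} {Z : Type*} [AddCommGroup Z] [Module ℂ Z]
    [TopologicalSpace Z] [T2Space Z] (D : (Φ.symPow k).Sp →L[ℂ] Z)
    (h : ∀ ξ ∈ Φ.step n, D (Φ.tpow k ξ) = 0) (f : (Φ.symPow k).Sp)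
    (hf : Φ.toForm f ∈ Φ.symStep k n) : D f = 0 := by
  have hmem : Φ.toForm f ∈ closure (Φ.powerSpan k n : Set (Φ.Form k)) :=
    Φ.symStep_le_closure k n hf
  obtain ⟨x, hx, hlim⟩ := mem_closure_iff_seq_limit.1 hmem
  have hx' : ∀ j, x j ∈ Φ.symStep k n := fun j => Φ.powerSpan_le k n (hx j)
  -- The approximating sequence stays in a single step, so it converges in that Banach space and
  -- therefore in the inductive limit topology, where `D` is continuous.
  let y : ℕ → (Φ.symPow k).step n := fun j =>
    ⟨⟨x j, Submodule.mem_iSup_of_mem n (hx' j)⟩, hx' j⟩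
  have hy : Tendsto y atTop (𝓝 ⟨(Φ.symPow k).ofSp f, hf⟩) :=
    tendsto_subtype_rng.2 (tendsto_subtype_rng.2 hlim)
  have hD := ((D.comp ((Φ.symPow k).stepInclL n)).continuous.tendsto _).comp hy
  have hz : ∀ g (hg : g ∈ Φ.powerSpan k n), D (Φ.ofForm g (Φ.powerSpan_le k n hg)) = 0 := by
    intro g hg
    induction hg using Submodule.span_induction with
    | mem g hg =>
      obtain ⟨ξ, hξ, rfl⟩ := hg
      exact h ξ hξ
    | zero => exact map_zero D
    | add g g' hg hg' ih ih' =>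
      have : Φ.ofForm (g + g') (Φ.powerSpan_le k n (add_mem hg hg')) =
        Φ.ofForm g (Φ.powerSpan_le k n hg) + Φ.ofForm g' (Φ.powerSpan_le k n hg') := rfl
      rw [this, map_add, ih, ih', add_zero]
    | smul c g hg ih =>
      have : Φ.ofForm (c • g) (Φ.powerSpan_le k n (Submodule.smul_mem _ c hg)) =
        c • Φ.ofForm g (Φ.powerSpan_le k n hg) := rfl
      rw [this, map_smul, ih, smul_zero]
  have hD0 : Tendsto (fun _ : ℕ => (0 : Z)) atTop (𝓝 (D f)) := by
    refine hD.congr fun j => ?_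
    exact hz (x j) (hx j)
  exact tendsto_nhds_unique hD0 tendsto_const_nhds

lemma ext_powers {k : ℕ} {Z : Type*} [AddCommGroup Z] [Module ℂ Z]
    [TopologicalSpace Z] [IsTopologicalAddGroup Z] [T2Space Z] {C D : (Φ.symPow k).Sp →L[ℂ] Z}
    (h : ∀ ξ, C (Φ.tpow k ξ) = D (Φ.tpow k ξ)) : C = D := by
  ext f
  obtain ⟨n, hn⟩ := Φ.exists_toForm_mem f
  rw [← sub_eq_zero]
  exact Φ.eq_zero_of_powers_step (C - D) (fun ξ _ => by simp [h]) f hn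

/-! ### Operators with prescribed values on the powers -/

/-- The bound makes the passage from a combination of powers to the same combination of the values
`g ξ` well defined and bounded; it then extends from the dense span to the whole step. -/
lemma exists_stepExtension {k n : ℕ} {F : Type*} [NormedAddCommGroup F] [NormedSpace ℂ F]
    [CompleteSpace F] (g : Φ.E → F) (K : ℝ) (hK : ∀ c : Φ.step n →₀ ℂ,
      ‖Finsupp.linearCombination ℂ (fun ξ : Φ.step n => g ξ) c‖ ≤
        K * ‖Finsupp.linearCombination ℂ
          (fun ξ : Φ.step n => Φ.pureTensor (fun _ : Fin k => (ξ : Φ.E))) c‖) :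
    ∃ T : Φ.symStep k n →L[ℂ] F, (∀ x, ‖T x‖ ≤ K * ‖x‖) ∧
      ∀ ξ (h : ξ ∈ Φ.step n), T ⟨_, Φ.power_mem_symStep h⟩ = g ξ := by
  let e : (Φ.step n →₀ ℂ) →ₗ[ℂ] Φ.symStep k n :=
    Finsupp.linearCombination ℂ (fun ξ : Φ.step n => ⟨_, Φ.power_mem_symStep ξ.2⟩)
  have he : ∀ c, (e c : Φ.Form k) = Finsupp.linearCombination ℂ
      (fun ξ : Φ.step n => Φ.pureTensor (fun _ : Fin k => (ξ : Φ.E))) c := by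
    intro c
    change (Φ.symStep k n).subtype (e c) = _
    rw [Finsupp.apply_linearCombination]
    rfl
  have hK' : ∀ c, ‖Finsupp.linearCombination ℂ (fun ξ : Φ.step n => g ξ) c‖ ≤ K * ‖e c‖ := by
    intro c
    have := hK c
    rwa [← he] at this
  have hd : DenseRange e := by
    rintro ⟨f, hf⟩
    rw [closure_subtype]
    have h1 : Subtype.val '' Set.range e = (Φ.powerSpan k n : Set (Φ.Form k)) := by
      have h2 : (Φ.powerSpan k n) = (LinearMap.range e).map (Φ.symStep k n).subtype := by
        rw [Finsupp.range_linearCombination, Submodule.map_span, powerSpan]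
        congr 1
        ext g
        constructor
        · rintro ⟨ξ, h, rfl⟩
          exact ⟨_, ⟨⟨ξ, h⟩, rfl⟩, rfl⟩
        · rintro ⟨_, ⟨ξ, rfl⟩, rfl⟩
          exact ⟨ξ, ξ.2, rfl⟩
      rw [h2]
      rfl
    rw [h1]
    exact Φ.symStep_le_closure k n hf
  refine ⟨LinearMap.extendOfNorm (Finsupp.linearCombination ℂ (fun ξ : Φ.step n => g ξ)) e,
    fun x => LinearMap.norm_extendOfNorm_apply_le hd K hK' x, fun ξ h => ?_⟩
  have := LinearMap.extendOfNorm_eq hd ⟨K, hK'⟩ (Finsupp.single ⟨ξ, h⟩ 1)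
  simpa [e] using this

lemma map_mem_of_powers {k n : ℕ} {F : Type*} [NormedAddCommGroup F] [NormedSpace ℂ F]
    {S : Submodule ℂ F} (hS : IsClosed (S : Set F)) (L : Φ.symStep k n →L[ℂ] F)
    (hL : ∀ ξ (h : ξ ∈ Φ.step n), L ⟨_, Φ.power_mem_symStep h⟩ ∈ S) (x : Φ.symStep k n) :
    L x ∈ S := by
  have hmem : (x : Φ.Form k) ∈ closure (Φ.powerSpan k n : Set (Φ.Form k)) :=
    Φ.symStep_le_closure k n x.2
  obtain ⟨y, hy, hlim⟩ := mem_closure_iff_seq_limit.1 hmem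
  have hy' : ∀ j, y j ∈ Φ.symStep k n := fun j => Φ.powerSpan_le k n (hy j)
  have hlim' : Tendsto (fun j => (⟨y j, hy' j⟩ : Φ.symStep k n)) atTop (𝓝 x) :=
    tendsto_subtype_rng.2 hlim
  refine hS.mem_of_tendsto ((L.continuous.tendsto x).comp hlim') (Eventually.of_forall ?_)
  intro j
  have : (Φ.powerSpan k n) ≤ (S.comap L.toLinearMap).map (Φ.symStep k n).subtype := by
    refine Submodule.span_le.2 ?_
    rintro _ ⟨ξ, hξ, rfl⟩
    exact ⟨_, hL ξ hξ, rfl⟩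
  obtain ⟨z, hz, hzy⟩ := this (hy j)
  have : (⟨y j, hy' j⟩ : Φ.symStep k n) = z := Subtype.ext hzy.symm
  simp only [Function.comp_apply, this]
  exact hz

lemma eq_of_powers {k n : ℕ} {F : Type*} [NormedAddCommGroup F] [NormedSpace ℂ F]
    (L M : Φ.symStep k n →L[ℂ] F)
    (h : ∀ ξ (h : ξ ∈ Φ.step n),
      L ⟨_, Φ.power_mem_symStep h⟩ = M ⟨_, Φ.power_mem_symStep h⟩) (x : Φ.symStep k n) :
    L x = M x := by
  have := Φ.map_mem_of_powers (S := ⊥) (by simp) (L - M) (fun ξ hξ => by simp [h ξ hξ]) x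
  exact sub_eq_zero.1 ((Submodule.mem_bot ℂ).1 this)

/-- Existence of operators with prescribed values on the tensor powers. -/
lemma exists_op (k i : ℕ) (g : Φ.E → Φ.Form i)
    (h : ∀ n, ∃ (m : ℕ) (K : ℝ), (∀ ξ ∈ Φ.step n, g ξ ∈ Φ.symStep i m) ∧
      ∀ c : Φ.step n →₀ ℂ,
      ‖Finsupp.linearCombination ℂ (fun ξ : Φ.step n => g ξ) c‖ ≤
        K * ‖Finsupp.linearCombination ℂ
          (fun ξ : Φ.step n => Φ.pureTensor (fun _ : Fin k => (ξ : Φ.E))) c‖) :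
    ∃ C : Φ.Op k i, ∀ ξ, Φ.toForm (C (Φ.tpow k ξ)) = g ξ := by
  choose m K hm hK using h
  choose T hTK hT using fun n => Φ.exists_stepExtension g (K n) (hK n)
  -- The extensions to different steps agree on powers, hence on the smaller step; this is what
  -- allows them to be glued.
  have hcompat : ∀ n n' (hn : n ≤ n') (x : Φ.Form k) (hx : x ∈ Φ.symStep k n),
      T n' ⟨x, Φ.symStep_mono k hn hx⟩ = T n ⟨x, hx⟩ := by
    intro n n' hn x hx
    let J : Φ.symStep k n →L[ℂ] Φ.symStep k n' :=
      ((Φ.symStep k n).subtypeL).codRestrict _ fun x => Φ.symStep_mono k hn x.2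
    exact Φ.eq_of_powers ((T n').comp J) (T n) (fun ξ hξ =>
      (hT n' ξ (Φ.step_mono hn hξ)).trans (hT n ξ hξ).symm) ⟨x, hx⟩
  have hrange : ∀ n x, T n x ∈ Φ.symStep i (m n) := fun n x =>
    Φ.map_mem_of_powers (Φ.isClosed_symStep i (m n)) (T n) (fun ξ hξ => by
      rw [hT n ξ hξ]; exact hm n ξ hξ) x
  -- The glued map is evaluated through an arbitrary step containing the tensor; `hval` shows that
  -- the choice is immaterial, which gives linearity.
  choose N hN using fun f : (Φ.symPow k).Sp => Φ.exists_toForm_mem f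
  have hval : ∀ (f : (Φ.symPow k).Sp) n (hn : Φ.toForm f ∈ Φ.symStep k n),
      T (N f) ⟨_, hN f⟩ = T n ⟨_, hn⟩ := by
    intro f n hn
    rcases le_total n (N f) with hle | hle
    · exact hcompat n (N f) hle _ hn
    · exact (hcompat (N f) n hle _ (hN f)).symm
  let C : (Φ.symPow k).Sp →ₗ[ℂ] (Φ.symPow i).Sp :=
    { toFun := fun f => Φ.ofForm (T (N f) ⟨_, hN f⟩) (hrange _ _)
      map_add' := by
        intro f g
        apply Φ.toForm_injective
        have hf := Φ.symStep_mono k (le_max_left (N f) (N g)) (hN f)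
        have hg := Φ.symStep_mono k (le_max_right (N f) (N g)) (hN g)
        have hfg : Φ.toForm (f + g) ∈ Φ.symStep k (max (N f) (N g)) := by
          rw [map_add]; exact add_mem hf hg
        rw [map_add Φ.toForm (Φ.ofForm _ _)]
        simp only [toForm_ofForm]
        rw [hval f _ hf, hval g _ hg, hval _ _ hfg, ← map_add]
        rfl
      map_smul' := by
        intro c f
        apply Φ.toForm_injective
        have hcf : Φ.toForm (c • f) ∈ Φ.symStep k (N f) := by
          rw [map_smul]; exact Submodule.smul_mem _ c (hN f)
        rw [RingHom.id_apply, map_smul Φ.toForm c (Φ.ofForm _ _)]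
        simp only [toForm_ofForm]
        rw [hval _ _ hcf, ← map_smul]
        rfl }
  have hC : ∀ (f : (Φ.symPow k).Sp) n (hn : Φ.toForm f ∈ Φ.symStep k n),
      Φ.toForm (C f) = T n ⟨_, hn⟩ := fun f n hn => hval f n hn
  refine ⟨⟨C, continuous_of_step_bound C fun n => ⟨m n, K n, fun x hx => ?_⟩⟩, fun ξ => ?_⟩
  · have hx' : Φ.toForm ((Φ.symPow k).toSp x) ∈ Φ.symStep k n := hx
    rw [ofSp_mem_step_iff, norm_ofSp, hC _ n hx']
    exact ⟨hrange n _, hTK n _⟩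
  · obtain ⟨n, hn⟩ := Φ.exists_mem_step ξ
    change Φ.toForm (C _) = _
    rw [hC _ n (Φ.power_mem_symStep hn)]
    exact hT n ξ hn

/-- `ofPowers` is a choice, so its defining formula becomes available only once existence is known;
`exists_odot` and `exists_dualTensor` supply it. -/
lemma ofPowers_spec {k i : ℕ} {g : Φ.E → Φ.Form i}
    (h : ∃ C : Φ.Op k i, ∀ ξ, Φ.toForm (C (Φ.tpow k ξ)) = g ξ) (ξ : Φ.E) :
    Φ.toForm (Φ.ofPowers k i g (Φ.tpow k ξ)) = g ξ :=
  Classical.epsilon_spec h ξ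

end LBSpace
end

/-! ### Symmetric products of operators and evaluation on the diagonal -/

noncomputable section
namespace LBSpace

variable (Φ : LBSpace.{u})

/-! ### Tensor products of operators -/

lemma tmul_apply {i j : ℕ} (f : Φ.Form i) (g : Φ.Form j) (ν : Fin (i + j) → Φ.NDual) :
    Φ.tmul f g ν = f (fun a => ν (Fin.castAdd j a)) * g (fun b => ν (Fin.natAdd i b)) := rfl

lemma norm_tmul_le {i j : ℕ} (f : Φ.Form i) (g : Φ.Form j) : ‖Φ.tmul f g‖ ≤ ‖f‖ * ‖g‖ := by
  refine ContinuousMultilinearMap.opNorm_le_bound (by positivity) fun ν => ?_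
  rw [tmul_apply, norm_mul, Fin.prod_univ_add]
  calc _ ≤ (‖f‖ * ∏ a, ‖ν (Fin.castAdd j a)‖) * (‖g‖ * ∏ b, ‖ν (Fin.natAdd i b)‖) :=
        mul_le_mul (f.le_opNorm _) (g.le_opNorm _) (norm_nonneg _) (by positivity)
    _ = _ := by ring

/-- The tensor product of forms as a continuous bilinear map. -/
def tmulL (i j : ℕ) : Φ.Form i →L[ℂ] Φ.Form j →L[ℂ] Φ.Form (i + j) :=
  LinearMap.mkContinuous₂
    (LinearMap.mk₂ ℂ Φ.tmul (fun f f' g => by ext ν; simp [tmul_apply, add_mul])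
      (fun c f g => by ext ν; simp [tmul_apply, mul_assoc])
      (fun f g g' => by ext ν; simp [tmul_apply, mul_add])
      (fun c f g => by ext ν; simp [tmul_apply, mul_left_comm])) 1
    fun f g => by simpa using Φ.norm_tmul_le f g

lemma tmulL_apply {i j : ℕ} (f : Φ.Form i) (g : Φ.Form j) : Φ.tmulL i j f g = Φ.tmul f g := rfl

lemma tmul_pureTensor {i j : ℕ} (b : Fin i → Φ.E) (c : Fin j → Φ.E) :
    Φ.tmul (Φ.pureTensor b) (Φ.pureTensor c) = Φ.pureTensor (Fin.append b c) := by
  ext ν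
  simp only [tmul_apply, pureTensor_apply, Fin.prod_univ_add, Fin.append_left, Fin.append_right]

lemma pureTensor_mem_tensorStep {k n : ℕ} {b : Fin k → Φ.E} (hb : ∀ i, b i ∈ Φ.step n) :
    Φ.pureTensor b ∈ Φ.tensorStep k n :=
  Submodule.le_topologicalClosure (Submodule.span ℂ _) (Submodule.subset_span ⟨b, hb, rfl⟩)

lemma isClosed_tensorStep (k n : ℕ) : IsClosed (Φ.tensorStep k n : Set (Φ.Form k)) :=
  Submodule.isClosed_topologicalClosure _

/-- A continuous linear map that sends elementary tensors into a closed subspace. -/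
lemma map_mem_of_pureTensor {k n l : ℕ} {S : Submodule ℂ (Φ.Form l)}
    (hS : IsClosed (S : Set (Φ.Form l))) (L : Φ.Form k →L[ℂ] Φ.Form l)
    (hL : ∀ b : Fin k → Φ.E, (∀ i, b i ∈ Φ.step n) → L (Φ.pureTensor b) ∈ S)
    {f : Φ.Form k} (hf : f ∈ Φ.tensorStep k n) : L f ∈ S := by
  have hcl : IsClosed ((S.comap L.toLinearMap : Submodule ℂ (Φ.Form k)) : Set (Φ.Form k)) :=
    hS.preimage L.continuous
  refine Submodule.topologicalClosure_minimal _ (Submodule.span_le.2 ?_) hcl hf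
  rintro _ ⟨b, hb, rfl⟩
  exact hL b hb

/-- Approximation in one factor at a time: first f is reduced to an elementary tensor with g fixed,
then g. -/
lemma tmul_mem_tensorStep {i j n : ℕ} {f : Φ.Form i} {g : Φ.Form j}
    (hf : f ∈ Φ.tensorStep i n) (hg : g ∈ Φ.tensorStep j n) :
    Φ.tmul f g ∈ Φ.tensorStep (i + j) n := by
  refine Φ.map_mem_of_pureTensor (Φ.isClosed_tensorStep _ n) ((Φ.tmulL i j).flip g)
    (fun b hb => ?_) hf
  refine Φ.map_mem_of_pureTensor (Φ.isClosed_tensorStep _ n) (Φ.tmulL i j (Φ.pureTensor b))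
    (fun c hc => ?_) hg
  rw [tmulL_apply, tmul_pureTensor]
  refine Φ.pureTensor_mem_tensorStep fun a => ?_
  induction a using Fin.addCases with
  | left a => rw [Fin.append_left]; exact hb a
  | right a => rw [Fin.append_right]; exact hc a

lemma sym_mem_tensorStep {k n : ℕ} {f : Φ.Form k} (hf : f ∈ Φ.tensorStep k n) :
    Φ.sym f ∈ Φ.symStep k n := by
  refine ⟨?_, Φ.sym_mem_symForms f⟩
  rw [← symL_apply]
  refine Φ.map_mem_of_pureTensor (Φ.isClosed_tensorStep _ n) (Φ.symL k) (fun b hb => ?_) hf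
  rw [symL_apply, sym]
  refine Submodule.smul_mem _ _ (Submodule.sum_mem _ fun π _ => ?_)
  rw [domDomCongr_pureTensor]
  exact Φ.pureTensor_mem_tensorStep fun i => hb _

lemma sym_tmul_mem {i j n : ℕ} {f : Φ.Form i} {g : Φ.Form j}
    (hf : f ∈ Φ.symStep i n) (hg : g ∈ Φ.symStep j n) :
    Φ.sym (Φ.tmul f g) ∈ Φ.symStep (i + j) n :=
  Φ.sym_mem_tensorStep (Φ.tmul_mem_tensorStep hf.1 hg.1)

/-- The values of an operator on the powers of the elements of a step. -/
lemma exists_op_bound {k i : ℕ} (A : Φ.Op k i) (n : ℕ) : ∃ (m : ℕ) (K : ℝ), 0 ≤ K ∧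
    (∀ ξ ∈ Φ.step n, Φ.toForm (A (Φ.tpow k ξ)) ∈ Φ.symStep i m) ∧
    ∀ (s : Finset (Φ.step n)) (c : Φ.step n → ℂ),
      ‖∑ ξ ∈ s, c ξ • Φ.toForm (A (Φ.tpow k (ξ : Φ.E)))‖ ≤
        K * ‖∑ ξ ∈ s, c ξ • Φ.pureTensor (fun _ : Fin k => (ξ : Φ.E))‖ := by
  obtain ⟨m, K, hK, h⟩ := exists_step_bound A n
  refine ⟨m, K, hK, fun ξ hξ => (h _ (Φ.power_mem_symStep hξ)).1, fun s c => ?_⟩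
  let x : (Φ.symPow k).Sp := ∑ ξ ∈ s, c ξ • Φ.tpow k (ξ : Φ.E)
  have hx : Φ.toForm x = ∑ ξ ∈ s, c ξ • Φ.pureTensor (fun _ : Fin k => (ξ : Φ.E)) := by
    simp only [x, map_sum, map_smul, toForm_tpow]
  have hAx : Φ.toForm (A x) = ∑ ξ ∈ s, c ξ • Φ.toForm (A (Φ.tpow k (ξ : Φ.E))) := by
    simp only [x, map_sum, map_smul]
  have hmem : (Φ.symPow k).ofSp x ∈ (Φ.symPow k).step n := by
    rw [ofSp_mem_step_iff, hx]
    exact Submodule.sum_mem _ fun ξ _ => Submodule.smul_mem _ _ (Φ.power_mem_symStep ξ.2)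
  have := (h _ hmem).2
  rwa [toSp_ofSp, norm_ofSp, norm_ofSp, hAx, hx] at this

/-- Existence of operators with prescribed values on the tensor powers, in terms of finite sums. -/
lemma exists_op_of_sum_bound (k i : ℕ) (g : Φ.E → Φ.Form i)
    (h : ∀ n, ∃ (m : ℕ) (K : ℝ), (∀ ξ ∈ Φ.step n, g ξ ∈ Φ.symStep i m) ∧
      ∀ (s : Finset (Φ.step n)) (c : Φ.step n → ℂ),
      ‖∑ ξ ∈ s, c ξ • g ξ‖ ≤
        K * ‖∑ ξ ∈ s, c ξ • Φ.pureTensor (fun _ : Fin k => (ξ : Φ.E))‖) :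
    ∃ C : Φ.Op k i, ∀ ξ, Φ.toForm (C (Φ.tpow k ξ)) = g ξ := by
  refine Φ.exists_op k i g fun n => ?_
  obtain ⟨m, K, hm, hK⟩ := h n
  exact ⟨m, K, hm, fun c => hK c.support c⟩

/-- The injective norm tests a tensor against functionals in each slot, so the two operators can be
applied one after the other. Freezing the last i₂ slots leaves a combination of powers to which the
bound for A₁ applies; freezing the outputs of A₁ leaves one for A₂. The constant is the product of
the two bounds. -/
lemma exists_odot {k i₁ i₂ j₁ j₂ : ℕ} (hk : k = i₁ + i₂) (A₁ : Φ.Op i₁ j₁) (A₂ : Φ.Op i₂ j₂) :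
    ∃ C : Φ.Op k (j₁ + j₂), ∀ ξ, Φ.toForm (C (Φ.tpow k ξ)) =
      Φ.sym (Φ.tmul (Φ.toForm (A₁ (Φ.tpow i₁ ξ))) (Φ.toForm (A₂ (Φ.tpow i₂ ξ)))) := by
  subst hk
  refine Φ.exists_op_of_sum_bound _ _ _ fun n => ?_
  obtain ⟨m₁, K₁, hK₁, hm₁, hA₁⟩ := Φ.exists_op_bound A₁ n
  obtain ⟨m₂, K₂, hK₂, hm₂, hA₂⟩ := Φ.exists_op_bound A₂ n
  refine ⟨max m₁ m₂, K₂ * K₁, fun ξ hξ => ?_, fun s c => ?_⟩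
  · exact Φ.sym_tmul_mem (Φ.symStep_mono _ (le_max_left _ _) (hm₁ ξ hξ))
      (Φ.symStep_mono _ (le_max_right _ _) (hm₂ ξ hξ))
  set a : Φ.step n → Φ.Form j₁ := fun ξ => Φ.toForm (A₁ (Φ.tpow i₁ (ξ : Φ.E))) with ha
  set b : Φ.step n → Φ.Form j₂ := fun ξ => Φ.toForm (A₂ (Φ.tpow i₂ (ξ : Φ.E))) with hb
  set N := ‖∑ ξ ∈ s, c ξ • Φ.pureTensor (fun _ : Fin (i₁ + i₂) => (ξ : Φ.E))‖ with hN
  have hsym : ∑ ξ ∈ s, c ξ • Φ.sym (Φ.tmul (a ξ) (b ξ)) =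
      Φ.sym (∑ ξ ∈ s, c ξ • Φ.tmul (a ξ) (b ξ)) := by
    simp only [← symL_apply, map_sum, map_smul]
  change ‖∑ ξ ∈ s, c ξ • Φ.sym (Φ.tmul (a ξ) (b ξ))‖ ≤ _
  rw [hsym]
  refine (Φ.norm_sym_le _).trans ?_
  have happ : ∀ {l : ℕ} (F : Φ.step n → Φ.Form l) (d : Φ.step n → ℂ) (ν : Fin l → Φ.NDual),
      (∑ ξ ∈ s, d ξ • F ξ) ν = ∑ ξ ∈ s, d ξ * F ξ ν := by
    intro l F d ν
    rw [_root_.sum_apply]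
    rfl
  -- The last i₂ slots are filled with μ; what remains is a combination of i₁-th powers with
  -- modified scalar coefficients.
  have h₁ : ∀ (μ : Fin i₂ → Φ.NDual),
      ‖∑ ξ ∈ s, (c ξ * Φ.pureTensor (fun _ => (ξ : Φ.E)) μ) •
        Φ.pureTensor (fun _ : Fin i₁ => (ξ : Φ.E))‖ ≤ N * ∏ q, ‖μ q‖ := by
    intro μ
    refine ContinuousMultilinearMap.opNorm_le_bound (by positivity) fun ρ => ?_
    have e : (∑ ξ ∈ s, (c ξ * Φ.pureTensor (fun _ => (ξ : Φ.E)) μ) •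
        Φ.pureTensor (fun _ : Fin i₁ => (ξ : Φ.E))) ρ =
        (∑ ξ ∈ s, c ξ • Φ.pureTensor (fun _ : Fin (i₁ + i₂) => (ξ : Φ.E)))
          (Fin.append ρ μ) := by
      rw [happ, happ]
      refine Finset.sum_congr rfl fun ξ _ => ?_
      simp only [pureTensor_apply, Fin.prod_univ_add, Fin.append_left, Fin.append_right]
      ring
    rw [e]
    refine (ContinuousMultilinearMap.le_opNorm _ _).trans (le_of_eq ?_)
    rw [Fin.prod_univ_add]
    simp only [Fin.append_left, Fin.append_right]
    ring
  -- Now A₁ has been applied and its outputs are filled with ν. Testing against μ exchanges the two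
  -- evaluations and reduces the estimate to `h₁` and the bound for A₁.
  have h₂ : ∀ (ν : Fin j₁ → Φ.NDual),
      ‖∑ ξ ∈ s, (c ξ * a ξ ν) • Φ.pureTensor (fun _ : Fin i₂ => (ξ : Φ.E))‖ ≤
        K₁ * N * ∏ q, ‖ν q‖ := by
    intro ν
    refine ContinuousMultilinearMap.opNorm_le_bound (by positivity) fun μ => ?_
    have e : (∑ ξ ∈ s, (c ξ * a ξ ν) • Φ.pureTensor (fun _ : Fin i₂ => (ξ : Φ.E))) μ =
        (∑ ξ ∈ s, (c ξ * Φ.pureTensor (fun _ => (ξ : Φ.E)) μ) • a ξ) ν := by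
      rw [happ, happ]
      exact Finset.sum_congr rfl fun ξ _ => by ring
    rw [e]
    calc _ ≤ ‖∑ ξ ∈ s, (c ξ * Φ.pureTensor (fun _ => (ξ : Φ.E)) μ) • a ξ‖ * ∏ q, ‖ν q‖ :=
          ContinuousMultilinearMap.le_opNorm _ _
      _ ≤ K₁ * (N * ∏ q, ‖μ q‖) * ∏ q, ‖ν q‖ := by
          gcongr
          exact (hA₁ s fun ξ => c ξ * Φ.pureTensor (fun _ => (ξ : Φ.E)) μ).trans
            (mul_le_mul_of_nonneg_left (h₁ μ) hK₁)
      _ = _ := by ring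
  refine ContinuousMultilinearMap.opNorm_le_bound (by positivity) fun ν => ?_
  set ν₁ : Fin j₁ → Φ.NDual := fun q => ν (Fin.castAdd j₂ q)
  set ν₂ : Fin j₂ → Φ.NDual := fun q => ν (Fin.natAdd j₁ q)
  have e : (∑ ξ ∈ s, c ξ • Φ.tmul (a ξ) (b ξ)) ν = (∑ ξ ∈ s, (c ξ * a ξ ν₁) • b ξ) ν₂ := by
    rw [happ, happ]
    exact Finset.sum_congr rfl fun ξ _ => by rw [tmul_apply]; ring
  rw [e, Fin.prod_univ_add]
  calc _ ≤ ‖∑ ξ ∈ s, (c ξ * a ξ ν₁) • b ξ‖ * ∏ q, ‖ν₂ q‖ := ContinuousMultilinearMap.le_opNorm _ _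
    _ ≤ K₂ * (K₁ * N * ∏ q, ‖ν₁ q‖) * ∏ q, ‖ν₂ q‖ := by
        gcongr
        exact (hA₂ s fun ξ => c ξ * a ξ ν₁).trans (mul_le_mul_of_nonneg_left (h₂ ν₁) hK₂)
    _ = _ := by ring

/-- The value of a symmetric tensor product of operators on a tensor power. -/
lemma toForm_odot {k i₁ i₂ j₁ j₂ : ℕ} (hk : k = i₁ + i₂) (A₁ : Φ.Op i₁ j₁) (A₂ : Φ.Op i₂ j₂)
    (ξ : Φ.E) : Φ.toForm (Φ.odot k A₁ A₂ (Φ.tpow k ξ)) =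
      Φ.sym (Φ.tmul (Φ.toForm (A₁ (Φ.tpow i₁ ξ))) (Φ.toForm (A₂ (Φ.tpow i₂ ξ)))) :=
  Φ.ofPowers_spec (Φ.exists_odot hk A₁ A₂) ξ

/-! ### Functionals on symmetric powers -/

lemma symStep_zero (n : ℕ) (f : Φ.Form 0) : f ∈ Φ.symStep 0 n := by
  have : f = f 0 • Φ.pureTensor (fun i : Fin 0 => i.elim0) := by
    ext ν
    rw [Subsingleton.elim ν 0, _root_.smul_apply, pureTensor_apply]
    simp
  rw [this]
  exact Submodule.smul_mem _ _ ⟨Φ.pureTensor_mem_tensorStep fun i => i.elim0, fun π => by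
    rw [domDomCongr_pureTensor]; congr 1⟩

lemma toForm_zero_apply (c : (Φ.symPow 0).Sp) (ν : Fin 0 → Φ.NDual) :
    Φ.toForm c ν = Φ.scalar c := by
  rw [scalar, Subsingleton.elim ν 0]

@[simp] lemma scalar_add (c d : (Φ.symPow 0).Sp) :
    Φ.scalar (c + d) = Φ.scalar c + Φ.scalar d := by simp [scalar]

@[simp] lemma scalar_smul (a : ℂ) (c : (Φ.symPow 0).Sp) :
    Φ.scalar (a • c) = a * Φ.scalar c := by simp [scalar]

/-- The identification of `Φ^{⊙0}` with `ℂ` as a continuous linear map. -/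
def scalarL : (Φ.symPow 0).Sp →L[ℂ] ℂ :=
  (ContinuousMultilinearMap.apply ℂ (fun _ : Fin 0 => Φ.NDual) ℂ 0).comp (Φ.toFormL 0)

lemma scalarL_apply (c : (Φ.symPow 0).Sp) : Φ.scalarL c = Φ.scalar c := rfl

lemma scalar_injective : Function.Injective Φ.scalar := by
  intro c d h
  apply Φ.toForm_injective
  ext ν
  rw [toForm_zero_apply, toForm_zero_apply, h]

lemma scalar_tpow (ξ : Φ.E) : Φ.scalar (Φ.tpow 0 ξ) = 1 := by
  rw [scalar, toForm_tpow, pureTensor_apply]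
  simp

/-- Each σ_i is bounded on a given step and extends by Hahn-Banach to a functional on the normed
space. On powers from that step the product of the σ_i is then an evaluation of the form, which the
injective norm bounds. -/
lemma exists_dualTensor {k : ℕ} (σ : Fin k → Φ.Dual) :
    ∃ C : Φ.Op k 0, ∀ ξ, Φ.toForm (C (Φ.tpow k ξ)) =
      ContinuousMultilinearMap.constOfIsEmpty ℂ _ (∏ i, σ i (Φ.toSp ξ)) := by
  refine Φ.exists_op_of_sum_bound _ _ _ fun n => ?_
  choose ν hν using fun i => Φ.exists_extension n (σ i)
  -- The target step is irrelevant, since every form without arguments lies in all of them.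
  refine ⟨0, ∏ i, ‖ν i‖, fun ξ _ => Φ.symStep_zero _ _, fun s c => ?_⟩
  refine ContinuousMultilinearMap.opNorm_le_bound (by positivity) fun ρ => ?_
  have e : (∑ ξ ∈ s, c ξ • ContinuousMultilinearMap.constOfIsEmpty ℂ (fun _ : Fin 0 => Φ.NDual)
      (∏ i, σ i (Φ.toSp (ξ : Φ.E)))) ρ =
      (∑ ξ ∈ s, c ξ • Φ.pureTensor (fun _ : Fin k => (ξ : Φ.E))) ν := by
    rw [_root_.sum_apply, _root_.sum_apply]
    refine Finset.sum_congr rfl fun ξ _ => ?_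
    rw [_root_.smul_apply, _root_.smul_apply, pureTensor_apply]
    simp [hν _ _ ξ.2]
  rw [e]
  refine (ContinuousMultilinearMap.le_opNorm _ _).trans (le_of_eq ?_)
  simp [mul_comm]

lemma scalar_dualTensor_tpow {k : ℕ} (σ : Fin k → Φ.Dual) (ξ : Φ.E) :
    Φ.scalar (Φ.dualTensor σ (Φ.tpow k ξ)) = ∏ i, σ i (Φ.toSp ξ) := by
  rw [scalar, dualTensor, Φ.ofPowers_spec (Φ.exists_dualTensor σ)]
  simp

/-- Functionals of the form `σ₁ ⊙ ⋯ ⊙ σₖ` in terms of functionals on the normed space. -/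
lemma scalar_dualTensor {k n : ℕ} {σ : Fin k → Φ.Dual} {ν : Fin k → Φ.NDual}
    (h : ∀ i, ∀ x ∈ Φ.step n, Φ.evalL x (ν i) = σ i (Φ.toSp x)) {f : (Φ.symPow k).Sp}
    (hf : Φ.toForm f ∈ Φ.symStep k n) :
    Φ.scalar (Φ.dualTensor σ f) = Φ.toForm f ν := by
  rw [← sub_eq_zero]
  let D : (Φ.symPow k).Sp →L[ℂ] ℂ := Φ.scalarL.comp (Φ.dualTensor σ) -
    (ContinuousMultilinearMap.apply ℂ (fun _ : Fin k => Φ.NDual) ℂ ν).comp (Φ.toFormL k)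
  refine Φ.eq_zero_of_powers_step D (fun ξ hξ => ?_) f hf
  change Φ.scalar (Φ.dualTensor σ (Φ.tpow k ξ)) - Φ.toForm (Φ.tpow k ξ) ν = 0
  rw [scalar_dualTensor_tpow, toForm_tpow, pureTensor_apply, sub_eq_zero]
  exact Finset.prod_congr rfl fun i _ => (h i ξ hξ).symm

lemma scalar_dualTensor_ofNDual {k : ℕ} (ν : Fin k → Φ.NDual) (f : (Φ.symPow k).Sp) :
    Φ.scalar (Φ.dualTensor (fun i => Φ.ofNDual (ν i)) f) = Φ.toForm f ν := by
  obtain ⟨n, hn⟩ := Φ.exists_toForm_mem f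
  exact Φ.scalar_dualTensor (fun i x _ => rfl) hn

/-- The value of the monomial `⟨ω^{⊗k}, f⟩`, continuous in `f`. -/
def ev (k : ℕ) (ω : Φ.Dual) : (Φ.symPow k).Sp →L[ℂ] ℂ := Φ.scalarL.comp (Φ.dualPow ω k)

lemma ev_eq {k : ℕ} (ω : Φ.Dual) (f : (Φ.symPow k).Sp) :
    Φ.ev k ω f = Φ.scalar (Φ.dualPow ω k f) := rfl

lemma ev_tpow (k : ℕ) (ω : Φ.Dual) (ξ : Φ.E) :
    Φ.ev k ω (Φ.tpow k ξ) = ω (Φ.toSp ξ) ^ k := by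
  rw [ev_eq, dualPow, scalar_dualTensor_tpow]
  simp

lemma ev_zero (ω : Φ.Dual) (c : (Φ.symPow 0).Sp) : Φ.ev 0 ω c = Φ.scalar c := by
  have : Φ.ev 0 ω = Φ.scalarL := Φ.ext_powers fun ξ => by
    rw [ev_tpow, pow_zero, scalarL_apply, scalar_tpow]
  rw [this, scalarL_apply]

/-- On a step the value of a monomial is the value on the diagonal of the form. -/
lemma exists_ev_eq (n : ℕ) (ω : Φ.Dual) : ∃ ν : Φ.NDual, ∀ (k : ℕ) (f : (Φ.symPow k).Sp),
    Φ.toForm f ∈ Φ.symStep k n → Φ.ev k ω f = Φ.toForm f fun _ => ν := by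
  obtain ⟨ν, hν⟩ := Φ.exists_extension n ω
  exact ⟨ν, fun k f hf => Φ.scalar_dualTensor (fun _ => hν) hf⟩

lemma ev_ofNDual {k : ℕ} (ν : Φ.NDual) (f : (Φ.symPow k).Sp) :
    Φ.ev k (Φ.ofNDual ν) f = Φ.toForm f fun _ => ν :=
  Φ.scalar_dualTensor_ofNDual (fun _ => ν) f

/-- The monomials separate the elements of `Φ^{⊙k}`. -/
lemma ext_ev {k : ℕ} {f g : (Φ.symPow k).Sp} (h : ∀ ω, Φ.ev k ω f = Φ.ev k ω g) : f = g := by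
  rw [← sub_eq_zero]
  apply Φ.toForm_injective
  rw [map_zero]
  refine Φ.eq_zero_of_diag (Φ.toForm_mem_symForms _) fun ν => ?_
  rw [← ev_ofNDual, map_sub, h, sub_self]

/-- Operators are determined by the values of monomials on the images of the powers. -/
lemma op_ext {k i : ℕ} {C D : Φ.Op k i}
    (h : ∀ ξ ω, Φ.ev i ω (C (Φ.tpow k ξ)) = Φ.ev i ω (D (Φ.tpow k ξ))) : C = D :=
  Φ.ext_powers fun ξ => Φ.ext_ev (h ξ)

/-- Symmetrization is invisible on the diagonal, so pairing with ω turns ⊙ into multiplication of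
numbers. All algebra of tensor series rests on this formula. -/
lemma ev_odot {k i₁ i₂ j₁ j₂ : ℕ} (hk : k = i₁ + i₂) (A₁ : Φ.Op i₁ j₁) (A₂ : Φ.Op i₂ j₂)
    (ξ : Φ.E) (ω : Φ.Dual) : Φ.ev (j₁ + j₂) ω (Φ.odot k A₁ A₂ (Φ.tpow k ξ)) =
      Φ.ev j₁ ω (A₁ (Φ.tpow i₁ ξ)) * Φ.ev j₂ ω (A₂ (Φ.tpow i₂ ξ)) := by
  obtain ⟨n₁, h₁⟩ := Φ.exists_toForm_mem (A₁ (Φ.tpow i₁ ξ))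
  obtain ⟨n₂, h₂⟩ := Φ.exists_toForm_mem (A₂ (Φ.tpow i₂ ξ))
  replace h₁ := Φ.symStep_mono _ (le_max_left n₁ n₂) h₁
  replace h₂ := Φ.symStep_mono _ (le_max_right n₁ n₂) h₂
  obtain ⟨ν, hν⟩ := Φ.exists_ev_eq (max n₁ n₂) ω
  have h₃ : Φ.toForm (Φ.odot k A₁ A₂ (Φ.tpow k ξ)) ∈ Φ.symStep (j₁ + j₂) (max n₁ n₂) := by
    rw [Φ.toForm_odot hk]
    exact Φ.sym_tmul_mem h₁ h₂
  rw [hν _ _ h₁, hν _ _ h₂, hν _ _ h₃, Φ.toForm_odot hk, sym_apply_const, tmul_apply]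

/-- The elements of `Φ^{⊙k}` are separated by the functionals `σ₁ ⊙ ⋯ ⊙ σₖ`. -/
lemma ext_dualTensor {k : ℕ} {f g : (Φ.symPow k).Sp}
    (h : ∀ σ : Fin k → Φ.Dual, Φ.scalar (Φ.dualTensor σ f) = Φ.scalar (Φ.dualTensor σ g)) :
    f = g :=
  Φ.ext_ev fun _ => h _

/-! ### The first symmetric power -/

/-- By Hahn-Banach ξ ↦ ξ^{⊗1} preserves the norm, so the image of a complete step is closed; it
contains the dense span of the powers. -/
lemma exists_eq_tpow_one (f : (Φ.symPow 1).Sp) : ∃ η : Φ.E, f = Φ.tpow 1 η := by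
  obtain ⟨n, hn⟩ := Φ.exists_toForm_mem f
  have hc : CompleteSpace (Φ.step n) := (Φ.isComplete_step n).completeSpace_coe
  let L : Φ.step n →ₗ[ℂ] Φ.Form 1 :=
    { toFun := fun ξ => Φ.pureTensor fun _ => (ξ : Φ.E)
      map_add' := fun x y => by ext ν; simp [pureTensor_apply, evalL]; rfl
      map_smul' := fun c x => by ext ν; simp [pureTensor_apply, evalL]; rfl }
  have hL : ∀ ξ ν, L ξ ν = Φ.evalL (ξ : Φ.E) (ν 0) := fun ξ ν => by
    change Φ.pureTensor _ ν = _
    rw [pureTensor_apply]; simp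
  have hup : ∀ ξ, ‖L ξ‖ ≤ 1 * ‖ξ‖ := fun ξ => by
    refine ContinuousMultilinearMap.opNorm_le_bound (by positivity) fun ν => ?_
    rw [hL, one_mul]
    simp only [Finset.univ_unique, Fin.default_eq_zero, Finset.prod_singleton]
    exact (ContinuousLinearMap.le_opNorm (show Φ.E →L[ℂ] ℂ from ν 0) ξ).trans_eq (mul_comm _ _)
  -- A norming functional of ξ gives the lower bound.
  have hlow : ∀ ξ, ‖ξ‖ ≤ (1 : NNReal) * ‖L ξ‖ := fun ξ => by
    obtain ⟨g, hg, hgx⟩ := exists_dual_vector'' ℂ (ξ : Φ.E)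
    have h1 := (L ξ).le_opNorm fun _ => (show Φ.NDual from g)
    rw [hL] at h1
    have h2 : ‖Φ.evalL (ξ : Φ.E) (show Φ.NDual from g)‖ = ‖(ξ : Φ.E)‖ := by
      change ‖g (ξ : Φ.E)‖ = _
      rw [hgx]; simp
    rw [h2] at h1
    simp only [Finset.univ_unique, Finset.prod_const] at h1
    rw [NNReal.coe_one, one_mul]
    exact h1.trans (mul_le_of_le_one_right (norm_nonneg _) (by rw [Finset.card_singleton, pow_one]; exact hg))
  let L' : Φ.step n →L[ℂ] Φ.Form 1 := L.mkContinuous 1 hup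
  have hanti : AntilipschitzWith 1 L' := AddMonoidHomClass.antilipschitz_of_bound L' hlow
  have hcl : IsClosed (Set.range L') := hanti.isClosed_range L'.uniformContinuous
  have hmem : Φ.toForm f ∈ closure (Φ.powerSpan 1 n : Set (Φ.Form 1)) :=
    Φ.symStep_le_closure 1 n hn
  have hsub : (Φ.powerSpan 1 n : Set (Φ.Form 1)) ⊆ Set.range L' := by
    change Φ.powerSpan 1 n ≤ LinearMap.range L
    refine Submodule.span_le.2 ?_
    rintro _ ⟨ξ, hξ, rfl⟩
    exact ⟨⟨ξ, hξ⟩, rfl⟩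
  obtain ⟨ξ, hξ⟩ := closure_minimal hsub hcl hmem
  exact ⟨ξ, Φ.toForm_injective _ hξ.symm⟩

/-- The element of `Φ` that corresponds to an element of `Φ^{⊙1}`. -/
def vec (f : (Φ.symPow 1).Sp) : Φ.E := (Φ.exists_eq_tpow_one f).choose

lemma tpow_vec (f : (Φ.symPow 1).Sp) : Φ.tpow 1 (Φ.vec f) = f :=
  (Φ.exists_eq_tpow_one f).choose_spec.symm

lemma apply_vec (ω : Φ.Dual) (f : (Φ.symPow 1).Sp) : ω (Φ.toSp (Φ.vec f)) = Φ.ev 1 ω f := by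
  rw [← Φ.tpow_vec f, ev_tpow, pow_one, tpow_vec]

/-- `vec` comes from a choice and is not visibly linear; a functional that norms `vec 0` settles
this one value, which `ev_derivS` needs. -/
lemma vec_zero : Φ.vec 0 = 0 := by
  obtain ⟨n, hn⟩ := Φ.exists_mem_step (Φ.vec 0)
  by_contra h
  obtain ⟨g, -, hgx⟩ := exists_dual_vector ℂ _ (norm_ne_zero_iff.2 h)
  have := Φ.apply_vec (Φ.ofNDual g) 0
  rw [map_zero] at this
  change g (Φ.vec 0) = 0 at this
  rw [hgx] at this
  simp [h] at this

end LBSpace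
end

/-! ### Calculus of tensor power series -/

noncomputable section

lemma sum_antidiagonal_right_comm {M : Type*} [AddCommMonoid M] (n : ℕ) (f : ℕ → ℕ → ℕ → M) :
    ∑ p ∈ Finset.HasAntidiagonal.antidiagonal n,
        ∑ q ∈ Finset.HasAntidiagonal.antidiagonal p.1, f q.1 q.2 p.2 =
      ∑ p ∈ Finset.HasAntidiagonal.antidiagonal n,
        ∑ q ∈ Finset.HasAntidiagonal.antidiagonal p.1, f q.1 p.2 q.2 := by
  rw [Finset.sum_sigma', Finset.sum_sigma']
  refine Finset.sum_bij' (fun x _ => ⟨(x.2.1 + x.1.2, x.2.2), (x.2.1, x.1.2)⟩)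
    (fun x _ => ⟨(x.2.1 + x.1.2, x.2.2), (x.2.1, x.1.2)⟩) ?_ ?_ ?_ ?_ ?_
  · rintro ⟨⟨a, b⟩, ⟨c, d⟩⟩ h
    simp only [Finset.mem_sigma, Finset.HasAntidiagonal.mem_antidiagonal] at h ⊢
    obtain ⟨h1, rfl⟩ := h
    exact ⟨by rw [← h1]; ring, trivial⟩
  · rintro ⟨⟨a, b⟩, ⟨c, d⟩⟩ h
    simp only [Finset.mem_sigma, Finset.HasAntidiagonal.mem_antidiagonal] at h ⊢
    obtain ⟨h1, rfl⟩ := h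
    exact ⟨by rw [← h1]; ring, trivial⟩
  · rintro ⟨⟨a, b⟩, ⟨c, d⟩⟩ h
    simp only [Finset.mem_sigma, Finset.HasAntidiagonal.mem_antidiagonal] at h ⊢
    obtain ⟨h1, rfl⟩ := h
    rfl
  · rintro ⟨⟨a, b⟩, ⟨c, d⟩⟩ h
    simp only [Finset.mem_sigma, Finset.HasAntidiagonal.mem_antidiagonal] at h ⊢
    obtain ⟨h1, rfl⟩ := h
    rfl
  · rintro ⟨⟨a, b⟩, ⟨c, d⟩⟩ h
    rfl

/-- Only the triangle below the antidiagonal contributes. This is how products of truncated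
exponentials are rearranged by total order. -/
lemma sum_range_sum_range_eq_antidiagonal {M : Type*} [AddCommMonoid M] (N : ℕ) (F : ℕ → ℕ → M)
    (hF : ∀ i j, N ≤ i + j → F i j = 0) :
    ∑ i ∈ Finset.range N, ∑ j ∈ Finset.range N, F i j =
      ∑ n ∈ Finset.range N, ∑ p ∈ Finset.HasAntidiagonal.antidiagonal n, F p.1 p.2 := by
  rw [← Finset.sum_product' (f := F)]
  rw [← Finset.sum_filter_of_ne (p := fun p : ℕ × ℕ => p.1 + p.2 < N)
    (fun p _ hp => by by_contra h; exact hp (hF _ _ (not_lt.1 h)))]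
  rw [← Finset.sum_fiberwise_of_maps_to (t := Finset.range N) (g := fun p : ℕ × ℕ => p.1 + p.2)
    (fun p hp => by simp at hp ⊢; omega)]
  refine Finset.sum_congr rfl fun n hn => Finset.sum_congr ?_ fun _ _ => rfl
  ext ⟨a, b⟩
  simp at hn ⊢
  omega

namespace LBSpace

variable (Φ : LBSpace.{u})

/-! ### Mixed powers and directional derivatives -/

/-- The element is the symmetrization of ξ^{⊗d} ⊗ η^{⊗j}. -/
lemma exists_mixed (d j : ℕ) (ξ η : Φ.E) : ∃ g : (Φ.symPow (d + j)).Sp,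
    ∀ ω : Φ.Dual, Φ.ev (d + j) ω g = ω (Φ.toSp ξ) ^ d * ω (Φ.toSp η) ^ j := by
  obtain ⟨n₁, h₁⟩ := Φ.exists_toForm_mem (Φ.tpow d ξ)
  obtain ⟨n₂, h₂⟩ := Φ.exists_toForm_mem (Φ.tpow j η)
  replace h₁ := Φ.symStep_mono _ (le_max_left n₁ n₂) h₁
  replace h₂ := Φ.symStep_mono _ (le_max_right n₁ n₂) h₂
  refine ⟨Φ.ofForm _ (Φ.sym_tmul_mem h₁ h₂), fun ω => ?_⟩
  obtain ⟨ν, hν⟩ := Φ.exists_ev_eq (max n₁ n₂) ω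
  rw [← ev_tpow, ← ev_tpow, hν _ _ h₁, hν _ _ h₂, hν _ _ (Φ.sym_tmul_mem h₁ h₂), toForm_ofForm,
    sym_apply_const, tmul_apply]

/-- Monomials separate tensors, so the binomial theorem for ω(ξ + tη)^k lifts to tensors. The curve
t ↦ (ξ + tη)^{⊗k} is thus a polynomial, and any linear functional, continuous or not, is
differentiable along it. -/
lemma exists_tpow_add (k : ℕ) (ξ η : Φ.E) : ∃ G : ℕ → (Φ.symPow k).Sp,
    (∀ t : ℂ, Φ.tpow k (ξ + t • η) = ∑ j ∈ Finset.range (k + 1), t ^ j • G j) ∧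
    ∀ j ≤ k, ∀ ω : Φ.Dual, Φ.ev k ω (G j) =
      ω (Φ.toSp ξ) ^ (k - j) * ω (Φ.toSp η) ^ j * k.choose j := by
  have h : ∀ j, ∃ g : (Φ.symPow k).Sp, j ≤ k → ∀ ω : Φ.Dual, Φ.ev k ω g =
      ω (Φ.toSp ξ) ^ (k - j) * ω (Φ.toSp η) ^ j * k.choose j := by
    intro j
    by_cases hj : j ≤ k
    · obtain ⟨d, rfl⟩ := Nat.exists_eq_add_of_le' hj
      obtain ⟨g, hg⟩ := Φ.exists_mixed d j ξ η
      refine ⟨((d + j).choose j : ℂ) • g, fun _ ω => ?_⟩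
      rw [map_smul, hg, Nat.add_sub_cancel, smul_eq_mul, mul_comm]
    · exact ⟨0, fun h => absurd h hj⟩
  choose G hG using h
  refine ⟨G, fun t => Φ.ext_ev fun ω => ?_, fun j hj => hG j hj⟩
  rw [ev_tpow, map_sum, map_add, map_smul, map_add, map_smul, add_comm, smul_eq_mul, add_pow]
  refine Finset.sum_congr rfl fun j hj => ?_
  rw [map_smul, hG j (by simpa [Nat.lt_succ_iff] using hj), smul_eq_mul, mul_pow]
  ring

/-- Linear functionals along an affine line of powers: differentiability. -/
lemma differentiableAt_tpow (k : ℕ) (D : (Φ.symPow k).Sp →ₗ[ℂ] ℂ) (ξ η : Φ.E) (t : ℂ) :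
    DifferentiableAt ℂ (fun t : ℂ => D (Φ.tpow k (ξ + t • η))) t := by
  obtain ⟨G, hG, -⟩ := Φ.exists_tpow_add k ξ η
  simp only [hG, map_sum, map_smul, smul_eq_mul]
  fun_prop

/-- The derivative of a linear functional along an affine line of powers. -/
lemma deriv_tpow_succ (m : ℕ) (D : (Φ.symPow (m + 1)).Sp →ₗ[ℂ] ℂ) (ξ η : Φ.E)
    (g : (Φ.symPow (m + 1)).Sp)
    (hg : ∀ ω : Φ.Dual, Φ.ev (m + 1) ω g = ω (Φ.toSp ξ) ^ m * ω (Φ.toSp η)) :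
    deriv (fun t : ℂ => D (Φ.tpow (m + 1) (ξ + t • η))) 0 = (m + 1 : ℕ) * D g := by
  obtain ⟨G, hG, hev⟩ := Φ.exists_tpow_add (m + 1) ξ η
  have h1 : G 1 = ((m + 1 : ℕ) : ℂ) • g := Φ.ext_ev fun ω => by
    rw [hev 1 (by omega), map_smul, hg, smul_eq_mul, Nat.choose_one_right]
    simp only [Nat.add_sub_cancel, pow_one]
    ring
  have h2 : HasDerivAt (fun t : ℂ => ∑ j ∈ Finset.range (m + 1 + 1), t ^ j * D (G j))
      (∑ j ∈ Finset.range (m + 1 + 1), (j * (0 : ℂ) ^ (j - 1)) * D (G j)) 0 :=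
    HasDerivAt.fun_sum fun j _ => (hasDerivAt_pow j (0 : ℂ)).mul_const _
  simp only [hG, map_sum, map_smul, smul_eq_mul]
  rw [h2.deriv, Finset.sum_eq_single 1]
  · rw [h1, map_smul, smul_eq_mul]; simp
  · intro j _ hj
    rcases Nat.lt_or_ge j 1 with h | h
    · have : j = 0 := by omega
      simp [this]
    · have : j - 1 ≠ 0 := by omega
      simp [this]
  · intro h
    simp at h

/-- The derivative of `⟨ω, C(ξ)⟩` in the direction `η`. -/
def dv {k i : ℕ} (C : Φ.Op k i) (ξ η : Φ.E) (ω : Φ.Dual) : ℂ :=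
  deriv (fun t : ℂ => Φ.ev i ω (C (Φ.tpow k (ξ + t • η)))) 0

lemma differentiableAt_dv {k i : ℕ} (C : Φ.Op k i) (ξ η : Φ.E) (ω : Φ.Dual) :
    DifferentiableAt ℂ (fun t : ℂ => Φ.ev i ω (C (Φ.tpow k (ξ + t • η)))) 0 :=
  Φ.differentiableAt_tpow k ((Φ.ev i ω).toLinearMap ∘ₗ C.toLinearMap) ξ η 0

lemma dv_zero_right {k i : ℕ} (C : Φ.Op k i) (ξ : Φ.E) (ω : Φ.Dual) : Φ.dv C ξ 0 ω = 0 := by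
  simp [dv]

lemma tpow_zero_eq (ξ η : Φ.E) : Φ.tpow 0 ξ = Φ.tpow 0 η :=
  Φ.ext_ev fun ω => by rw [ev_tpow, ev_tpow, pow_zero, pow_zero]

lemma dv_degree_zero {i : ℕ} (C : Φ.Op 0 i) (ξ η : Φ.E) (ω : Φ.Dual) : Φ.dv C ξ η ω = 0 := by
  have : (fun t : ℂ => Φ.ev i ω (C (Φ.tpow 0 (ξ + t • η)))) =
      fun _ => Φ.ev i ω (C (Φ.tpow 0 ξ)) := by
    funext t
    rw [Φ.tpow_zero_eq (ξ + t • η) ξ]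
  rw [dv, this, deriv_const]

lemma dv_sum {k i : ℕ} {ι : Type*} (s : Finset ι) (C : ι → Φ.Op k i) (ξ η : Φ.E) (ω : Φ.Dual) :
    Φ.dv (∑ a ∈ s, C a) ξ η ω = ∑ a ∈ s, Φ.dv (C a) ξ η ω := by
  simp only [dv, _root_.sum_apply, map_sum]
  rw [deriv_fun_sum fun a _ => Φ.differentiableAt_dv (C a) ξ η ω]

lemma dv_odot {k i₁ i₂ j₁ j₂ : ℕ} (hk : k = i₁ + i₂) (A₁ : Φ.Op i₁ j₁) (A₂ : Φ.Op i₂ j₂)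
    (ξ η : Φ.E) (ω : Φ.Dual) : Φ.dv (Φ.odot k A₁ A₂) ξ η ω =
      Φ.dv A₁ ξ η ω * Φ.ev j₂ ω (A₂ (Φ.tpow i₂ ξ)) +
        Φ.ev j₁ ω (A₁ (Φ.tpow i₁ ξ)) * Φ.dv A₂ ξ η ω := by
  simp only [dv, Φ.ev_odot hk]
  rw [deriv_fun_mul (Φ.differentiableAt_dv A₁ ξ η ω) (Φ.differentiableAt_dv A₂ ξ η ω)]
  simp

/-- This connects analytic derivatives with the algebraic definition of `derivS`: the direction B
ξ^{⊗r} produces the coefficient of D_B with its factor m + 1. The Leibniz rule for D_B can then be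
taken from the ordinary product rule. -/
lemma dv_succ {m r i : ℕ} (k : ℕ) (hk : k = m + r) (C : Φ.Op (m + 1) i) (B : Φ.Op r 1) (ξ : Φ.E)
    (ω : Φ.Dual) : Φ.dv C ξ (Φ.vec (B (Φ.tpow r ξ))) ω = (m + 1 : ℕ) *
      Φ.ev i ω (C (Φ.odot k (ContinuousLinearMap.id ℂ (Φ.symPow m).Sp) B (Φ.tpow k ξ))) := by
  refine Φ.deriv_tpow_succ m ((Φ.ev i ω).toLinearMap ∘ₗ C.toLinearMap) ξ _ _ fun ω' => ?_
  rw [Φ.ev_odot hk, ContinuousLinearMap.id_apply, ev_tpow, apply_vec]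

/-! ### Bilinearity of the symmetric tensor product of operators -/

lemma odot_add_right {k i₁ i₂ j₁ j₂ : ℕ} (hk : k = i₁ + i₂) (A : Φ.Op i₁ j₁) (B B' : Φ.Op i₂ j₂) :
    Φ.odot k A (B + B') = Φ.odot k A B + Φ.odot k A B' := Φ.op_ext fun ξ ω => by
  simp only [_root_.add_apply, map_add, Φ.ev_odot hk, mul_add]

lemma odot_smul_left {k i₁ i₂ j₁ j₂ : ℕ} (hk : k = i₁ + i₂) (c : ℂ) (A : Φ.Op i₁ j₁)
    (B : Φ.Op i₂ j₂) : Φ.odot k (c • A) B = c • Φ.odot k A B := Φ.op_ext fun ξ ω => by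
  simp only [_root_.smul_apply, map_smul, Φ.ev_odot hk, smul_mul_assoc]

lemma odot_smul_right {k i₁ i₂ j₁ j₂ : ℕ} (hk : k = i₁ + i₂) (c : ℂ) (A : Φ.Op i₁ j₁)
    (B : Φ.Op i₂ j₂) : Φ.odot k A (c • B) = c • Φ.odot k A B := Φ.op_ext fun ξ ω => by
  simp only [_root_.smul_apply, map_smul, Φ.ev_odot hk, mul_smul_comm]

lemma odot_zero_left {k i₁ i₂ j₁ j₂ : ℕ} (hk : k = i₁ + i₂) (B : Φ.Op i₂ j₂) :
    Φ.odot k (0 : Φ.Op i₁ j₁) B = 0 := by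
  simpa using Φ.odot_smul_left hk 0 0 B

lemma odot_zero_right {k i₁ i₂ j₁ j₂ : ℕ} (hk : k = i₁ + i₂) (A : Φ.Op i₁ j₁) :
    Φ.odot k A (0 : Φ.Op i₂ j₂) = 0 := by
  simpa using Φ.odot_smul_right hk 0 A 0

/-! ### Generating series -/

@[simp] lemma series_add_apply {i : ℕ} (X Y : Φ.Series i) (k : ℕ) : (X + Y) k = X k + Y k := rfl

@[simp] lemma series_sub_apply {i : ℕ} (X Y : Φ.Series i) (k : ℕ) : (X - Y) k = X k - Y k := rfl

@[simp] lemma series_zero_apply {i : ℕ} (k : ℕ) : (0 : Φ.Series i) k = 0 := rfl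

@[simp] lemma series_smul_apply {i : ℕ} (c : ℂ) (X : Φ.Series i) (k : ℕ) :
    (c • X) k = c • X k := rfl

lemma series_sum_apply {i : ℕ} {ι : Type*} (s : Finset ι) (X : ι → Φ.Series i) (k : ℕ) :
    (∑ a ∈ s, X a) k = ∑ a ∈ s, X a k :=
  Finset.sum_apply k s X

/-- The scalar power series with the coefficients `⟨ω, Xₖ ξ^{⊗k}⟩`. -/
def gen {i : ℕ} (X : Φ.Series i) (ξ : Φ.E) (ω : Φ.Dual) : PowerSeries ℂ :=
  PowerSeries.mk fun k => Φ.ev i ω (X k (Φ.tpow k ξ))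

lemma coeff_gen {i : ℕ} (X : Φ.Series i) (ξ : Φ.E) (ω : Φ.Dual) (k : ℕ) :
    PowerSeries.coeff k (Φ.gen X ξ ω) = Φ.ev i ω (X k (Φ.tpow k ξ)) :=
  PowerSeries.coeff_mk _ _

/-- The passage from tensor series to ℂ[[z]]: products become products there, so polynomial
identities between series need only commutative algebra. -/
lemma gen_ext {i : ℕ} {X Y : Φ.Series i} (h : ∀ ξ ω, Φ.gen X ξ ω = Φ.gen Y ξ ω) : X = Y := by
  refine funext fun k => Φ.op_ext fun ξ ω => ?_
  rw [← coeff_gen, h, coeff_gen]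

lemma gen_add {i : ℕ} (X Y : Φ.Series i) (ξ : Φ.E) (ω : Φ.Dual) :
    Φ.gen (X + Y) ξ ω = Φ.gen X ξ ω + Φ.gen Y ξ ω := by
  ext k; simp [coeff_gen]

lemma gen_smul {i : ℕ} (c : ℂ) (X : Φ.Series i) (ξ : Φ.E) (ω : Φ.Dual) :
    Φ.gen (c • X) ξ ω = c • Φ.gen X ξ ω := by
  ext k; simp [coeff_gen]

lemma gen_mulS {i j : ℕ} (X : Φ.Series i) (Y : Φ.Series j) (ξ : Φ.E) (ω : Φ.Dual) :
    Φ.gen (Φ.mulS X Y) ξ ω = Φ.gen X ξ ω * Φ.gen Y ξ ω := by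
  ext k
  rw [coeff_gen, PowerSeries.coeff_mul, mulS, _root_.sum_apply, map_sum]
  refine Finset.sum_congr rfl fun a ha => ?_
  rw [Φ.ev_odot (Finset.HasAntidiagonal.mem_antidiagonal.1 ha).symm, coeff_gen, coeff_gen]

lemma gen_oneS (ξ : Φ.E) (ω : Φ.Dual) : Φ.gen Φ.oneS ξ ω = 1 := by
  ext k
  rw [coeff_gen, PowerSeries.coeff_one]
  cases k with
  | zero => simp [oneS, ev_tpow]
  | succ k => simp [oneS]

lemma gen_powS (B : Φ.Series 1) (l : ℕ) (ξ : Φ.E) (ω : Φ.Dual) :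
    Φ.gen (Φ.powS B l) ξ ω = Φ.gen B ξ ω ^ l := by
  induction l with
  | zero => rw [powS, gen_oneS, pow_zero]
  | succ l ih => rw [powS, gen_mulS, ih, pow_succ]

lemma gen_spowS (α : Φ.Series 0) (l : ℕ) (ξ : Φ.E) (ω : Φ.Dual) :
    Φ.gen (Φ.spowS α l) ξ ω = Φ.gen α ξ ω ^ l := by
  induction l with
  | zero => rw [spowS, gen_oneS, pow_zero]
  | succ l ih => rw [pow_succ, ← ih]; exact Φ.gen_mulS _ _ ξ ω

lemma gen_idS (ξ : Φ.E) (ω : Φ.Dual) :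
    Φ.gen Φ.idS ξ ω = PowerSeries.C (ω (Φ.toSp ξ)) * PowerSeries.X := by
  ext k
  rw [coeff_gen, PowerSeries.coeff_C_mul, PowerSeries.coeff_X]
  match k with
  | 0 => simp [idS]
  | 1 => simp [idS, ev_tpow]
  | k + 2 => simp [idS]

lemma mulS_add_left {i j : ℕ} (X X' : Φ.Series i) (Y : Φ.Series j) :
    Φ.mulS (X + X') Y = Φ.mulS X Y + Φ.mulS X' Y :=
  Φ.gen_ext fun ξ ω => by simp only [gen_mulS, gen_add, add_mul]

lemma mulS_add_right {i j : ℕ} (X : Φ.Series i) (Y Y' : Φ.Series j) :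
    Φ.mulS X (Y + Y') = Φ.mulS X Y + Φ.mulS X Y' :=
  Φ.gen_ext fun ξ ω => by simp only [gen_mulS, gen_add, mul_add]

lemma mulS_smul_left {i j : ℕ} (c : ℂ) (X : Φ.Series i) (Y : Φ.Series j) :
    Φ.mulS (c • X) Y = c • Φ.mulS X Y :=
  Φ.gen_ext fun ξ ω => by simp only [gen_mulS, gen_smul, smul_mul_assoc]

lemma mulS_smul_right {i j : ℕ} (c : ℂ) (X : Φ.Series i) (Y : Φ.Series j) :
    Φ.mulS X (c • Y) = c • Φ.mulS X Y :=
  Φ.gen_ext fun ξ ω => by simp only [gen_mulS, gen_smul, mul_smul_comm]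

/-- The product of series as a bilinear map. -/
def mulSL (i j : ℕ) : Φ.Series i →ₗ[ℂ] Φ.Series j →ₗ[ℂ] Φ.Series (i + j) :=
  LinearMap.mk₂ ℂ Φ.mulS Φ.mulS_add_left Φ.mulS_smul_left Φ.mulS_add_right Φ.mulS_smul_right

lemma mulSL_apply {i j : ℕ} (X : Φ.Series i) (Y : Φ.Series j) :
    Φ.mulSL i j X Y = Φ.mulS X Y := rfl

/-! ### The derivative in the direction of a series -/

/-- The derivative in the direction of a series as a linear operator. -/
def derivL (B : Φ.Series 1) (i : ℕ) : Module.End ℂ (Φ.Series i) where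
  toFun := Φ.derivS B
  map_add' X Y := by
    funext k
    simp only [derivS, series_add_apply, ContinuousLinearMap.add_comp, smul_add,
      Finset.sum_add_distrib]
  map_smul' c X := by
    funext k
    simp only [derivS, series_smul_apply, ContinuousLinearMap.smul_comp, RingHom.id_apply,
      Finset.smul_sum]
    exact Finset.sum_congr rfl fun m _ => smul_comm _ _ _

lemma derivL_apply (B : Φ.Series 1) {i : ℕ} (X : Φ.Series i) :
    Φ.derivL B i X = Φ.derivS B X := rfl

/-- Both ends of the antidiagonal vanish: the term l = 0 because X_0 has zero derivative, the term l
= k + 1 because B has no constant term. Including them gives a convolution without boundary cases.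
-/
lemma ev_derivS {B : Φ.Series 1} (hB : B 0 = 0) {i : ℕ} (X : Φ.Series i) (k : ℕ) (ξ : Φ.E)
    (ω : Φ.Dual) : Φ.ev i ω (Φ.derivS B X k (Φ.tpow k ξ)) =
      ∑ p ∈ Finset.HasAntidiagonal.antidiagonal (k + 1),
        Φ.dv (X p.1) ξ (Φ.vec (B p.2 (Φ.tpow p.2 ξ))) ω := by
  rw [Finset.Nat.sum_antidiagonal_eq_sum_range_succ
    (fun l r => Φ.dv (X l) ξ (Φ.vec (B r (Φ.tpow r ξ))) ω), Finset.sum_range_succ,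
    Finset.sum_range_succ', dv_degree_zero, Nat.sub_self, hB]
  rw [show (0 : Φ.Op 0 1) (Φ.tpow 0 ξ) = 0 from rfl, vec_zero, dv_zero_right, add_zero, add_zero,
    derivS, _root_.sum_apply, map_sum]
  refine Finset.sum_congr rfl fun m hm => ?_
  have hm' : m < k := Finset.mem_range.1 hm
  rw [Nat.add_sub_add_right, Φ.dv_succ k (by omega), _root_.smul_apply, map_smul, smul_eq_mul]
  rfl

/-- The Leibniz rule. -/
lemma derivS_mulS {B : Φ.Series 1} (hB : B 0 = 0) {i j : ℕ} (X : Φ.Series i) (Y : Φ.Series j) :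
    Φ.derivS B (Φ.mulS X Y) = Φ.mulS (Φ.derivS B X) Y + Φ.mulS X (Φ.derivS B Y) := by
  refine Φ.gen_ext fun ξ ω => ?_
  rw [gen_add, gen_mulS, gen_mulS]
  -- D_B lowers the degree by one before B raises it, so the full convolution is z times the
  -- generating series of D_B X. The rule is proved after multiplication by z.
  let F : {i : ℕ} → Φ.Series i → PowerSeries ℂ := fun X => PowerSeries.mk fun p =>
    ∑ q ∈ Finset.HasAntidiagonal.antidiagonal p,
      Φ.dv (X q.1) ξ (Φ.vec (B q.2 (Φ.tpow q.2 ξ))) ω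
  have hF : ∀ {i : ℕ} (X : Φ.Series i), F X = PowerSeries.X * Φ.gen (Φ.derivS B X) ξ ω := by
    intro i X
    ext p
    cases p with
    | zero => simp [F, dv_degree_zero]
    | succ p => rw [PowerSeries.coeff_succ_X_mul, coeff_gen, Φ.ev_derivS hB]; simp [F]
  have hX : (PowerSeries.X : PowerSeries ℂ) ≠ 0 := PowerSeries.X_ne_zero
  apply mul_left_cancel₀ hX
  rw [mul_add, ← mul_assoc, ← hF, mul_left_comm, ← hF, ← hF]
  ext n
  rw [map_add, PowerSeries.coeff_mul, PowerSeries.coeff_mul]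
  simp only [F, PowerSeries.coeff_mk, coeff_gen]
  have h1 : ∀ p ∈ Finset.HasAntidiagonal.antidiagonal n,
      Φ.dv (Φ.mulS X Y p.1) ξ (Φ.vec (B p.2 (Φ.tpow p.2 ξ))) ω =
      ∑ q ∈ Finset.HasAntidiagonal.antidiagonal p.1,
        (Φ.dv (X q.1) ξ (Φ.vec (B p.2 (Φ.tpow p.2 ξ))) ω * Φ.ev j ω (Y q.2 (Φ.tpow q.2 ξ)) +
        Φ.ev i ω (X q.1 (Φ.tpow q.1 ξ)) * Φ.dv (Y q.2) ξ (Φ.vec (B p.2 (Φ.tpow p.2 ξ))) ω) := by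
    intro p _
    rw [mulS, dv_sum]
    exact Finset.sum_congr rfl fun q hq => Φ.dv_odot (Finset.HasAntidiagonal.mem_antidiagonal.1 hq).symm _ _ _ _ _
  rw [Finset.sum_congr rfl h1]
  simp only [Finset.sum_add_distrib]
  congr 1
  · rw [sum_antidiagonal_right_comm n (fun a c r =>
      Φ.dv (X a) ξ (Φ.vec (B r (Φ.tpow r ξ))) ω * Φ.ev j ω (Y c (Φ.tpow c ξ)))]
    exact Finset.sum_congr rfl fun p _ => (Finset.sum_mul _ _ _).symm
  · rw [← Finset.Nat.sum_antidiagonal_swap (n := n) (f := fun p =>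
      Φ.ev i ω (X p.1 (Φ.tpow p.1 ξ)) * _)]
    have h2 : ∀ p ∈ Finset.HasAntidiagonal.antidiagonal n,
        ∑ q ∈ Finset.HasAntidiagonal.antidiagonal p.1, Φ.ev i ω (X q.1 (Φ.tpow q.1 ξ)) *
          Φ.dv (Y q.2) ξ (Φ.vec (B p.2 (Φ.tpow p.2 ξ))) ω =
        ∑ q ∈ Finset.HasAntidiagonal.antidiagonal p.1, Φ.ev i ω (X q.2 (Φ.tpow q.2 ξ)) *
          Φ.dv (Y q.1) ξ (Φ.vec (B p.2 (Φ.tpow p.2 ξ))) ω := fun p _ =>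
      (Finset.Nat.sum_antidiagonal_swap (n := p.1) (f := fun q =>
        Φ.ev i ω (X q.1 (Φ.tpow q.1 ξ)) * Φ.dv (Y q.2) ξ (Φ.vec (B p.2 (Φ.tpow p.2 ξ))) ω)).symm
    rw [Finset.sum_congr rfl h2, sum_antidiagonal_right_comm n (fun c a r =>
      Φ.ev i ω (X a (Φ.tpow a ξ)) * Φ.dv (Y c) ξ (Φ.vec (B r (Φ.tpow r ξ))) ω)]
    exact Finset.sum_congr rfl fun p _ => (Finset.mul_sum _ _ _).symm

end LBSpace
end

/-! ### Exponentials of derivations and their flows -/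

noncomputable section

/-- The iterated Leibniz rule. -/
lemma leibniz_pow {M N Q : Type*} [AddCommGroup M] [Module ℂ M] [AddCommGroup N] [Module ℂ N]
    [AddCommGroup Q] [Module ℂ Q] (μ : M →ₗ[ℂ] N →ₗ[ℂ] Q) (T₁ : Module.End ℂ M)
    (T₂ : Module.End ℂ N) (T₃ : Module.End ℂ Q)
    (h : ∀ x y, T₃ (μ x y) = μ (T₁ x) y + μ x (T₂ y)) (n : ℕ) (x : M) (y : N) :
    (T₃ ^ n) (μ x y) = ∑ p ∈ Finset.HasAntidiagonal.antidiagonal n,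
      n.choose p.1 • μ ((T₁ ^ p.1) x) ((T₂ ^ p.2) y) := by
  induction n with
  | zero => simp
  | succ n ih =>
    rw [Finset.sum_antidiagonal_choose_succ_nsmul (fun i j => μ ((T₁ ^ i) x) ((T₂ ^ j) y)),
      pow_succ', Module.End.mul_apply, ih, map_sum, add_comm, ← Finset.sum_add_distrib]
    refine Finset.sum_congr rfl fun p hp => ?_
    have hp' := Finset.HasAntidiagonal.mem_antidiagonal.1 hp
    rw [map_nsmul, h, nsmul_add, Nat.choose_symm_of_eq_add hp'.symm, ← Module.End.mul_apply,
      ← pow_succ', ← Module.End.mul_apply, ← pow_succ']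

lemma inv_factorial_mul_choose {n i j : ℕ} (h : i + j = n) :
    (n.factorial : ℂ)⁻¹ * n.choose i = (i.factorial : ℂ)⁻¹ * (j.factorial : ℂ)⁻¹ := by
  subst h
  have h1 : ((i + j).factorial : ℂ) ≠ 0 := by exact_mod_cast (i + j).factorial_ne_zero
  have h2 : (i.factorial : ℂ) ≠ 0 := by exact_mod_cast i.factorial_ne_zero
  have h3 : (j.factorial : ℂ) ≠ 0 := by exact_mod_cast j.factorial_ne_zero
  have h4 : ((i + j).choose i : ℂ) * i.factorial * j.factorial = (i + j).factorial := by
    rw [Nat.choose_symm_add]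
    exact_mod_cast Nat.add_choose_mul_factorial_mul_factorial i j
  field_simp
  rw [← h4]

namespace LBSpace

variable (Φ : LBSpace.{u})

/-! ### Operators that raise the order, and their exponentials -/

/-- `T` raises the order of formal series. -/
def IsRaising {i : ℕ} (T : Module.End ℂ (Φ.Series i)) : Prop :=
  ∀ (n : ℕ) (X : Φ.Series i), (∀ j < n, X j = 0) → ∀ j < n + 1, T X j = 0

variable {Φ}

lemma IsRaising.pow {i : ℕ} {T : Module.End ℂ (Φ.Series i)} (hT : Φ.IsRaising T) {m : ℕ}
    {X : Φ.Series i} (hX : ∀ j < m, X j = 0) (n : ℕ) : ∀ j < m + n, (T ^ n) X j = 0 := by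
  induction n with
  | zero => simpa using hX
  | succ n ih =>
    rw [pow_succ', Module.End.mul_apply]
    exact hT _ _ ih

lemma IsRaising.pow_apply {i : ℕ} {T : Module.End ℂ (Φ.Series i)} (hT : Φ.IsRaising T)
    (X : Φ.Series i) {n k : ℕ} (h : k < n) : (T ^ n) X k = 0 :=
  hT.pow (m := 0) (fun _ hj => absurd hj (Nat.not_lt_zero _)) n k (by omega)

lemma IsRaising.smul {i : ℕ} {T : Module.End ℂ (Φ.Series i)} (hT : Φ.IsRaising T) (t : ℂ) :
    Φ.IsRaising (t • T) := fun n X hX j hj => by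
  rw [LinearMap.smul_apply, series_smul_apply, hT n X hX j hj, smul_zero]

/-- The exponential of an operator that raises the order. -/
def expSer {i : ℕ} (T : Module.End ℂ (Φ.Series i)) : Module.End ℂ (Φ.Series i) where
  toFun X := fun k => ∑ n ∈ Finset.range (k + 1), (n.factorial : ℂ)⁻¹ • (T ^ n) X k
  map_add' X Y := by
    funext k
    simp only [map_add, series_add_apply, smul_add]
    exact Finset.sum_add_distrib
  map_smul' c X := by
    funext k
    simp only [map_smul, series_smul_apply, RingHom.id_apply]
    change _ = c • ∑ n ∈ Finset.range (k + 1), (n.factorial : ℂ)⁻¹ • (T ^ n) X k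
    rw [Finset.smul_sum]
    exact Finset.sum_congr rfl fun n _ => smul_comm _ _ _

lemma expSer_apply {i : ℕ} (T : Module.End ℂ (Φ.Series i)) (X : Φ.Series i) (k : ℕ) :
    expSer T X k = ∑ n ∈ Finset.range (k + 1), (n.factorial : ℂ)⁻¹ • (T ^ n) X k := rfl

/-- Powers of T never move information to lower orders, so a series may be replaced by anything that
agrees with it up to order k. -/
lemma IsRaising.expSer_congr {i : ℕ} {T : Module.End ℂ (Φ.Series i)} (hT : Φ.IsRaising T)
    {X Y : Φ.Series i} {k : ℕ} (h : ∀ j ≤ k, X j = Y j) : expSer T X k = expSer T Y k := by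
  rw [← sub_eq_zero, ← series_sub_apply, ← map_sub, expSer_apply]
  refine Finset.sum_eq_zero fun n _ => ?_
  rw [hT.pow (m := k + 1) (fun j hj => ?_) n k (by omega), smul_zero]
  rw [series_sub_apply, h j (by omega), sub_self]

/-- Powers beyond the k-th do not reach order k, so the sum may be cut at any larger N. Different
coefficients and different exponentials can thus be compared with a common truncation. -/
lemma IsRaising.expSer_eq {i : ℕ} {T : Module.End ℂ (Φ.Series i)} (hT : Φ.IsRaising T)
    (X : Φ.Series i) {k N : ℕ} (h : k < N) :
    expSer T X k = (∑ n ∈ Finset.range N, (n.factorial : ℂ)⁻¹ • (T ^ n) X) k := by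
  rw [series_sum_apply, expSer_apply]
  refine Finset.sum_subset (Finset.range_mono h) fun n _ hn => ?_
  rw [hT.pow_apply X (by simpa using hn), smul_zero]

/-- The exponentials of the multiples of an operator are a one-parameter group. -/
lemma IsRaising.expSer_add {i : ℕ} {T : Module.End ℂ (Φ.Series i)} (hT : Φ.IsRaising T) (s t : ℂ)
    (X : Φ.Series i) : expSer ((s + t) • T) X = expSer (s • T) (expSer (t • T) X) := by
  funext k
  rw [(hT.smul s).expSer_congr (Y := ∑ n ∈ Finset.range (k + 1),
      (n.factorial : ℂ)⁻¹ • ((t • T) ^ n) X)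
    (fun j hj => (hT.smul t).expSer_eq X (Nat.lt_succ_of_le hj)),
    (hT.smul s).expSer_eq _ (Nat.lt_succ_self k), (hT.smul _).expSer_eq _ (Nat.lt_succ_self k)]
  simp only [map_sum, series_sum_apply, Finset.smul_sum]
  -- Pairs of exponents with sum above k contribute nothing, so the product of the truncations can
  -- be collected by total exponent and the binomial theorem applied.
  rw [sum_range_sum_range_eq_antidiagonal]
  · refine Finset.sum_congr rfl fun n _ => ?_
    rw [smul_pow, LinearMap.smul_apply, series_smul_apply, series_smul_apply,
      (Commute.all s t).add_pow', smul_smul, Finset.mul_sum, Finset.sum_smul]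
    refine Finset.sum_congr rfl fun p hp => ?_
    have hp' := Finset.HasAntidiagonal.mem_antidiagonal.1 hp
    rw [smul_pow, smul_pow, LinearMap.smul_apply, LinearMap.smul_apply, map_smul, map_smul,
      ← Module.End.mul_apply, ← pow_add, hp']
    simp only [series_smul_apply, smul_smul]
    congr 1
    rw [nsmul_eq_mul, ← mul_assoc, inv_factorial_mul_choose hp']
    ring
  · intro a b hab
    rw [smul_pow, smul_pow, LinearMap.smul_apply, LinearMap.smul_apply, map_smul, map_smul,
      ← Module.End.mul_apply, ← pow_add]
    simp only [series_smul_apply]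
    rw [hT.pow_apply X (by omega)]
    simp

lemma expSer_zero_smul {i : ℕ} (T : Module.End ℂ (Φ.Series i)) (X : Φ.Series i) :
    expSer ((0 : ℂ) • T) X = X := by
  funext k
  rw [expSer_apply, Finset.sum_eq_single 0]
  · simp
  · intro n _ hn
    rw [zero_smul, zero_pow hn]
    simp
  · simp

lemma mulS_congr {i j k : ℕ} {X X' : Φ.Series i} {Y Y' : Φ.Series j} (hX : ∀ a ≤ k, X a = X' a)
    (hY : ∀ a ≤ k, Y a = Y' a) : Φ.mulS X Y k = Φ.mulS X' Y' k := by
  refine Finset.sum_congr rfl fun p hp => ?_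
  have hp' := Finset.HasAntidiagonal.mem_antidiagonal.1 hp
  rw [hX _ (by omega), hY _ (by omega)]

lemma mulS_vanish {i j p q : ℕ} {X : Φ.Series i} {Y : Φ.Series j} (hX : ∀ a < p, X a = 0)
    (hY : ∀ a < q, Y a = 0) : ∀ k < p + q, Φ.mulS X Y k = 0 := by
  refine fun k hk => Finset.sum_eq_zero fun a ha => ?_
  have ha' := (Finset.HasAntidiagonal.mem_antidiagonal.1 ha).symm
  rcases Nat.lt_or_ge a.1 p with h | h
  · rw [hX _ h, Φ.odot_zero_left ha']
  · rw [hY a.2 (by omega), Φ.odot_zero_right ha']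

/-- The exponentials of operators that satisfy the Leibniz rule are multiplicative. -/
lemma expSer_mulS {i j : ℕ} {T₁ : Module.End ℂ (Φ.Series i)} {T₂ : Module.End ℂ (Φ.Series j)}
    {T₃ : Module.End ℂ (Φ.Series (i + j))} (h₁ : Φ.IsRaising T₁) (h₂ : Φ.IsRaising T₂)
    (h₃ : Φ.IsRaising T₃)
    (h : ∀ X Y, T₃ (Φ.mulS X Y) = Φ.mulS (T₁ X) Y + Φ.mulS X (T₂ Y))
    (X : Φ.Series i) (Y : Φ.Series j) :
    expSer T₃ (Φ.mulS X Y) = Φ.mulS (expSer T₁ X) (expSer T₂ Y) := by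
  funext k
  rw [h₃.expSer_eq _ (Nat.lt_succ_self k),
    mulS_congr (X' := ∑ n ∈ Finset.range (k + 1), (n.factorial : ℂ)⁻¹ • (T₁ ^ n) X)
      (Y' := ∑ n ∈ Finset.range (k + 1), (n.factorial : ℂ)⁻¹ • (T₂ ^ n) Y)
      (fun a ha => h₁.expSer_eq X (Nat.lt_succ_of_le ha))
      (fun a ha => h₂.expSer_eq Y (Nat.lt_succ_of_le ha))]
  simp only [← mulSL_apply]
  simp only [map_sum, LinearMap.sum_apply, series_sum_apply]
  rw [Finset.sum_comm, sum_range_sum_range_eq_antidiagonal]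
  · refine Finset.sum_congr rfl fun n _ => ?_
    rw [leibniz_pow (Φ.mulSL i j) T₁ T₂ T₃ h, Finset.smul_sum, series_sum_apply]
    refine Finset.sum_congr rfl fun p hp => ?_
    have hp' := Finset.HasAntidiagonal.mem_antidiagonal.1 hp
    rw [← Nat.cast_smul_eq_nsmul ℂ, smul_smul, inv_factorial_mul_choose hp', map_smul, map_smul,
      LinearMap.smul_apply, smul_smul, mul_comm]
  · intro a b hab
    rw [map_smul, map_smul, LinearMap.smul_apply, mulSL_apply, series_smul_apply,
      series_smul_apply, mulS_vanish (p := a) (q := b) (fun c hc => h₁.pow_apply X hc)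
        (fun c hc => h₂.pow_apply Y hc) k (by omega)]
    simp

/-! ### Composition with a fixed operator -/

variable (Φ)

/-- The series `∑ₖ C Yₖ ξ^{⊗k}`. -/
def compOp {l i : ℕ} (C : Φ.Op l i) : Φ.Series l →ₗ[ℂ] Φ.Series i where
  toFun Y := fun k => C.comp (Y k)
  map_add' Y Z := by
    funext k
    exact ContinuousLinearMap.comp_add _ _ _
  map_smul' c Y := by
    funext k
    exact ContinuousLinearMap.comp_smul _ _ _

lemma compOp_apply {l i : ℕ} (C : Φ.Op l i) (Y : Φ.Series l) (k : ℕ) :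
    Φ.compOp C Y k = C.comp (Y k) := rfl

/-- D_B acts by precomposition, so it commutes with a fixed operator composed from the left. -/
lemma derivS_compOp (B : Φ.Series 1) {l i : ℕ} (C : Φ.Op l i) (Y : Φ.Series l) :
    Φ.derivS B (Φ.compOp C Y) = Φ.compOp C (Φ.derivS B Y) := by
  funext k
  rw [compOp_apply, derivS, derivS, ContinuousLinearMap.comp_finsetSum]
  refine Finset.sum_congr rfl fun m _ => ?_
  rw [ContinuousLinearMap.comp_smul]
  rfl

lemma pairS_eq (ω : Φ.Dual) (B : Φ.Series 1) : Φ.pairS ω B = Φ.compOp (Φ.dualPow ω 1) B := rfl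

lemma expSer_derivL_compOp (B : Φ.Series 1) {l i : ℕ} (C : Φ.Op l i) (Y : Φ.Series l) (t : ℂ) :
    expSer (t • Φ.derivL B i) (Φ.compOp C Y) = Φ.compOp C (expSer (t • Φ.derivL B l) Y) := by
  have h : ∀ n, ((t • Φ.derivL B i) ^ n) (Φ.compOp C Y) =
      Φ.compOp C (((t • Φ.derivL B l) ^ n) Y) := by
    intro n
    induction n with
    | zero => rfl
    | succ n ih =>
      rw [pow_succ', Module.End.mul_apply, ih, pow_succ', Module.End.mul_apply,
        LinearMap.smul_apply, LinearMap.smul_apply, derivL_apply, derivS_compOp, map_smul, derivL_apply]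
  funext k
  simp only [expSer_apply, h, compOp_apply]
  rw [ContinuousLinearMap.comp_finsetSum]
  exact Finset.sum_congr rfl fun n _ => (ContinuousLinearMap.comp_smul _ _ _).symm

/-! ### Unit, powers of the identity -/

lemma oneS_succ (k : ℕ) : Φ.oneS (k + 1) = 0 := rfl

lemma mulS_oneS {i : ℕ} (X : Φ.Series i) : (Φ.mulS X Φ.oneS : Φ.Series i) = X := by
  refine Φ.gen_ext fun ξ ω => ?_
  refine (Φ.gen_mulS X Φ.oneS ξ ω).trans ?_
  rw [gen_oneS, mul_one]

lemma derivS_oneS (B : Φ.Series 1) : Φ.derivS B Φ.oneS = 0 := by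
  funext k
  refine Finset.sum_eq_zero fun m _ => ?_
  rw [oneS_succ, ContinuousLinearMap.zero_comp, smul_zero]

lemma derivS_idS {B : Φ.Series 1} (hB : B 0 = 0) : Φ.derivS B Φ.idS = B := by
  funext k
  cases k with
  | zero => rw [hB]; rfl
  | succ k =>
    rw [derivS, Finset.sum_eq_single 0]
    · refine Φ.op_ext fun ξ ω => ?_
      simp only [idS, zero_add, Nat.cast_one, one_smul, Nat.sub_zero]
      rw [ContinuousLinearMap.comp_apply]
      change Φ.ev (0 + 1) ω (Φ.odot _ _ _ _) = _
      rw [Φ.ev_odot (by omega), ContinuousLinearMap.id_apply, ev_tpow, pow_zero, one_mul]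
    · intro m _ hm
      obtain ⟨m, rfl⟩ := Nat.exists_eq_succ_of_ne_zero hm
      simp [idS]
    · simp

lemma powS_idS_self (l : ℕ) : Φ.powS Φ.idS l l = ContinuousLinearMap.id ℂ _ := by
  refine Φ.op_ext fun ξ ω => ?_
  rw [← coeff_gen, gen_powS, gen_idS, mul_pow, ← map_pow, PowerSeries.coeff_C_mul,
    PowerSeries.coeff_X_pow_self, ContinuousLinearMap.id_apply, ev_tpow, mul_one]

lemma powS_idS_of_ne {j l : ℕ} (h : j ≠ l) : Φ.powS Φ.idS l j = 0 := by
  refine Φ.op_ext fun ξ ω => ?_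
  rw [← coeff_gen, gen_powS, gen_idS, mul_pow, ← map_pow, PowerSeries.coeff_C_mul,
    PowerSeries.coeff_X_pow, if_neg h]
  simp

/-- A series is, up to every finite order, a sum of series `C_l ξ^{⊗l}`. -/
lemma eq_sum_compOp {i : ℕ} (C : Φ.Series i) {j N : ℕ} (h : j < N) :
    C j = (∑ l ∈ Finset.range N, Φ.compOp (C l) (Φ.powS Φ.idS l)) j := by
  rw [series_sum_apply, Finset.sum_eq_single j]
  · rw [compOp_apply, powS_idS_self, ContinuousLinearMap.comp_id]
  · intro l _ hl
    rw [compOp_apply, Φ.powS_idS_of_ne hl.symm, ContinuousLinearMap.comp_zero]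
  · intro hj
    exact absurd (Finset.mem_range.2 h) hj

/-! ### Derivations and composition of series -/

/-- The only term of degree n that order considerations do not remove pairs X_n with β_1, which is
zero because β starts in degree two. -/
lemma isRaising_derivL {β : Φ.Series 1} (hβ : β ∈ Φ.W1) (i : ℕ) : Φ.IsRaising (Φ.derivL β i) := by
  intro n X hX j hj
  rw [derivL_apply, derivS]
  refine Finset.sum_eq_zero fun m hm => ?_
  have hm' : m < j := Finset.mem_range.1 hm
  rcases Nat.lt_or_ge (m + 1) n with h | h
  · rw [hX _ h, ContinuousLinearMap.zero_comp, smul_zero]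
  · have h1 : j - m = 1 := by omega
    rw [h1, hβ.2, Φ.odot_zero_right (by omega), ContinuousLinearMap.comp_zero, smul_zero]

lemma derivS_congr (B : Φ.Series 1) {i k : ℕ} {X Y : Φ.Series i} (h : ∀ j ≤ k, X j = Y j) :
    Φ.derivS B X k = Φ.derivS B Y k := by
  refine Finset.sum_congr rfl fun m hm => ?_
  rw [h _ (Finset.mem_range.1 hm)]

lemma smul_derivL_mulS {β : Φ.Series 1} (hβ : β ∈ Φ.W1) (t : ℂ) {i j : ℕ} (X : Φ.Series i)
    (Y : Φ.Series j) : (t • Φ.derivL β (i + j)) (Φ.mulS X Y) =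
      Φ.mulS ((t • Φ.derivL β i) X) Y + Φ.mulS X ((t • Φ.derivL β j) Y) := by
  simp only [LinearMap.smul_apply, derivL_apply]
  rw [Φ.derivS_mulS hβ.1, smul_add, mulS_smul_left, mulS_smul_right]

/-- The exponential of a derivation is multiplicative. -/
lemma expSer_derivL_mulS {β : Φ.Series 1} (hβ : β ∈ Φ.W1) (t : ℂ) {i j : ℕ} (X : Φ.Series i)
    (Y : Φ.Series j) : expSer (t • Φ.derivL β (i + j)) (Φ.mulS X Y) =
      Φ.mulS (expSer (t • Φ.derivL β i) X) (expSer (t • Φ.derivL β j) Y) :=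
  expSer_mulS ((Φ.isRaising_derivL hβ i).smul t) ((Φ.isRaising_derivL hβ j).smul t)
    ((Φ.isRaising_derivL hβ (i + j)).smul t) (Φ.smul_derivL_mulS hβ t) X Y

lemma expSer_derivL_oneS (β : Φ.Series 1) (t : ℂ) :
    expSer (t • Φ.derivL β 0) Φ.oneS = Φ.oneS := by
  funext k
  rw [expSer_apply, Finset.sum_eq_single 0]
  · simp
  · intro n _ hn
    obtain ⟨n, rfl⟩ := Nat.exists_eq_succ_of_ne_zero hn
    rw [pow_succ, Module.End.mul_apply, LinearMap.smul_apply, derivL_apply, derivS_oneS, smul_zero,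
      map_zero]
    simp
  · simp

/-- The second component of the one-parameter group with tangent vector `(α, β)`. -/
def flowB (β : Φ.Series 1) (t : ℂ) : Φ.Series 1 := expSer (t • Φ.derivL β 1) Φ.idS

lemma expSer_powS {β : Φ.Series 1} (hβ : β ∈ Φ.W1) (t : ℂ) (B : Φ.Series 1) (l : ℕ) :
    expSer (t • Φ.derivL β l) (Φ.powS B l) = Φ.powS (expSer (t • Φ.derivL β 1) B) l := by
  induction l with
  | zero => exact Φ.expSer_derivL_oneS β t
  | succ l ih => rw [powS, Φ.expSer_derivL_mulS hβ, ih]; rfl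

/-- Composition with the flow of a derivation is the exponential of the derivation. -/
lemma compS_flowB {β : Φ.Series 1} (hβ : β ∈ Φ.W1) (t : ℂ) {i : ℕ} (C : Φ.Series i) :
    Φ.compS C (Φ.flowB β t) = expSer (t • Φ.derivL β i) C := by
  funext k
  -- Up to order k, C is a finite sum of the series C_l ξ^{⊗l}; on these the exponential passes
  -- through C_l and is multiplicative on the powers of ξ.
  rw [((Φ.isRaising_derivL hβ i).smul t).expSer_congr
    (fun j hj => Φ.eq_sum_compOp C (Nat.lt_succ_of_le hj)), map_sum, series_sum_apply, compS]
  refine Finset.sum_congr rfl fun l _ => ?_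
  rw [expSer_derivL_compOp, Φ.expSer_powS hβ]
  rfl

lemma derivS_mem_W0 {α : Φ.Series 0} (hα : α ∈ Φ.W0) {β : Φ.Series 1} (hβ : β ∈ Φ.W1) :
    Φ.derivS β α ∈ Φ.W0 :=
  Φ.isRaising_derivL hβ 0 1 α (fun j hj => by
    have : j = 0 := by omega
    rw [this]; exact hα) 0 (by omega)

lemma derivS_mem_W1 {β β' : Φ.Series 1} (hβ : β ∈ Φ.W1) (hβ' : β' ∈ Φ.W1) :
    Φ.derivS β β' ∈ Φ.W1 := by
  have h := Φ.isRaising_derivL hβ 1 1 β' (fun j hj => by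
    have : j = 0 := by omega
    rw [this]; exact hβ'.1)
  exact ⟨h 0 (by omega), h 1 (by omega)⟩

lemma sub_mem_W0 {α α' : Φ.Series 0} (h : α ∈ Φ.W0) (h' : α' ∈ Φ.W0) : α - α' ∈ Φ.W0 := by
  change α 0 - α' 0 = 0
  rw [show α 0 = 0 from h, show α' 0 = 0 from h', sub_zero]

lemma sub_mem_W1 {β β' : Φ.Series 1} (h : β ∈ Φ.W1) (h' : β' ∈ Φ.W1) : β - β' ∈ Φ.W1 := by
  constructor
  · rw [series_sub_apply, h.1, h'.1, sub_zero]
  · rw [series_sub_apply, h.2, h'.2, sub_zero]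

/-- The commutator of derivations. -/
lemma derivS_commutator {β₁ β₂ : Φ.Series 1} (h₁ : β₁ ∈ Φ.W1) (h₂ : β₂ ∈ Φ.W1) {i : ℕ}
    (X : Φ.Series i) : Φ.derivS β₂ (Φ.derivS β₁ X) - Φ.derivS β₁ (Φ.derivS β₂ X) =
      Φ.derivS (Φ.derivS β₂ β₁ - Φ.derivS β₁ β₂) X := by
  set β₃ := Φ.derivS β₂ β₁ - Φ.derivS β₁ β₂ with hβ₃
  have h₃ : β₃ ∈ Φ.W1 := Φ.sub_mem_W1 (Φ.derivS_mem_W1 h₂ h₁) (Φ.derivS_mem_W1 h₁ h₂)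
  -- Both sides satisfy the Leibniz rule and agree on ξ, so they agree on all powers of ξ; the mixed
  -- first-order terms cancel in the commutator.
  have hpow : ∀ l, Φ.derivS β₂ (Φ.derivS β₁ (Φ.powS Φ.idS l)) -
      Φ.derivS β₁ (Φ.derivS β₂ (Φ.powS Φ.idS l)) = Φ.derivS β₃ (Φ.powS Φ.idS l) := by
    intro l
    induction l with
    | zero =>
      simp only [powS, derivS_oneS]
      simp only [← derivL_apply, map_zero, sub_zero]
    | succ l ih =>
      rw [powS, Φ.derivS_mulS h₁.1, Φ.derivS_mulS h₂.1, Φ.derivS_mulS h₃.1, ← ih]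
      simp only [← derivL_apply, map_add]
      simp only [derivL_apply]
      rw [Φ.derivS_mulS h₂.1, Φ.derivS_mulS h₂.1, Φ.derivS_mulS h₁.1, Φ.derivS_mulS h₁.1,
        Φ.derivS_idS h₁.1, Φ.derivS_idS h₂.1, Φ.derivS_idS h₃.1, hβ₃]
      simp only [← mulSL_apply, map_sub, LinearMap.sub_apply]
      abel
  funext k
  have hloc : ∀ j ≤ k, X j = (∑ l ∈ Finset.range (k + 1), Φ.compOp (X l) (Φ.powS Φ.idS l)) j :=
    fun j hj => Φ.eq_sum_compOp X (Nat.lt_succ_of_le hj)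
  have hsum : ∀ B : Φ.Series 1,
      Φ.derivS B (∑ l ∈ Finset.range (k + 1), Φ.compOp (X l) (Φ.powS Φ.idS l)) =
        ∑ l ∈ Finset.range (k + 1), Φ.compOp (X l) (Φ.derivS B (Φ.powS Φ.idS l)) := by
    intro B
    rw [← derivL_apply, map_sum]
    exact Finset.sum_congr rfl fun l _ => Φ.derivS_compOp B _ _
  have hsum₂ : ∀ B B' : Φ.Series 1,
      Φ.derivS B (∑ l ∈ Finset.range (k + 1), Φ.compOp (X l) (Φ.derivS B' (Φ.powS Φ.idS l))) =
        ∑ l ∈ Finset.range (k + 1),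
          Φ.compOp (X l) (Φ.derivS B (Φ.derivS B' (Φ.powS Φ.idS l))) := by
    intro B B'
    rw [← derivL_apply, map_sum]
    exact Finset.sum_congr rfl fun l _ => Φ.derivS_compOp B _ _
  rw [series_sub_apply, Φ.derivS_congr β₃ hloc, hsum,
    Φ.derivS_congr β₂ (fun j hj => Φ.derivS_congr β₁ fun a ha => hloc a (ha.trans hj)),
    Φ.derivS_congr β₁ (fun j hj => Φ.derivS_congr β₂ fun a ha => hloc a (ha.trans hj)),
    hsum, hsum, hsum₂, hsum₂, ← series_sub_apply, ← Finset.sum_sub_distrib]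
  refine congrArg (fun Z : Φ.Series i => Z k) (Finset.sum_congr rfl fun l _ => ?_)
  rw [← map_sub, hpow]

/-! ### The exponential of a scalar series -/

lemma spowS_vanish {F : Φ.Series 0} (hF : F 0 = 0) (n : ℕ) : ∀ k < n, Φ.spowS F n k = 0 := by
  induction n with
  | zero => exact fun k hk => absurd hk (Nat.not_lt_zero k)
  | succ n ih =>
    refine mulS_vanish (p := n) (q := 1) ih fun a ha => ?_
    have : a = 0 := by omega
    rw [this, hF]

lemma expS_eq {F : Φ.Series 0} (hF : F 0 = 0) {j N : ℕ} (h : j < N) :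
    Φ.expS F j = (∑ n ∈ Finset.range N, (n.factorial : ℂ)⁻¹ • Φ.spowS F n) j := by
  rw [series_sum_apply, expS]
  refine Finset.sum_subset (Finset.range_mono h) fun n _ hn => ?_
  rw [Φ.spowS_vanish hF n j (by simpa using hn), smul_zero]

lemma expSer_spowS {β : Φ.Series 1} (hβ : β ∈ Φ.W1) (t : ℂ) (F : Φ.Series 0) (n : ℕ) :
    expSer (t • Φ.derivL β 0) (Φ.spowS F n) = Φ.spowS (expSer (t • Φ.derivL β 0) F) n := by
  induction n with
  | zero => exact Φ.expSer_derivL_oneS β t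
  | succ n ih => 
    rw [spowS, spowS, ← ih]
    exact Φ.expSer_derivL_mulS hβ t (Φ.spowS F n) F

lemma expSer_apply_zero {i : ℕ} (T : Module.End ℂ (Φ.Series i)) (X : Φ.Series i) :
    expSer T X 0 = X 0 := by
  rw [expSer_apply]; simp

lemma expSer_expS {β : Φ.Series 1} (hβ : β ∈ Φ.W1) (t : ℂ) {F : Φ.Series 0} (hF : F 0 = 0) :
    expSer (t • Φ.derivL β 0) (Φ.expS F) = Φ.expS (expSer (t • Φ.derivL β 0) F) := by
  funext k
  rw [((Φ.isRaising_derivL hβ 0).smul t).expSer_congr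
    (fun j hj => Φ.expS_eq hF (Nat.lt_succ_of_le hj)),
    Φ.expS_eq (by rw [expSer_apply_zero, hF]) (Nat.lt_succ_self k)]
  simp only [map_sum, map_smul, Φ.expSer_spowS hβ]

/-! ### The dual operator -/

/-- The operator `F ↦ F α + D_β F` on scalar series. -/
def dualL (α : Φ.Series 0) (β : Φ.Series 1) : Module.End ℂ (Φ.Series 0) :=
  (Φ.mulSL 0 0).flip α + Φ.derivL β 0

lemma dualL_apply (α : Φ.Series 0) (β : Φ.Series 1) (F : Φ.Series 0) :
    Φ.dualL α β F = (Φ.mulS F α : Φ.Series 0) + Φ.derivS β F := rfl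

lemma isRaising_dualL {α : Φ.Series 0} (hα : α ∈ Φ.W0) {β : Φ.Series 1} (hβ : β ∈ Φ.W1) :
    Φ.IsRaising (Φ.dualL α β) := by
  intro n X hX j hj
  rw [dualL_apply, series_add_apply, ← derivL_apply, Φ.isRaising_derivL hβ 0 n X hX j hj, add_zero]
  refine mulS_vanish (p := n) (q := 1) hX (fun a ha => ?_) j hj
  have : a = 0 := by omega
  rw [this]; exact hα

lemma gen_mulS_zero (X Y : Φ.Series 0) (ξ : Φ.E) (ω : Φ.Dual) :
    Φ.gen (Φ.mulS X Y : Φ.Series 0) ξ ω = Φ.gen X ξ ω * Φ.gen Y ξ ω := Φ.gen_mulS X Y ξ ω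

lemma derivS_mulS_zero {B : Φ.Series 1} (hB : B 0 = 0) (X Y : Φ.Series 0) :
    Φ.derivS B (Φ.mulS X Y : Φ.Series 0) =
      (Φ.mulS (Φ.derivS B X) Y : Φ.Series 0) + (Φ.mulS X (Φ.derivS B Y) : Φ.Series 0) :=
  Φ.derivS_mulS hB X Y

/-- Multiplication by α can be absorbed in the second factor, so `dualL` obeys a Leibniz rule with
D_β acting on the first factor. `expSer_mulS` allows different operators on the factors for this
reason. -/
lemma dualL_mulS (α : Φ.Series 0) {β : Φ.Series 1} (hβ : β 0 = 0) (F A : Φ.Series 0) :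
    Φ.dualL α β (Φ.mulS F A : Φ.Series 0) =
      (Φ.mulS (Φ.derivS β F) A : Φ.Series 0) + (Φ.mulS F (Φ.dualL α β A) : Φ.Series 0) := by
  rw [dualL_apply, Φ.derivS_mulS_zero hβ]
  refine Φ.gen_ext fun ξ ω => ?_
  simp only [gen_add, gen_mulS_zero, dualL_apply]
  ring

/-- The first component of the one-parameter group with tangent vector `(α, β)`. -/
def flowA (α : Φ.Series 0) (β : Φ.Series 1) (t : ℂ) : Φ.Series 0 :=
  expSer (t • Φ.dualL α β) Φ.oneS

lemma expSer_dualL_mulS {α : Φ.Series 0} (hα : α ∈ Φ.W0) {β : Φ.Series 1} (hβ : β ∈ Φ.W1) (t : ℂ)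
    (F A : Φ.Series 0) : expSer (t • Φ.dualL α β) (Φ.mulS F A : Φ.Series 0) =
      Φ.mulS (expSer (t • Φ.derivL β 0) F) (expSer (t • Φ.dualL α β) A) := by
  refine expSer_mulS (i := 0) (j := 0) ((Φ.isRaising_derivL hβ 0).smul t)
    ((Φ.isRaising_dualL hα hβ).smul t) ((Φ.isRaising_dualL hα hβ).smul t) (fun X Y => ?_) F A
  have := Φ.dualL_mulS α hβ.1 X Y
  simp only [LinearMap.smul_apply, mulS_smul_left, mulS_smul_right, derivL_apply]
  rw [← smul_add]
  exact congrArg (t • ·) this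

lemma expSer_dualL {α : Φ.Series 0} (hα : α ∈ Φ.W0) {β : Φ.Series 1} (hβ : β ∈ Φ.W1) (t : ℂ)
    (F : Φ.Series 0) : expSer (t • Φ.dualL α β) F =
      Φ.mulS (expSer (t • Φ.derivL β 0) F) (Φ.flowA α β t) := by
  have := Φ.expSer_dualL_mulS hα hβ t F Φ.oneS
  rwa [mulS_oneS] at this

/-- The action of the exponential of the dual operator on generating functions. -/
lemma expSer_dualL_genFun {α : Φ.Series 0} (hα : α ∈ Φ.W0) {β : Φ.Series 1} (hβ : β ∈ Φ.W1)
    (t : ℂ) (ω : Φ.Dual) (A : Φ.Series 0) {B : Φ.Series 1} (hB : B 0 = 0) :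
    expSer (t • Φ.dualL α β) (Φ.mulS (Φ.expS (Φ.pairS ω B)) A : Φ.Series 0) =
      Φ.mulS (Φ.expS (Φ.pairS ω (Φ.compS B (Φ.flowB β t))))
        (Φ.mulS (Φ.compS A (Φ.flowB β t)) (Φ.flowA α β t) : Φ.Series 0) := by
  have h0 : Φ.pairS ω B 0 = 0 := by
    change (Φ.dualPow ω 1).comp (B 0) = 0
    rw [hB, ContinuousLinearMap.comp_zero]
  rw [Φ.expSer_dualL_mulS hα hβ, Φ.expSer_expS hβ t h0, pairS_eq, expSer_derivL_compOp,
    Φ.compS_flowB hβ, Φ.compS_flowB hβ, Φ.expSer_dualL hα hβ t A]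
  rfl

/-- The D-parts are handled by `derivS_commutator`. Expanding D_{β₂}(F α₁) and D_{β₁}(F α₂), the
terms with first derivatives of F and the products α₁α₂ cancel. -/
lemma dualL_commutator {α₁ α₂ : Φ.Series 0} {β₁ β₂ : Φ.Series 1}
    (h₁ : β₁ ∈ Φ.W1) (h₂ : β₂ ∈ Φ.W1) (F : Φ.Series 0) :
    Φ.dualL α₂ β₂ (Φ.dualL α₁ β₁ F) - Φ.dualL α₁ β₁ (Φ.dualL α₂ β₂ F) =
      Φ.dualL (Φ.derivS β₂ α₁ - Φ.derivS β₁ α₂) (Φ.derivS β₂ β₁ - Φ.derivS β₁ β₂) F := by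
  have hsub : ∀ (X Y : Φ.Series 0) ξ ω, Φ.gen (X - Y) ξ ω = Φ.gen X ξ ω - Φ.gen Y ξ ω := by
    intro X Y ξ ω
    ext k; simp [coeff_gen]
  have hadd : ∀ (B : Φ.Series 1) (X Y : Φ.Series 0),
      Φ.derivS B (X + Y) = Φ.derivS B X + Φ.derivS B Y := fun B X Y => map_add (Φ.derivL B 0) X Y
  rw [dualL_apply _ (_ - _), ← Φ.derivS_commutator h₁ h₂]
  simp only [dualL_apply, hadd, Φ.derivS_mulS_zero h₁.1, Φ.derivS_mulS_zero h₂.1]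
  refine Φ.gen_ext fun ξ ω => ?_
  simp only [hsub, gen_add, gen_mulS_zero]
  ring

end LBSpace
end

/-! ### Duality between polynomials and scalar series -/

noncomputable section

namespace LBSpace

variable (Φ : LBSpace.{u})

/-! ### Polynomials as a direct sum -/

lemma ev_smul (k : ℕ) (z : ℂ) (ω : Φ.Dual) (f : (Φ.symPow k).Sp) :
    Φ.ev k (z • ω) f = z ^ k * Φ.ev k ω f := by
  have : Φ.ev k (z • ω) = z ^ k • Φ.ev k ω := Φ.ext_powers fun ξ => by
    rw [ev_tpow, _root_.smul_apply, _root_.smul_apply, ev_tpow, smul_eq_mul, smul_eq_mul, mul_pow]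
  rw [this]
  rfl

lemma mem_of_mem_polyLE {n : ℕ} {S : Submodule ℂ Φ.Poly}
    (h : ∀ k ≤ n, ∀ f, Φ.monomial k f ∈ S) {p : Φ.Poly} (hp : (p : Φ.Dual → ℂ) ∈ Φ.polyLE n) :
    p ∈ S := by
  have : Φ.polyLE n ≤ S.map Φ.Poly.subtype := by
    refine iSup_le fun k => ?_
    rintro _ ⟨f, rfl⟩
    exact ⟨Φ.monomial k f, h k (Nat.lt_succ_iff.1 k.2) f, rfl⟩
  obtain ⟨q, hq, hqp⟩ := this hp
  rwa [← Subtype.ext hqp]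

lemma monomial_mem_polyLE {k n : ℕ} (h : k ≤ n) (f : (Φ.symPow k).Sp) :
    (Φ.monomial k f : Φ.Dual → ℂ) ∈ Φ.polyLE n :=
  Submodule.mem_iSup_of_mem (p := fun k : Fin (n + 1) => LinearMap.range (Φ.monomialFun k))
    ⟨k, Nat.lt_succ_of_le h⟩ ⟨f, rfl⟩

lemma polyLE_mono {m n : ℕ} (h : m ≤ n) : Φ.polyLE m ≤ Φ.polyLE n := by
  refine iSup_le fun k => ?_
  rintro _ ⟨f, rfl⟩
  exact Φ.monomial_mem_polyLE ((Nat.lt_succ_iff.1 k.2).trans h) f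

lemma mem_of_monomial_mem {S : Submodule ℂ Φ.Poly} (h : ∀ k f, Φ.monomial k f ∈ S) (p : Φ.Poly) :
    p ∈ S := by
  have : Φ.Poly ≤ S.map Φ.Poly.subtype := by
    refine iSup_le fun k => ?_
    rintro _ ⟨f, rfl⟩
    exact ⟨Φ.monomial k f, h k f, rfl⟩
  obtain ⟨q, hq, hqp⟩ := this p.2
  rwa [← Subtype.ext hqp]

lemma exists_mem_polyLE (p : Φ.Poly) : ∃ n, (p : Φ.Dual → ℂ) ∈ Φ.polyLE n := by
  let S : Submodule ℂ Φ.Poly :=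
    { carrier := {p | ∃ n, (p : Φ.Dual → ℂ) ∈ Φ.polyLE n}
      zero_mem' := ⟨0, Submodule.zero_mem _⟩
      add_mem' := by
        rintro p q ⟨m, hm⟩ ⟨n, hn⟩
        exact ⟨max m n, Submodule.add_mem _ (Φ.polyLE_mono (le_max_left m n) hm)
          (Φ.polyLE_mono (le_max_right m n) hn)⟩
      smul_mem' := by
        rintro c p ⟨m, hm⟩
        exact ⟨m, Submodule.smul_mem _ c hm⟩ }
  exact Φ.mem_of_monomial_mem (S := S) (fun k f => ⟨k, Φ.monomial_mem_polyLE le_rfl f⟩) p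

lemma polyHom_ext {M : Type*} [AddCommGroup M] [Module ℂ M] {S T : Φ.Poly →ₗ[ℂ] M}
    (h : ∀ k f, S (Φ.monomial k f) = T (Φ.monomial k f)) : S = T :=
  LinearMap.ext fun p => Φ.mem_of_monomial_mem (S := LinearMap.eqLocus S T) h p

/-- The sum of the monomials with given coefficients. -/
def sumMonomial : (Π₀ k, (Φ.symPow k).Sp) →ₗ[ℂ] Φ.Poly := DFinsupp.lsum ℂ Φ.monomial

lemma sumMonomial_single (k : ℕ) (f : (Φ.symPow k).Sp) :
    Φ.sumMonomial (DFinsupp.single k f) = Φ.monomial k f :=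
  DFinsupp.lsum_single _ _ _ _

/-- A polynomial on Φ' restricted to a complex line z ↦ zω is a polynomial in z whose coefficients
are the homogeneous parts at ω. The sum of the homogeneous spaces is therefore direct, and maps may
be prescribed on monomials (`polyLift`). -/
lemma sumMonomial_bijective : Function.Bijective Φ.sumMonomial := by
  classical
  constructor
  · rw [injective_iff_map_eq_zero]
    intro v hv
    have hv' : ∀ ω, ∑ k ∈ v.support, Φ.ev k ω (v k) = 0 := by
      intro ω
      have h1 : Φ.sumMonomial v = ∑ k ∈ v.support, Φ.monomial k (v k) := by
        rw [sumMonomial, DFinsupp.lsum_apply_apply, DFinsupp.sumAddHom_apply, DFinsupp.sum]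
        rfl
      have h2 := congrFun (congrArg (fun p : Φ.Poly => (p : Φ.Dual → ℂ)) (h1.symm.trans hv)) ω
      simp only [Submodule.coe_sum, Finset.sum_apply] at h2
      exact h2
    ext1 k
    rw [DFinsupp.zero_apply]
    refine Φ.ext_ev fun ω => ?_
    rw [map_zero]
    have hP : ∑ k ∈ v.support, Polynomial.monomial k (Φ.ev k ω (v k)) = 0 := by
      refine Polynomial.funext fun z => ?_
      rw [Polynomial.eval_finsetSum, Polynomial.eval_zero, ← hv' (z • ω)]
      refine Finset.sum_congr rfl fun k _ => ?_
      rw [Polynomial.eval_monomial, ev_smul, mul_comm]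
    by_cases hk : k ∈ v.support
    · have := congrArg (fun P => Polynomial.coeff P k) hP
      simp only [Polynomial.finsetSum_coeff, Polynomial.coeff_monomial,
        Finset.sum_ite_eq', hk, if_true, Polynomial.coeff_zero] at this
      exact this
    · rw [DFinsupp.notMem_support_iff.1 hk, map_zero]
  · intro p
    exact Φ.mem_of_monomial_mem (S := LinearMap.range Φ.sumMonomial)
      (fun k f => ⟨_, Φ.sumMonomial_single k f⟩) p

/-- The linear map on polynomials with given values on monomials. -/
def polyLift {M : Type*} [AddCommGroup M] [Module ℂ M] (T : ∀ k, (Φ.symPow k).Sp →ₗ[ℂ] M) :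
    Φ.Poly →ₗ[ℂ] M :=
  DFinsupp.lsum ℂ T ∘ₗ (LinearEquiv.ofBijective Φ.sumMonomial Φ.sumMonomial_bijective).symm

lemma polyLift_monomial {M : Type*} [AddCommGroup M] [Module ℂ M]
    (T : ∀ k, (Φ.symPow k).Sp →ₗ[ℂ] M) (k : ℕ) (f : (Φ.symPow k).Sp) :
    Φ.polyLift T (Φ.monomial k f) = T k f := by
  have : (LinearEquiv.ofBijective Φ.sumMonomial Φ.sumMonomial_bijective).symm (Φ.monomial k f) =
      DFinsupp.single k f := by
    rw [LinearEquiv.symm_apply_eq]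
    exact (Φ.sumMonomial_single k f).symm
  rw [polyLift, LinearMap.comp_apply, LinearEquiv.coe_coe, this]
  exact DFinsupp.lsum_single _ _ _ _

/-! ### The pairing of series and polynomials -/

/-- The functional on polynomials with `⟨ω^{⊗k}, f⟩ ↦ k! F_k f`. -/
def pairing (F : Φ.Series 0) : Φ.Poly →ₗ[ℂ] ℂ :=
  Φ.polyLift fun k => (k.factorial : ℂ) • (Φ.scalarL.comp (F k)).toLinearMap

lemma pairing_monomial (F : Φ.Series 0) (k : ℕ) (f : (Φ.symPow k).Sp) :
    Φ.pairing F (Φ.monomial k f) = k.factorial * Φ.scalar (F k f) := by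
  rw [pairing, polyLift_monomial]
  rfl

lemma gen_pairS (ω ω' : Φ.Dual) (B : Φ.Series 1) (ξ : Φ.E) :
    Φ.gen (Φ.pairS ω B) ξ ω' = Φ.gen B ξ ω := by
  ext k
  rw [coeff_gen, coeff_gen, ev_zero]
  rfl

/-- On ξ^{⊗k} only the k-th power of ⟨ω, ξ⟩ has a coefficient of order k. Since the pairing carries
the factor k!, pairing with exp⟨ω, ξ⟩ is evaluation at ω. -/
lemma scalar_expS_pairS_idS (ω : Φ.Dual) (k : ℕ) (f : (Φ.symPow k).Sp) :
    Φ.scalar (Φ.expS (Φ.pairS ω Φ.idS) k f) = (k.factorial : ℂ)⁻¹ * Φ.ev k ω f := by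
  have : Φ.scalarL.comp (Φ.expS (Φ.pairS ω Φ.idS) k) = (k.factorial : ℂ)⁻¹ • Φ.ev k ω := by
    refine Φ.ext_powers fun ξ => ?_
    rw [ContinuousLinearMap.comp_apply, scalarL_apply, ← Φ.ev_zero ω, _root_.smul_apply, ev_tpow,
      expS, _root_.sum_apply, map_sum, Finset.sum_eq_single k]
    · rw [_root_.smul_apply, map_smul, ← coeff_gen, gen_spowS, gen_pairS, gen_idS, mul_pow,
        ← map_pow, PowerSeries.coeff_C_mul, PowerSeries.coeff_X_pow_self, mul_one]
    · intro n _ hn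
      rw [_root_.smul_apply, map_smul, ← coeff_gen, gen_spowS, gen_pairS, gen_idS, mul_pow,
        ← map_pow, PowerSeries.coeff_C_mul, PowerSeries.coeff_X_pow, if_neg hn.symm, mul_zero,
        smul_zero]
    · intro h
      exact absurd (Finset.self_mem_range_succ k) h
  exact DFunLike.congr_fun this f

/-- The values of polynomials in terms of the pairing. -/
lemma coe_apply_eq_pairing (p : Φ.Poly) (ω : Φ.Dual) :
    (p : Φ.Dual → ℂ) ω = Φ.pairing (Φ.expS (Φ.pairS ω Φ.idS)) p := by
  have : (LinearMap.proj ω ∘ₗ Φ.Poly.subtype : Φ.Poly →ₗ[ℂ] ℂ) =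
      Φ.pairing (Φ.expS (Φ.pairS ω Φ.idS)) := by
    refine Φ.polyHom_ext fun k f => ?_
    rw [pairing_monomial, scalar_expS_pairS_idS, ← mul_assoc, mul_inv_cancel₀, one_mul]
    · rfl
    · exact_mod_cast k.factorial_ne_zero
  exact DFunLike.congr_fun this p

lemma poly_ext {p q : Φ.Poly} (h : ∀ F, Φ.pairing F p = Φ.pairing F q) : p = q :=
  Subtype.ext (funext fun ω => by rw [coe_apply_eq_pairing, coe_apply_eq_pairing, h])

/-- Monomials span the polynomials, and the 1/k! of the generating function cancels the k! of the
pairing. The right side says that the transpose of P maps exp⟨ω, ξ⟩ to exp⟨ω, B⟩ A. -/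
lemma hasGenFun_iff {P : Φ.PolyOp} {A : Φ.Series 0} {B : Φ.Series 1} : Φ.HasGenFun P A B ↔
    ∀ (ω : Φ.Dual) (p : Φ.Poly), (P p : Φ.Dual → ℂ) ω =
      Φ.pairing (Φ.mulS (Φ.expS (Φ.pairS ω B)) A : Φ.Series 0) p := by
  have hk : ∀ k : ℕ, (k.factorial : ℂ) ≠ 0 := fun k => by exact_mod_cast k.factorial_ne_zero
  constructor
  · intro h ω p
    have : (LinearMap.proj ω ∘ₗ Φ.Poly.subtype ∘ₗ P : Φ.Poly →ₗ[ℂ] ℂ) =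
        Φ.pairing (Φ.mulS (Φ.expS (Φ.pairS ω B)) A : Φ.Series 0) := by
      refine Φ.polyHom_ext fun k f => ?_
      rw [pairing_monomial, ← h ω k f, ← mul_assoc, mul_inv_cancel₀ (hk k), one_mul]
      rfl
    exact DFunLike.congr_fun this p
  · intro h ω k f
    rw [h, pairing_monomial, ← mul_assoc, inv_mul_cancel₀ (hk k), one_mul]

lemma HasGenFun.unique {P P' : Φ.PolyOp} {A : Φ.Series 0} {B : Φ.Series 1}
    (h : Φ.HasGenFun P A B) (h' : Φ.HasGenFun P' A B) : P = P' := by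
  rw [hasGenFun_iff] at h h'
  refine LinearMap.ext fun p => Subtype.ext (funext fun ω => ?_)
  rw [h, h']

/-! ### The operators of first order -/

lemma odot_id_scalar {k i r : ℕ} (hk : k = i + r) (a : Φ.Op r 0) (ξ : Φ.E) :
    (Φ.odot k (ContinuousLinearMap.id ℂ (Φ.symPow i).Sp) a : Φ.Op k i) (Φ.tpow k ξ) =
      Φ.scalar (a (Φ.tpow r ξ)) • Φ.tpow i ξ := by
  refine Φ.ext_ev fun ω => ?_
  refine (Φ.ev_odot hk _ a ξ ω).trans ?_
  rw [map_smul, ev_zero, ContinuousLinearMap.id_apply, smul_eq_mul, mul_comm]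
  rfl

/-- The blocks of `α(∇)`, up to factorials. -/
def alphaBlock (α : Φ.Series 0) (i k : ℕ) : Φ.Op k i :=
  Φ.odot k (ContinuousLinearMap.id ℂ (Φ.symPow i).Sp) (α (k - i))

/-- The blocks of `M(β(∇))`, up to factorials. -/
def betaBlock (β : Φ.Series 1) : ∀ i k : ℕ, Φ.Op k i
  | 0, _ => 0
  | i + 1, k => ((i + 1 : ℕ) : ℂ) •
      Φ.odot k (ContinuousLinearMap.id ℂ (Φ.symPow i).Sp) (β (k - i))

/-- The blocks of `α(∇) + M(β(∇))`. -/
def vBlock (α : Φ.Series 0) (β : Φ.Series 1) (i k : ℕ) : Φ.Op k i :=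
  if i ≤ k then ((k.factorial : ℂ) * (i.factorial : ℂ)⁻¹) •
    (Φ.alphaBlock α i k + Φ.betaBlock β i k) else 0

/-- The operator `α(∇) + M(β(∇))` on polynomials, in terms of its blocks. -/
def vOp (α : Φ.Series 0) (β : Φ.Series 1) : Φ.PolyOp :=
  Φ.polyLift fun k => ∑ i ∈ Finset.range (k + 1),
    Φ.monomial i ∘ₗ (Φ.vBlock α β i k).toLinearMap

lemma vOp_monomial (α : Φ.Series 0) (β : Φ.Series 1) (k : ℕ) (f : (Φ.symPow k).Sp) :
    Φ.vOp α β (Φ.monomial k f) =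
      ∑ i ∈ Finset.range (k + 1), Φ.monomial i (Φ.vBlock α β i k f) := by
  rw [vOp, polyLift_monomial, LinearMap.sum_apply]
  rfl

lemma vBlock_of_lt {i k : ℕ} (h : k < i) (α : Φ.Series 0) (β : Φ.Series 1) :
    Φ.vBlock α β i k = 0 := if_neg (not_le.2 h)

/-- The operator is dual to the operator `F ↦ F α + D_β F`. -/
lemma pairing_vOp (α : Φ.Series 0) (β : Φ.Series 1) (F : Φ.Series 0) (p : Φ.Poly) :
    Φ.pairing F (Φ.vOp α β p) = Φ.pairing (Φ.dualL α β F) p := by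
  -- The factor k!/i! in the blocks is chosen so that the factorials of the pairing cancel; the
  -- blocks of α then give the coefficients of Fα, those of β the coefficients of D_β F.
  have hop : ∀ k, ∑ i ∈ Finset.range (k + 1), (i.factorial : ℂ) • (F i).comp (Φ.vBlock α β i k) =
      (k.factorial : ℂ) • Φ.dualL α β F k := by
    intro k
    have h1 : ∀ i ∈ Finset.range (k + 1), (i.factorial : ℂ) • (F i).comp (Φ.vBlock α β i k) =
        (k.factorial : ℂ) • ((F i).comp (Φ.alphaBlock α i k) +
          (F i).comp (Φ.betaBlock β i k)) := by
      intro i hi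
      have hi' : i ≤ k := Nat.lt_succ_iff.1 (Finset.mem_range.1 hi)
      have hne : (i.factorial : ℂ) ≠ 0 := by exact_mod_cast i.factorial_ne_zero
      rw [vBlock, if_pos hi', ContinuousLinearMap.comp_smul, smul_smul, mul_left_comm,
        mul_inv_cancel₀ hne, mul_one, ContinuousLinearMap.comp_add]
    rw [Finset.sum_congr rfl h1, ← Finset.smul_sum, Finset.sum_add_distrib, dualL_apply,
      series_add_apply]
    congr 2
    · refine Φ.op_ext fun ξ ω => ?_
      rw [mulS, Finset.Nat.sum_antidiagonal_eq_sum_range_succ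
        (fun a b => (Φ.odot k (F a) (α b) : Φ.Op k 0)), _root_.sum_apply, _root_.sum_apply, map_sum,
        map_sum]
      refine Finset.sum_congr rfl fun i hi => ?_
      have hk : k = i + (k - i) := by have := Finset.mem_range.1 hi; omega
      rw [ContinuousLinearMap.comp_apply, alphaBlock, Φ.odot_id_scalar hk, map_smul, map_smul]
      refine Eq.trans ?_ (Φ.ev_odot hk (F i) (α (k - i)) ξ ω).symm
      rw [ev_zero, ev_zero, smul_eq_mul, mul_comm]
    · rw [Finset.sum_range_succ', derivS]
      rw [betaBlock, ContinuousLinearMap.comp_zero, add_zero]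
      refine Finset.sum_congr rfl fun m _ => ?_
      rw [betaBlock, ContinuousLinearMap.comp_smul]
  have : Φ.pairing F ∘ₗ Φ.vOp α β = Φ.pairing (Φ.dualL α β F) := by
    refine Φ.polyHom_ext fun k f => ?_
    have hf := congrArg (fun C : Φ.Op k 0 => Φ.scalarL (C f)) (hop k)
    simp only [_root_.sum_apply, _root_.smul_apply, map_sum, map_smul, smul_eq_mul,
      scalarL_apply, ContinuousLinearMap.comp_apply] at hf
    rw [LinearMap.comp_apply, vOp_monomial, map_sum, pairing_monomial, ← hf]
    exact Finset.sum_congr rfl fun i _ => Φ.pairing_monomial F i _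
  exact DFunLike.congr_fun this p

lemma polyOp_ext {V W : Φ.PolyOp} (h : ∀ F p, Φ.pairing F (V p) = Φ.pairing F (W p)) : V = W :=
  LinearMap.ext fun p => Φ.poly_ext fun F => h F p

lemma pairing_add (F G : Φ.Series 0) (p : Φ.Poly) :
    Φ.pairing (F + G) p = Φ.pairing F p + Φ.pairing G p := by
  have : Φ.pairing (F + G) = Φ.pairing F + Φ.pairing G := Φ.polyHom_ext fun k f => by
    rw [LinearMap.add_apply, pairing_monomial, pairing_monomial, pairing_monomial,
      series_add_apply, _root_.add_apply, scalar_add, mul_add]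
  rw [this, LinearMap.add_apply]

lemma pairing_smul (c : ℂ) (F : Φ.Series 0) (p : Φ.Poly) :
    Φ.pairing (c • F) p = c * Φ.pairing F p := by
  have : Φ.pairing (c • F) = c • Φ.pairing F := Φ.polyHom_ext fun k f => by
    rw [LinearMap.smul_apply, pairing_monomial, pairing_monomial,
      series_smul_apply, _root_.smul_apply, scalar_smul, smul_eq_mul, mul_left_comm]
  rw [this, LinearMap.smul_apply, smul_eq_mul]

/-- The pairing as a bilinear map. -/
def pairingL : Φ.Series 0 →ₗ[ℂ] Φ.Poly →ₗ[ℂ] ℂ where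
  toFun := Φ.pairing
  map_add' F G := LinearMap.ext fun p => Φ.pairing_add F G p
  map_smul' c F := LinearMap.ext fun p => Φ.pairing_smul c F p

lemma pairingL_apply (F : Φ.Series 0) (p : Φ.Poly) : Φ.pairingL F p = Φ.pairing F p := rfl

/-- Transposition reverses products, which is why the commutator of the `dualL` appears in the
opposite order. -/
lemma vOp_commutator {α₁ α₂ : Φ.Series 0} {β₁ β₂ : Φ.Series 1} (h₁ : β₁ ∈ Φ.W1)
    (h₂ : β₂ ∈ Φ.W1) : Φ.vOp α₁ β₁ * Φ.vOp α₂ β₂ - Φ.vOp α₂ β₂ * Φ.vOp α₁ β₁ =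
      Φ.vOp (Φ.derivS β₂ α₁ - Φ.derivS β₁ α₂) (Φ.derivS β₂ β₁ - Φ.derivS β₁ β₂) := by
  refine Φ.polyOp_ext fun F p => ?_
  rw [LinearMap.sub_apply, Module.End.mul_apply, Module.End.mul_apply, map_sub, pairing_vOp,
    pairing_vOp, pairing_vOp, pairing_vOp, pairing_vOp, ← Φ.dualL_commutator h₁ h₂,
    ← pairingL_apply (F := _ - _), map_sub, LinearMap.sub_apply]
  rfl

lemma dualL_add (α α' : Φ.Series 0) (β β' : Φ.Series 1)
    (F : Φ.Series 0) : Φ.dualL (α + α') (β + β') F = Φ.dualL α β F + Φ.dualL α' β' F := by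
  have : Φ.derivS (β + β') F = Φ.derivS β F + Φ.derivS β' F := by
    funext k
    rw [series_add_apply, derivS, derivS, derivS, ← Finset.sum_add_distrib]
    refine Finset.sum_congr rfl fun m hm => ?_
    have := Finset.mem_range.1 hm
    rw [series_add_apply, Φ.odot_add_right (by omega), ContinuousLinearMap.comp_add, smul_add]
  rw [dualL_apply, dualL_apply, dualL_apply, this, mulS_add_right]
  exact add_add_add_comm _ _ _ _

lemma dualL_smul (c : ℂ) (α : Φ.Series 0) (β : Φ.Series 1)
    (F : Φ.Series 0) : Φ.dualL (c • α) (c • β) F = c • Φ.dualL α β F := by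
  have : Φ.derivS (c • β) F = c • Φ.derivS β F := by
    funext k
    rw [series_smul_apply, derivS, derivS, Finset.smul_sum]
    refine Finset.sum_congr rfl fun m hm => ?_
    have := Finset.mem_range.1 hm
    rw [series_smul_apply, Φ.odot_smul_right (by omega), ContinuousLinearMap.comp_smul, smul_comm]
  rw [dualL_apply, dualL_apply, this, mulS_smul_right, smul_add]

lemma vOp_add (α α' : Φ.Series 0) (β β' : Φ.Series 1) :
    Φ.vOp (α + α') (β + β') = Φ.vOp α β + Φ.vOp α' β' := by
  refine Φ.polyOp_ext fun F p => ?_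
  rw [LinearMap.add_apply, map_add, pairing_vOp, pairing_vOp, pairing_vOp,
    Φ.dualL_add α α' β β', pairing_add]

lemma vOp_smul (c : ℂ) (α : Φ.Series 0) (β : Φ.Series 1) :
    Φ.vOp (c • α) (c • β) = c • Φ.vOp α β := by
  refine Φ.polyOp_ext fun F p => ?_
  rw [LinearMap.smul_apply, map_smul, pairing_vOp, pairing_vOp, dualL_smul, pairing_smul,
    smul_eq_mul]

end LBSpace
end

/-! ### The exponential parametrization of the Sheffer group -/

noncomputable section

namespace LBSpace

variable (Φ : LBSpace.{u})

/-! ### Exponential and logarithm of operators that lower the degree -/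

instance : IsTopologicalAddGroup Φ.Poly := isTopologicalAddGroup_finestLC _ _

instance : ContinuousSMul ℂ Φ.Poly :=
  continuousSMul_finestLC (fun k => (Φ.symPow k).Sp) Φ.monomial

instance : LocallyConvexSpace ℝ Φ.Poly := locallyConvexSpace_finestLC _ _

lemma continuous_monomial (k : ℕ) : Continuous (Φ.monomial k) :=
  continuous_finestLC_incl (fun k => (Φ.symPow k).Sp) Φ.monomial k

lemma continuous_polyHom {T : Φ.PolyOp} (h : ∀ k, Continuous fun f => T (Φ.monomial k f)) :
    Continuous T :=
  continuous_of_finestLC (fun k => (Φ.symPow k).Sp) Φ.monomial T h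

/-- The polynomials of degree less than `n`. -/
def polyLT : ℕ → Submodule ℂ Φ.Poly
  | 0 => ⊥
  | n + 1 => (Φ.polyLE n).comap Φ.Poly.subtype

lemma polyLT_mono : Monotone Φ.polyLT := monotone_nat_of_le_succ fun n => by
  cases n with
  | zero => exact bot_le
  | succ n => exact fun p hp => Φ.polyLE_mono (Nat.le_succ n) hp

lemma monomial_mem_polyLT {k n : ℕ} (h : k < n) (f : (Φ.symPow k).Sp) :
    Φ.monomial k f ∈ Φ.polyLT n := by
  cases n with
  | zero => exact absurd h (Nat.not_lt_zero k)
  | succ n => exact Φ.monomial_mem_polyLE (Nat.lt_succ_iff.1 h) f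

lemma polyLT_le {n : ℕ} {S : Submodule ℂ Φ.Poly} (h : ∀ k < n, ∀ f, Φ.monomial k f ∈ S) :
    Φ.polyLT n ≤ S := by
  cases n with
  | zero => exact bot_le
  | succ n => exact fun p hp => Φ.mem_of_mem_polyLE (fun k hk => h k (Nat.lt_succ_of_le hk)) hp

lemma exists_mem_polyLT (p : Φ.Poly) : ∃ n, p ∈ Φ.polyLT n :=
  let ⟨n, hn⟩ := Φ.exists_mem_polyLE p
  ⟨n + 1, hn⟩

/-- The operators that lower the degree. -/
def lowering : Submodule ℂ Φ.PolyOp where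
  carrier := {V | ∀ n, ∀ p ∈ Φ.polyLT (n + 1), V p ∈ Φ.polyLT n}
  zero_mem' := fun _ _ _ => Submodule.zero_mem _
  add_mem' := fun hV hW n p hp => Submodule.add_mem _ (hV n p hp) (hW n p hp)
  smul_mem' := fun c _ hV n p hp => Submodule.smul_mem _ c (hV n p hp)

variable {Φ}

lemma mem_VV_iff {V : Φ.PolyOp} : V ∈ Φ.VV ↔ Continuous V ∧ V ∈ Φ.lowering := by
  refine and_congr_right fun _ => ⟨fun h n p hp => ?_, fun h => ⟨fun p hp => ?_, fun n p hp => ?_⟩⟩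
  · cases n with
    | zero => exact h.1 p hp
    | succ n => exact h.2 n p hp
  · exact h 0 p hp
  · exact h (n + 1) p hp

lemma lowering_apply_mem {V : Φ.PolyOp} (hV : V ∈ Φ.lowering) {n : ℕ} {p : Φ.Poly}
    (hp : p ∈ Φ.polyLT n) : V p ∈ Φ.polyLT (n - 1) := by
  cases n with
  | zero =>
    rw [(Submodule.mem_bot ℂ).1 hp, map_zero]
    exact Submodule.zero_mem _
  | succ n => exact hV n p hp

lemma lowering_mul {V W : Φ.PolyOp} (hV : V ∈ Φ.lowering) (hW : W ∈ Φ.lowering) :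
    V * W ∈ Φ.lowering := fun n p hp =>
  Φ.polyLT_mono (Nat.sub_le n 1) (lowering_apply_mem hV (hW n p hp))

lemma lowering_pow_apply_mem {V : Φ.PolyOp} (hV : V ∈ Φ.lowering) {n : ℕ} {p : Φ.Poly}
    (hp : p ∈ Φ.polyLT n) (m : ℕ) : (V ^ m) p ∈ Φ.polyLT (n - m) := by
  induction m with
  | zero => exact hp
  | succ m ih =>
    rw [pow_succ', Module.End.mul_apply, ← Nat.sub_sub]
    exact lowering_apply_mem hV ih

lemma lowering_pow_apply {V : Φ.PolyOp} (hV : V ∈ Φ.lowering) {n m : ℕ} (h : n ≤ m) {p : Φ.Poly}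
    (hp : p ∈ Φ.polyLT n) : (V ^ m) p = 0 := by
  have := lowering_pow_apply_mem hV hp m
  rw [Nat.sub_eq_zero_of_le h] at this
  exact this

/-- The terms from the N-th on kill polynomials of degree below N, so one truncation serves all of
these polynomials. -/
lemma opSum_apply {T : ℕ → Φ.PolyOp} (hT : ∀ N, ∀ p ∈ Φ.polyLT N, ∀ n ≥ N, T n p = 0) {N : ℕ}
    {p : Φ.Poly} (hp : p ∈ Φ.polyLT N) : Φ.opSum T p = ∑ n ∈ Finset.range N, T n p := by
  have hs : ∀ N, ∀ p ∈ Φ.polyLT N, (Function.support fun n => T n p) ⊆ Finset.range N := by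
    intro N p hp n hn
    by_contra h
    exact hn (hT N p hp n (by simpa using h))
  have h : ∀ p, (Function.support fun n => T n p).Finite := fun p => by
    obtain ⟨N, hN⟩ := Φ.exists_mem_polyLT p
    exact (Finset.finite_toSet _).subset (hs N p hN)
  rw [opSum, dif_pos h]
  exact finsum_eq_sum_of_support_subset _ (hs N p hp)

lemma expOp_apply {V : Φ.PolyOp} (hV : V ∈ Φ.lowering) {N : ℕ} {p : Φ.Poly}
    (hp : p ∈ Φ.polyLT N) :
    Φ.expOp V p = ∑ n ∈ Finset.range N, (n.factorial : ℂ)⁻¹ • (V ^ n) p :=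
  opSum_apply (fun N p hp n hn => by
    rw [LinearMap.smul_apply, lowering_pow_apply hV hn hp, smul_zero]) hp

lemma logOp_apply {P : Φ.PolyOp} (hP : P - 1 ∈ Φ.lowering) {N : ℕ} {p : Φ.Poly}
    (hp : p ∈ Φ.polyLT N) : Φ.logOp P p =
      ∑ n ∈ Finset.range N, ((-1) ^ n / (n + 1 : ℂ)) • ((P - 1) ^ (n + 1)) p :=
  opSum_apply (fun N p hp n hn => by
    rw [LinearMap.smul_apply, lowering_pow_apply hP (by omega) hp, smul_zero]) hp

lemma expOp_sub_one_mem_lowering {V : Φ.PolyOp} (hV : V ∈ Φ.lowering) :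
    Φ.expOp V - 1 ∈ Φ.lowering := by
  intro n p hp
  rw [LinearMap.sub_apply, expOp_apply hV hp, Finset.sum_range_succ']
  simp only [Nat.factorial_zero, Nat.cast_one, inv_one, pow_zero, one_smul, add_sub_cancel_right]
  refine Submodule.sum_mem _ fun m _ => Submodule.smul_mem _ _ ?_
  exact Φ.polyLT_mono (by omega) (lowering_pow_apply_mem hV hp (m + 1))

/-- The difference of the polynomials is divisible by X^N, and V^N kills p. Formal identities modulo
X^N can thus be used for operators. -/
lemma aeval_apply_congr {M : Type*} [AddCommGroup M] [Module ℂ M] {V : Module.End ℂ M} {N : ℕ}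
    {p : M} (hp : (V ^ N) p = 0) {P Q : Polynomial ℂ} (h : ∀ j < N, P.coeff j = Q.coeff j) :
    Polynomial.aeval V P p = Polynomial.aeval V Q p := by
  obtain ⟨R, hR⟩ : Polynomial.X ^ N ∣ P - Q :=
    Polynomial.X_pow_dvd_iff.2 fun j hj => by rw [Polynomial.coeff_sub, h j hj, sub_self]
  rw [← sub_eq_zero, ← LinearMap.sub_apply, ← map_sub, hR, mul_comm, map_mul, map_pow,
    Polynomial.aeval_X, Module.End.mul_apply, hp, map_zero]

/-- The partial sums of the series `log(1 + (exp z - 1))` agree with `z` up to higher order. -/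
lemma coeff_log_exp (N j : ℕ) (hj : j < N) : PowerSeries.coeff j
    (∑ n ∈ Finset.range N, ((-1 : ℂ) ^ n / (n + 1 : ℂ)) • (PowerSeries.exp ℂ - 1) ^ (n + 1)) =
      if j = 1 then 1 else 0 := by
  set u := PowerSeries.exp ℂ - 1 with hu
  have hu0 : PowerSeries.constantCoeff u = 0 := by simp [hu]
  have hdvd : PowerSeries.X ∣ u := PowerSeries.X_dvd_iff.2 hu0
  set S := ∑ n ∈ Finset.range N, ((-1 : ℂ) ^ n / (n + 1 : ℂ)) • u ^ (n + 1) with hS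
  -- As u' = 1 + u, the derivative of the truncated logarithm is a geometric sum. Its defect (-u)^N
  -- has order at least N, so S' agrees with 1 below order N.
  have hd : PowerSeries.derivative ℂ S = 1 - (-u) ^ N := by
    have h1 : PowerSeries.derivative ℂ u = 1 + u := by
      rw [hu, map_sub, PowerSeries.derivative_exp]
      simp
    have h2 : PowerSeries.derivative ℂ S = (1 + u) * ∑ n ∈ Finset.range N, (-u) ^ n := by
      rw [hS, map_sum, Finset.mul_sum]
      refine Finset.sum_congr rfl fun n _ => ?_
      rw [Derivation.map_smul, Derivation.leibniz_pow, h1, Nat.add_sub_cancel, ← Nat.cast_smul_eq_nsmul ℂ,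
        smul_smul, neg_pow u n, smul_eq_mul]
      have : (-1 : ℂ) ^ n / (n + 1 : ℂ) * ((n + 1 : ℕ) : ℂ) = (-1) ^ n := by
        have : (n + 1 : ℂ) ≠ 0 := by exact_mod_cast n.succ_ne_zero
        push_cast
        field_simp
      rw [this, PowerSeries.smul_eq_C_mul, map_pow, map_neg, map_one]
      ring
    rw [h2]
    have := mul_neg_geom_sum (-u) N
    rwa [sub_neg_eq_add] at this
  cases j with
  | zero =>
    rw [hS, map_sum]
    refine Finset.sum_eq_zero fun n _ => ?_
    rw [map_smul, PowerSeries.coeff_zero_eq_constantCoeff_apply, map_pow, hu0, zero_pow n.succ_ne_zero,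
      smul_zero]
  | succ j =>
    have h1 : PowerSeries.coeff j (PowerSeries.derivative ℂ S) = if j = 0 then 1 else 0 := by
      have : PowerSeries.coeff j ((-u) ^ N) = 0 :=
        PowerSeries.X_pow_dvd_iff.1 (pow_dvd_pow_of_dvd (hdvd.neg_right) N) j (by omega)
      rw [hd, map_sub, this, sub_zero, PowerSeries.coeff_one]
    rw [PowerSeries.coeff_derivative] at h1
    have hne : (j + 1 : ℂ) ≠ 0 := by exact_mod_cast j.succ_ne_zero
    by_cases h0 : j = 0
    · subst h0
      simpa using h1
    · rw [if_neg h0] at h1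
      rw [if_neg (by omega)]
      exact (mul_eq_zero.1 h1).resolve_right hne

/-- On polynomials of degree less than M the operator exp V − 1 is a polynomial in V, and V^M
vanishes there. The claim is then the scalar identity `coeff_log_exp` modulo X^M. -/
lemma logOp_expOp {V : Φ.PolyOp} (hV : V ∈ Φ.lowering) : Φ.logOp (Φ.expOp V) = V := by
  refine LinearMap.ext fun p => ?_
  obtain ⟨N, hp⟩ := Φ.exists_mem_polyLT p
  replace hp := Φ.polyLT_mono (Nat.le_add_right N 2) hp
  generalize hM : N + 2 = M at hp
  rw [logOp_apply (expOp_sub_one_mem_lowering hV) hp]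
  set E := PowerSeries.trunc M (PowerSeries.exp ℂ) with hE
  have hE' : E = ∑ n ∈ Finset.range M,
      Polynomial.monomial n (PowerSeries.coeff n (PowerSeries.exp ℂ)) := by
    ext j
    simp [hE, PowerSeries.coeff_trunc, Polynomial.finsetSum_coeff, Polynomial.coeff_monomial]
  have hE1 : ∀ q ∈ Φ.polyLT M, (Φ.expOp V - 1) q = Polynomial.aeval V (E - 1) q := by
    intro q hq
    rw [LinearMap.sub_apply, expOp_apply hV hq, map_sub, map_one, LinearMap.sub_apply, hE',
      map_sum, LinearMap.sum_apply]
    congr 1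
    refine Finset.sum_congr rfl fun n _ => ?_
    rw [Polynomial.aeval_monomial, PowerSeries.coeff_exp, Module.End.mul_apply,
      Module.algebraMap_end_apply]
    simp
  have hpow : ∀ n, ((Φ.expOp V - 1) ^ n) p = Polynomial.aeval V ((E - 1) ^ n) p := by
    intro n
    induction n with
    | zero => simp
    | succ n ih =>
      have := Φ.polyLT_mono (Nat.sub_le M n)
        (lowering_pow_apply_mem (expOp_sub_one_mem_lowering hV) hp n)
      rw [pow_succ', Module.End.mul_apply, hE1 _ this, ih, pow_succ', map_mul,
        Module.End.mul_apply]
  have hsum : ∑ n ∈ Finset.range M, ((-1) ^ n / (n + 1 : ℂ)) • ((Φ.expOp V - 1) ^ (n + 1)) p =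
      Polynomial.aeval V (∑ n ∈ Finset.range M, ((-1 : ℂ) ^ n / (n + 1 : ℂ)) • (E - 1) ^ (n + 1))
        p := by
    rw [map_sum, LinearMap.sum_apply]
    refine Finset.sum_congr rfl fun n _ => ?_
    rw [map_smul, LinearMap.smul_apply, hpow]
  rw [hsum, aeval_apply_congr (Q := Polynomial.X) (N := M) (lowering_pow_apply hV le_rfl hp),
    Polynomial.aeval_X]
  intro j hj
  -- E is the exponential truncated at order M, so all powers of E − 1 and of exp − 1 agree modulo
  -- X^M.
  have hcoe : ∀ n, PowerSeries.coeff j (((E - 1) ^ n : Polynomial ℂ) : PowerSeries ℂ) =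
      PowerSeries.coeff j ((PowerSeries.exp ℂ - 1) ^ n) := by
    intro n
    rw [← sub_eq_zero, ← map_sub]
    suffices h : PowerSeries.X ^ M ∣ (((E - 1) ^ n : Polynomial ℂ) : PowerSeries ℂ) -
        (PowerSeries.exp ℂ - 1) ^ n from PowerSeries.X_pow_dvd_iff.1 h j hj
    rw [Polynomial.coe_pow]
    refine dvd_trans ?_ (sub_dvd_pow_sub_pow _ _ n)
    rw [PowerSeries.X_pow_dvd_iff]
    intro m hm
    have h1 : ((E - 1 : Polynomial ℂ) : PowerSeries ℂ) = (E : PowerSeries ℂ) - 1 := by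
      rw [Polynomial.coe_sub, Polynomial.coe_one]
    rw [h1, sub_sub_sub_cancel_right, map_sub, Polynomial.coeff_coe, hE, PowerSeries.coeff_trunc,
      if_pos hm, sub_self]
  rw [Polynomial.finsetSum_coeff, Polynomial.coeff_X, if_congr eq_comm rfl rfl,
    ← coeff_log_exp M j hj, map_sum]
  refine Finset.sum_congr rfl fun n _ => ?_
  rw [Polynomial.coeff_smul, map_smul, ← hcoe, Polynomial.coeff_coe]

/-! ### The exponential of the operators of first order -/

variable (Φ)

/-- The diagonal block involves only α_0 and β_1. Their vanishing is what makes the operator lower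
the degree. -/
lemma vBlock_self {α : Φ.Series 0} (hα : α ∈ Φ.W0) {β : Φ.Series 1} (hβ : β ∈ Φ.W1) (k : ℕ) :
    Φ.vBlock α β k k = 0 := by
  have h0 : α 0 = 0 := hα
  rw [vBlock, if_pos le_rfl, alphaBlock, Nat.sub_self, h0, Φ.odot_zero_right (by omega)]
  cases k with
  | zero => simp [betaBlock]
  | succ k =>
    rw [betaBlock, Nat.add_sub_cancel_left, hβ.2, Φ.odot_zero_right (by omega)]
    simp

lemma vOp_mem_lowering {α : Φ.Series 0} (hα : α ∈ Φ.W0) {β : Φ.Series 1} (hβ : β ∈ Φ.W1) :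
    Φ.vOp α β ∈ Φ.lowering := by
  intro n
  refine Φ.polyLT_le (S := (Φ.polyLT n).comap (Φ.vOp α β)) fun k hk f => ?_
  rw [Submodule.mem_comap, vOp_monomial]
  refine Submodule.sum_mem _ fun i hi => ?_
  have hi' := Finset.mem_range.1 hi
  by_cases h : i = k
  · rw [h, vBlock_self Φ hα hβ, _root_.zero_apply, map_zero]
    exact Submodule.zero_mem _
  · exact Φ.monomial_mem_polyLT (by omega) _

lemma continuous_vOp (α : Φ.Series 0) (β : Φ.Series 1) : Continuous (Φ.vOp α β) := by
  refine Φ.continuous_polyHom fun k => ?_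
  simp only [vOp_monomial]
  exact continuous_finsetSum _ fun i _ =>
    (Φ.continuous_monomial i).comp (Φ.vBlock α β i k).continuous

variable {Φ}

lemma continuous_pow_polyOp {V : Φ.PolyOp} (hV : Continuous V) (n : ℕ) : Continuous (V ^ n) := by
  induction n with
  | zero => exact continuous_id
  | succ n ih => rw [pow_succ']; exact hV.comp ih

lemma expOp_mem_MM {V : Φ.PolyOp} (hV : V ∈ Φ.VV) : Φ.expOp V ∈ Φ.MM := by
  rw [mem_VV_iff] at hV
  refine mem_VV_iff.2 ⟨?_, expOp_sub_one_mem_lowering hV.2⟩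
  refine Φ.continuous_polyHom fun k => ?_
  simp only [LinearMap.sub_apply, expOp_apply hV.2 (Φ.monomial_mem_polyLT (Nat.lt_succ_self k) _)]
  refine Continuous.sub (continuous_finsetSum _ fun n _ => (continuous_const_smul _).comp ?_)
    (Φ.continuous_monomial k)
  exact (continuous_pow_polyOp hV.1 n).comp (Φ.continuous_monomial k)

lemma mul_sub_one_eq (P Q : Φ.PolyOp) : P * Q - 1 = (P - 1) * (Q - 1) + (P - 1) + (Q - 1) :=
  LinearMap.ext fun p => by
    simp only [LinearMap.sub_apply, LinearMap.add_apply, Module.End.mul_apply, map_sub,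
      Module.End.one_apply]
    abel

lemma mul_sub_one_mem_lowering {P Q : Φ.PolyOp} (hP : P - 1 ∈ Φ.lowering)
    (hQ : Q - 1 ∈ Φ.lowering) : P * Q - 1 ∈ Φ.lowering := by
  rw [mul_sub_one_eq]
  exact Submodule.add_mem _ (Submodule.add_mem _ (lowering_mul hP hQ) hP) hQ

lemma MM_mul_mem {P Q : Φ.PolyOp} (hP : P ∈ Φ.MM) (hQ : Q ∈ Φ.MM) : P * Q ∈ Φ.MM := by
  have hP' := mem_VV_iff.1 hP
  have hQ' := mem_VV_iff.1 hQ
  refine mem_VV_iff.2 ⟨?_, mul_sub_one_mem_lowering hP'.2 hQ'.2⟩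
  rw [mul_sub_one_eq]
  exact ((hP'.1.comp hQ'.1).add hP'.1).add hQ'.1

lemma pairing_congr {F G : Φ.Series 0} {N : ℕ} (h : ∀ k < N, F k = G k) {p : Φ.Poly}
    (hp : p ∈ Φ.polyLT N) : Φ.pairing F p = Φ.pairing G p :=
  Φ.polyLT_le (S := LinearMap.eqLocus (Φ.pairing F) (Φ.pairing G))
    (fun k hk f => by
      change Φ.pairing F _ = Φ.pairing G _
      rw [pairing_monomial, pairing_monomial, h k hk]) hp

variable (Φ)

/-- Transposing power by power: below any degree both exponentials are finite sums with the same
coefficients. -/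
lemma pairing_expOp_vOp {α : Φ.Series 0} (hα : α ∈ Φ.W0) {β : Φ.Series 1} (hβ : β ∈ Φ.W1)
    (F : Φ.Series 0) (p : Φ.Poly) :
    Φ.pairing F (Φ.expOp (Φ.vOp α β) p) = Φ.pairing (expSer (Φ.dualL α β) F) p := by
  obtain ⟨N, hp⟩ := Φ.exists_mem_polyLT p
  have hpow : ∀ (n : ℕ) F p, Φ.pairing F ((Φ.vOp α β ^ n) p) =
      Φ.pairing ((Φ.dualL α β ^ n) F) p := by
    intro n
    induction n with
    | zero => exact fun _ _ => rfl
    | succ n ih =>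
      intro F p
      rw [pow_succ, Module.End.mul_apply, ih, pairing_vOp, pow_succ', Module.End.mul_apply]
  rw [expOp_apply (Φ.vOp_mem_lowering hα hβ) hp, map_sum,
    pairing_congr (G := ∑ n ∈ Finset.range N, (n.factorial : ℂ)⁻¹ • (Φ.dualL α β ^ n) F)
      (fun k hk => (Φ.isRaising_dualL hα hβ).expSer_eq F hk) hp, ← pairingL_apply,
    map_sum, LinearMap.sum_apply]
  refine Finset.sum_congr rfl fun n _ => ?_
  rw [map_smul, hpow, map_smul, LinearMap.smul_apply, pairingL_apply]

variable {Φ}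

/-- Composing with exp(V) on the right applies exp(`dualL`) to the generating function, which is
right multiplication by (A_1, B_1) in 𝓢(Φ). With P = 1 this yields the generating function of
exp(V); in general it yields closure of 𝕊(Φ) under products. -/
lemma HasGenFun.mul_expOp {P : Φ.PolyOp} {A : Φ.Series 0} {B : Φ.Series 1} (hP : Φ.HasGenFun P A B)
    (hB : B 0 = 0) {α : Φ.Series 0} (hα : α ∈ Φ.W0) {β : Φ.Series 1} (hβ : β ∈ Φ.W1) :
    Φ.HasGenFun (P * Φ.expOp (Φ.vOp α β))
      (Φ.mulS (Φ.compS A (Φ.flowB β 1)) (Φ.flowA α β 1) : Φ.Series 0)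
      (Φ.compS B (Φ.flowB β 1)) := by
  rw [hasGenFun_iff] at hP ⊢
  intro ω p
  have := Φ.expSer_dualL_genFun hα hβ 1 ω A hB
  rw [one_smul] at this
  rw [Module.End.mul_apply, hP, pairing_expOp_vOp Φ hα hβ, this]

variable (Φ)

lemma hasGenFun_one : Φ.HasGenFun 1 Φ.oneS Φ.idS := by
  rw [hasGenFun_iff]
  intro ω p
  rw [mulS_oneS, Module.End.one_apply, coe_apply_eq_pairing]

lemma compS_idS_flowB {β : Φ.Series 1} (hβ : β ∈ Φ.W1) (t : ℂ) :
    Φ.compS Φ.idS (Φ.flowB β t) = Φ.flowB β t := Φ.compS_flowB hβ t _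

lemma compS_oneS_flowB {β : Φ.Series 1} (hβ : β ∈ Φ.W1) (t : ℂ) :
    Φ.compS Φ.oneS (Φ.flowB β t) = Φ.oneS := by
  rw [Φ.compS_flowB hβ, expSer_derivL_oneS]

lemma oneS_mulS (X : Φ.Series 0) : (Φ.mulS Φ.oneS X : Φ.Series 0) = X := by
  refine Φ.gen_ext fun ξ ω => ?_
  rw [gen_mulS_zero, gen_oneS, one_mul]

lemma hasGenFun_expOp_vOp {α : Φ.Series 0} (hα : α ∈ Φ.W0) {β : Φ.Series 1} (hβ : β ∈ Φ.W1) :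
    Φ.HasGenFun (Φ.expOp (Φ.vOp α β)) (Φ.flowA α β 1) (Φ.flowB β 1) := by
  have := Φ.hasGenFun_one.mul_expOp rfl hα hβ
  rwa [one_mul, Φ.compS_idS_flowB hβ, Φ.compS_oneS_flowB hβ, oneS_mulS] at this

variable {Φ}

lemma IsRaising.expSer_apply_of_vanish {i : ℕ} {T : Module.End ℂ (Φ.Series i)}
    (hT : Φ.IsRaising T) {X : Φ.Series i} {n : ℕ} (hX : ∀ j < n, X j = 0) :
    expSer T X n = X n := by
  rw [expSer_apply, Finset.sum_eq_single 0]
  · simp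
  · intro m _ hm
    rw [hT.pow hX m n (by omega), smul_zero]
  · simp

variable (Φ)

lemma expSer_derivL_mem_F1 {β : Φ.Series 1} (hβ : β ∈ Φ.W1) (t : ℂ) {B : Φ.Series 1}
    (hB : B ∈ Φ.F1) : expSer (t • Φ.derivL β 1) B ∈ Φ.F1 := by
  refine ⟨by rw [expSer_apply_zero, hB.1], ?_⟩
  rw [((Φ.isRaising_derivL hβ 1).smul t).expSer_apply_of_vanish (n := 1), hB.2]
  intro j hj
  rw [Nat.lt_one_iff.1 hj, hB.1]

lemma expSer_mem_F0 (T : Module.End ℂ (Φ.Series 0)) {A : Φ.Series 0} (hA : A ∈ Φ.F0) :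
    expSer T A ∈ Φ.F0 := (expSer_apply_zero Φ T A).trans hA

lemma flowB_mem_F1 {β : Φ.Series 1} (hβ : β ∈ Φ.W1) (t : ℂ) : Φ.flowB β t ∈ Φ.F1 :=
  Φ.expSer_derivL_mem_F1 hβ t ⟨rfl, rfl⟩

lemma flowA_mem_F0 (α : Φ.Series 0) (β : Φ.Series 1) (t : ℂ) : Φ.flowA α β t ∈ Φ.F0 :=
  Φ.expSer_mem_F0 _ rfl

/-- Right multiplication by the flow is a pair of linear exponentials, so the group law of the flow
reduces to `IsRaising.expSer_add`. -/
lemma mulPair_flow {α : Φ.Series 0} (hα : α ∈ Φ.W0) {β : Φ.Series 1} (hβ : β ∈ Φ.W1) (t : ℂ)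
    (A : Φ.Series 0) (B : Φ.Series 1) : Φ.mulPair (A, B) (Φ.flowA α β t, Φ.flowB β t) =
      (expSer (t • Φ.dualL α β) A, expSer (t • Φ.derivL β 1) B) := by
  rw [mulPair, Φ.expSer_dualL hα hβ, Φ.compS_flowB hβ, Φ.compS_flowB hβ]

lemma vOp_mem_VV {α : Φ.Series 0} (hα : α ∈ Φ.W0) {β : Φ.Series 1} (hβ : β ∈ Φ.W1) :
    Φ.vOp α β ∈ Φ.VV :=
  mem_VV_iff.2 ⟨Φ.continuous_vOp α β, Φ.vOp_mem_lowering hα hβ⟩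

lemma expOp_vOp_mem_SS {α : Φ.Series 0} (hα : α ∈ Φ.W0) {β : Φ.Series 1} (hβ : β ∈ Φ.W1) :
    Φ.expOp (Φ.vOp α β) ∈ Φ.SS :=
  ⟨expOp_mem_MM (Φ.vOp_mem_VV hα hβ), _, Φ.flowA_mem_F0 α β 1, _, Φ.flowB_mem_F1 hβ 1,
    Φ.hasGenFun_expOp_vOp hα hβ⟩

lemma shefferOp_flow {α : Φ.Series 0} (hα : α ∈ Φ.W0) {β : Φ.Series 1} (hβ : β ∈ Φ.W1) :
    Φ.shefferOp (Φ.flowA α β 1, Φ.flowB β 1) = Φ.expOp (Φ.vOp α β) := by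
  have h := Classical.epsilon_spec (p := fun P : Φ.PolyOp => P ∈ Φ.MM ∧
    Φ.HasGenFun P (Φ.flowA α β 1) (Φ.flowB β 1))
    ⟨_, expOp_mem_MM (Φ.vOp_mem_VV hα hβ), Φ.hasGenFun_expOp_vOp hα hβ⟩
  exact HasGenFun.unique Φ h.2 (Φ.hasGenFun_expOp_vOp hα hβ)

/-! ### Every element of the group is an exponential -/

/-- Under iteration from any starting point the k-th component no longer changes after k + 1 steps,
and the sequence of these stable values is fixed. -/
lemma exists_fixedPoint_of_causal {X : ℕ → Type*} [∀ k, Nonempty (X k)]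
    (F : (∀ k, X k) → ∀ k, X k) (hF : ∀ k x y, (∀ j < k, x j = y j) → F x k = F y k) :
    ∃ x, F x = x := by
  let s : ℕ → ∀ k, X k := fun n => F^[n] fun k => Classical.arbitrary (X k)
  have hs : ∀ n, s (n + 1) = F (s n) := fun n => Function.iterate_succ_apply' F n _
  have h1 : ∀ n, ∀ j < n, s (n + 1) j = s n j := by
    intro n
    induction n with
    | zero => exact fun j hj => absurd hj (Nat.not_lt_zero j)
    | succ n ih =>
      intro j hj
      rw [hs (n + 1)]
      nth_rw 2 [hs n]
      exact hF j _ _ fun l hl => ih l (by omega)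
  have h2 : ∀ n j, j < n → s n j = s (j + 1) j := by
    intro n j hj
    induction n, hj using Nat.le_induction with
    | base => rfl
    | succ n hn ih => rw [h1 n j hn, ih]
  refine ⟨fun k => s (k + 1) k, funext fun k => ?_⟩
  rw [hs k]
  exact hF k _ _ fun j hj => (h2 k j hj).symm

/-- A top coefficient of X is multiplied by β_1 and a top coefficient of β by X_1; both factors
vanish, so only lower coefficients enter. -/
lemma derivS_congr_lt {β β' : Φ.Series 1} (hβ : β ∈ Φ.W1) {i k : ℕ}
    {X X' : Φ.Series i} (h : ∀ j < k, β j = β' j) (hX : X 1 = 0) (hX' : X' 1 = 0)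
    (hXX : ∀ j < k, X j = X' j) : Φ.derivS β X k = Φ.derivS β' X' k := by
  refine Finset.sum_congr rfl fun m hm => ?_
  have hm' := Finset.mem_range.1 hm
  rcases Nat.eq_zero_or_pos m with rfl | hpos
  · change _ • (X 1).comp _ = _ • (X' 1).comp _
    rw [hX, hX', ContinuousLinearMap.zero_comp, ContinuousLinearMap.zero_comp]
  · rw [h (k - m) (by omega)]
    rcases Nat.lt_or_ge (m + 1) k with h1 | h1
    · rw [hXX _ h1]
    · have h2 : k - m = 1 := by omega
      rw [← h (k - m) (by omega), h2, hβ.2, Φ.odot_zero_right (by omega),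
        ContinuousLinearMap.comp_zero, ContinuousLinearMap.comp_zero]

/-- The term n = 0 is common and the term n = 1 is subtracted. The rest of the exponential consists
of powers covered by the hypothesis. -/
lemma expSer_sub_congr {i k : ℕ} (hk : 1 ≤ k) {T T' : Module.End ℂ (Φ.Series i)} {X Y Y' : Φ.Series i}
    (hY : T X = Y) (hY' : T' X = Y') (h : ∀ n, 1 ≤ n → (T ^ n) Y k = (T' ^ n) Y' k) :
    expSer T X k - Y k = expSer T' X k - Y' k := by
  rw [sub_eq_sub_iff_sub_eq_sub, expSer_apply, expSer_apply, ← Finset.sum_sub_distrib,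
    Finset.sum_eq_single 1]
  · simp [hY, hY']
  · intro n _ hn
    rcases n with _ | _ | n
    · simp
    · exact absurd rfl hn
    · rw [pow_succ, pow_succ T', Module.End.mul_apply, Module.End.mul_apply, hY, hY',
        h (n + 1) (by omega), sub_self]
  · intro h
    exact absurd (Finset.mem_range.2 (by omega)) h

lemma derivL_pow_congr {β β' : Φ.Series 1} (hβ : β ∈ Φ.W1) (hβ' : β' ∈ Φ.W1) {k : ℕ}
    (h : ∀ j < k, β j = β' j) (n : ℕ) :
    (Φ.derivL β 1 ^ n) β ∈ Φ.W1 ∧ (Φ.derivL β' 1 ^ n) β' ∈ Φ.W1 ∧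
      (∀ j < k, (Φ.derivL β 1 ^ n) β j = (Φ.derivL β' 1 ^ n) β' j) ∧
      (1 ≤ n → (Φ.derivL β 1 ^ n) β k = (Φ.derivL β' 1 ^ n) β' k) := by
  induction n with
  | zero => exact ⟨hβ, hβ', h, fun h => absurd h (by omega)⟩
  | succ n ih =>
    obtain ⟨h1, h2, h3, -⟩ := ih
    simp only [pow_succ', Module.End.mul_apply, derivL_apply]
    exact ⟨Φ.derivS_mem_W1 hβ h1, Φ.derivS_mem_W1 hβ' h2,
      fun j hj => Φ.derivS_congr_lt hβ (fun l hl => h l (by omega)) h1.2 h2.2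
        (fun l hl => h3 l (by omega)),
      fun _ => Φ.derivS_congr_lt hβ h h1.2 h2.2 h3⟩

/-- Consequently the equation B_1 = B reads β_k = B_k minus an expression in β_j with j < k, which
can be solved recursively. -/
lemma flowB_sub_congr {β β' : Φ.Series 1} (hβ : β ∈ Φ.W1) (hβ' : β' ∈ Φ.W1) {k : ℕ} (hk : 1 ≤ k)
    (h : ∀ j < k, β j = β' j) : Φ.flowB β 1 k - β k = Φ.flowB β' 1 k - β' k := by
  rw [flowB, flowB, one_smul, one_smul]
  exact Φ.expSer_sub_congr hk (Φ.derivS_idS hβ.1) (Φ.derivS_idS hβ'.1)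
    fun n hn => (Φ.derivL_pow_congr hβ hβ' h n).2.2.2 hn

lemma exists_flowB_eq {B : Φ.Series 1} (hB : B ∈ Φ.F1) : ∃ β ∈ Φ.W1, Φ.flowB β 1 = B := by
  -- The fixed point theorem ranges over all sequences, whereas the causality estimate needs
  -- coefficients 0 and 1 to vanish; cutting them enforces membership in 𝓦₁.
  let cut : Φ.Series 1 → Φ.Series 1 := fun β k => if k < 2 then 0 else β k
  have hcut : ∀ β, cut β ∈ Φ.W1 := fun β => ⟨rfl, rfl⟩
  obtain ⟨β, hβ⟩ := exists_fixedPoint_of_causal (X := fun k => Φ.Op k 1)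
    (fun β => cut fun k => B k - (Φ.flowB (cut β) 1 k - cut β k)) (by
      intro k x y hxy
      by_cases hk : k < 2
      · simp only [cut, if_pos hk]
      · have hxy' : ∀ j < k, cut x j = cut y j := fun j hj => by
          simp only [cut, hxy j hj]
        exact congrArg (fun Z => if k < 2 then 0 else B k - Z)
          (Φ.flowB_sub_congr (hcut x) (hcut y) (by omega) hxy'))
  have hβc : cut β = β := by
    rw [← hβ]
    funext k
    by_cases hk : k < 2
    · simp only [cut, if_pos hk]
    · simp only [cut, if_neg hk]
  have hW : β ∈ Φ.W1 := hβc ▸ hcut β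
  refine ⟨β, hW, funext fun k => ?_⟩
  have hF := Φ.flowB_mem_F1 hW 1
  rcases k with _ | _ | k
  · rw [hF.1, hB.1]
  · exact hF.2.trans hB.2.symm
  · have := congrFun hβ (k + 2)
    rw [hβc] at this
    have h2 : B (k + 2) - (Φ.flowB β 1 (k + 2) - β (k + 2)) = β (k + 2) := this
    rw [sub_sub_eq_add_sub, sub_eq_iff_eq_add, add_comm (β _)] at h2
    exact (add_right_cancel h2).symm

lemma mulS_congr_lt {i i' k : ℕ} {X X' : Φ.Series i} {Y Y' : Φ.Series i'} (hX : X 0 = 0)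
    (hX' : X' 0 = 0) (hY : Y 0 = 0) (hY' : Y' 0 = 0) (h : ∀ j < k, X j = X' j)
    (h' : ∀ j < k, Y j = Y' j) : Φ.mulS X Y k = Φ.mulS X' Y' k := by
  refine Finset.sum_congr rfl fun p hp => ?_
  have hp' := Finset.HasAntidiagonal.mem_antidiagonal.1 hp
  rcases Nat.eq_zero_or_pos p.1 with h0 | h0
  · rw [h0, hX, hX', Φ.odot_zero_left (by omega), Φ.odot_zero_left (by omega)]
  rcases Nat.eq_zero_or_pos p.2 with h1 | h1
  · rw [h1, hY, hY', Φ.odot_zero_right (by omega), Φ.odot_zero_right (by omega)]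
  rw [h _ (by omega), h' _ (by omega)]

/-- The same causality for fixed β: in a product of series without constant term, and in D_β, the
top coefficient never enters. -/
lemma dualL_pow_congr {α α' : Φ.Series 0} (hα : α ∈ Φ.W0) (hα' : α' ∈ Φ.W0) {β : Φ.Series 1}
    (hβ : β ∈ Φ.W1) {k : ℕ} (h : ∀ j < k, α j = α' j) (n : ℕ) :
    (Φ.dualL α β ^ n) α ∈ Φ.W0 ∧ (Φ.dualL α' β ^ n) α' ∈ Φ.W0 ∧
      (∀ j < k, (Φ.dualL α β ^ n) α j = (Φ.dualL α' β ^ n) α' j) ∧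
      (1 ≤ n → (Φ.dualL α β ^ n) α k = (Φ.dualL α' β ^ n) α' k) := by
  have hcongr : ∀ {X X' : Φ.Series 0} {k : ℕ}, X 0 = 0 → X' 0 = 0 → (∀ j < k, X j = X' j) →
      (∀ j < k, α j = α' j) → Φ.dualL α β X k = Φ.dualL α' β X' k := by
    intro X X' k hX hX' hXX h
    rw [dualL_apply, dualL_apply, series_add_apply, series_add_apply,
      Φ.mulS_congr_lt hX hX' hα hα' hXX h]
    congr 1
    refine Finset.sum_congr rfl fun m hm => ?_
    have hm' := Finset.mem_range.1 hm
    rcases Nat.lt_or_ge (m + 1) k with h1 | h1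
    · rw [hXX _ h1]
    · have h2 : k - m = 1 := by omega
      rw [h2, hβ.2, Φ.odot_zero_right (by omega), ContinuousLinearMap.comp_zero,
        ContinuousLinearMap.comp_zero]
  induction n with
  | zero => exact ⟨hα, hα', h, fun h => absurd h (by omega)⟩
  | succ n ih =>
    obtain ⟨h1, h2, h3, -⟩ := ih
    have hr : ∀ {α X : Φ.Series 0}, α ∈ Φ.W0 → Φ.dualL α β X ∈ Φ.W0 := fun hα =>
      Φ.isRaising_dualL hα hβ 0 _ (fun j hj => absurd hj (Nat.not_lt_zero j)) 0 Nat.one_pos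
    simp only [pow_succ', Module.End.mul_apply]
    exact ⟨hr hα, hr hα', fun j hj => hcongr h1 h2 (fun l hl => h3 l (by omega))
      (fun l hl => h l (by omega)), fun _ => hcongr h1 h2 h3 h⟩

lemma dualL_oneS (α : Φ.Series 0) (β : Φ.Series 1) : Φ.dualL α β Φ.oneS = α := by
  rw [dualL_apply, oneS_mulS, derivS_oneS, add_zero]

lemma flowA_sub_congr {α α' : Φ.Series 0} (hα : α ∈ Φ.W0) (hα' : α' ∈ Φ.W0) {β : Φ.Series 1}
    (hβ : β ∈ Φ.W1) {k : ℕ} (hk : 1 ≤ k) (h : ∀ j < k, α j = α' j) :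
    Φ.flowA α β 1 k - α k = Φ.flowA α' β 1 k - α' k := by
  rw [flowA, flowA, one_smul, one_smul]
  exact Φ.expSer_sub_congr hk (Φ.dualL_oneS α β) (Φ.dualL_oneS α' β)
    fun n hn => (Φ.dualL_pow_congr hα hα' hβ h n).2.2.2 hn

lemma exists_flowA_eq {A : Φ.Series 0} (hA : A ∈ Φ.F0) {β : Φ.Series 1} (hβ : β ∈ Φ.W1) :
    ∃ α ∈ Φ.W0, Φ.flowA α β 1 = A := by
  let cut : Φ.Series 0 → Φ.Series 0 := fun α k => if k < 1 then 0 else α k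
  have hcut : ∀ α, cut α ∈ Φ.W0 := fun α => rfl
  obtain ⟨α, hα⟩ := exists_fixedPoint_of_causal (X := fun k => Φ.Op k 0)
    (fun α => cut fun k => A k - (Φ.flowA (cut α) β 1 k - cut α k)) (by
      intro k x y hxy
      by_cases hk : k < 1
      · simp only [cut, if_pos hk]
      · have hxy' : ∀ j < k, cut x j = cut y j := fun j hj => by
          simp only [cut, hxy j hj]
        exact congrArg (fun Z => if k < 1 then 0 else A k - Z)
          (Φ.flowA_sub_congr (hcut x) (hcut y) hβ (by omega) hxy'))
  have hαc : cut α = α := by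
    rw [← hα]
    funext k
    by_cases hk : k < 1
    · simp only [cut, if_pos hk]
    · simp only [cut, if_neg hk]
  have hW : α ∈ Φ.W0 := hαc ▸ hcut α
  refine ⟨α, hW, funext fun k => ?_⟩
  rcases k with _ | k
  · exact (Φ.flowA_mem_F0 α β 1).trans hA.symm
  · have := congrFun hα (k + 1)
    rw [hαc] at this
    have h2 : A (k + 1) - (Φ.flowA α β 1 (k + 1) - α (k + 1)) = α (k + 1) := this
    rw [sub_sub_eq_add_sub, sub_eq_iff_eq_add, add_comm (α _)] at h2
    exact (add_right_cancel h2).symm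

/-- The equations for EXP are triangular: β is found from B alone, and afterwards α from A with this
β. The generating function then identifies the operator. -/
lemma mem_SS_iff {P : Φ.PolyOp} :
    P ∈ Φ.SS ↔ ∃ α ∈ Φ.W0, ∃ β ∈ Φ.W1, P = Φ.expOp (Φ.vOp α β) := by
  constructor
  · rintro ⟨-, A, hA, B, hB, h⟩
    obtain ⟨β, hβ, rfl⟩ := Φ.exists_flowB_eq hB
    obtain ⟨α, hα, rfl⟩ := Φ.exists_flowA_eq hA hβ
    exact ⟨α, hα, β, hβ, HasGenFun.unique Φ h (Φ.hasGenFun_expOp_vOp hα hβ)⟩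
  · rintro ⟨α, hα, β, hβ, rfl⟩
    exact Φ.expOp_vOp_mem_SS hα hβ

/-- The Lie algebra consists of the operators `α(∇) + M(β(∇))`. -/
lemma mem_lieS_iff {V : Φ.PolyOp} : V ∈ Φ.lieS ↔ ∃ α ∈ Φ.W0, ∃ β ∈ Φ.W1, V = Φ.vOp α β := by
  constructor
  · rintro ⟨P, hP, rfl⟩
    obtain ⟨α, hα, β, hβ, rfl⟩ := Φ.mem_SS_iff.1 hP
    exact ⟨α, hα, β, hβ, logOp_expOp (Φ.vOp_mem_lowering hα hβ)⟩
  · rintro ⟨α, hα, β, hβ, rfl⟩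
    exact ⟨_, Φ.expOp_vOp_mem_SS hα hβ, logOp_expOp (Φ.vOp_mem_lowering hα hβ)⟩

lemma SS_mul_mem {P Q : Φ.PolyOp} (hP : P ∈ Φ.SS) (hQ : Q ∈ Φ.SS) : P * Q ∈ Φ.SS := by
  obtain ⟨hPM, A, hA, B, hB, hg⟩ := hP
  obtain ⟨α, hα, β, hβ, rfl⟩ := Φ.mem_SS_iff.1 hQ
  refine ⟨MM_mul_mem hPM hQ.1, _, ?_, _, ?_, hg.mul_expOp hB.1 hα hβ⟩
  · rw [Φ.compS_flowB hβ, ← Φ.expSer_dualL hα hβ]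
    exact Φ.expSer_mem_F0 _ hA
  · rw [Φ.compS_flowB hβ]
    exact Φ.expSer_derivL_mem_F1 hβ 1 hB

end LBSpace
end

/-! ### Gradients of polynomials and the operators α(∇), M(β(∇)) -/

noncomputable section

namespace LBSpace

variable (Φ : LBSpace.{u})

/-! ### Derivatives of polynomials -/

/-- The derivative in the direction `σ`, as an operator on polynomials. -/
def dirOp (σ : Φ.Dual) : Φ.PolyOp :=
  Φ.polyLift fun n => (n : ℂ) • (Φ.monomial (n - 1) ∘ₗ
    (Φ.odot n (ContinuousLinearMap.id ℂ (Φ.symPow (n - 1)).Sp) (Φ.dualPow σ 1) :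
      Φ.Op n (n - 1)).toLinearMap)

lemma dirOp_monomial (σ : Φ.Dual) (n : ℕ) (f : (Φ.symPow n).Sp) :
    Φ.dirOp σ (Φ.monomial n f) = (n : ℂ) • Φ.monomial (n - 1)
      ((Φ.odot n (ContinuousLinearMap.id ℂ (Φ.symPow (n - 1)).Sp) (Φ.dualPow σ 1) :
        Φ.Op n (n - 1)) f) := by
  rw [dirOp, polyLift_monomial]
  rfl

lemma scalar_dualPow_tpow (ω : Φ.Dual) (k : ℕ) (ξ : Φ.E) :
    Φ.scalar (Φ.dualPow ω k (Φ.tpow k ξ)) = ω (Φ.toSp ξ) ^ k := Φ.ev_tpow k ω ξ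

lemma dirOp_monomial_tpow (σ : Φ.Dual) (n : ℕ) (ξ : Φ.E) :
    Φ.dirOp σ (Φ.monomial n (Φ.tpow n ξ)) =
      ((n : ℂ) * σ (Φ.toSp ξ)) • Φ.monomial (n - 1) (Φ.tpow (n - 1) ξ) := by
  rw [dirOp_monomial]
  cases n with
  | zero => simp
  | succ n =>
    rw [Φ.odot_id_scalar (by omega), scalar_dualPow_tpow, pow_one, map_smul, smul_smul]

lemma continuous_dirOp (σ : Φ.Dual) : Continuous (Φ.dirOp σ) := by
  refine Φ.continuous_polyHom fun k => ?_
  simp only [dirOp_monomial]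
  exact (continuous_const_smul _).comp
    ((Φ.continuous_monomial _).comp (ContinuousLinearMap.continuous _))

/-- For a general f the binomial expansion of (ω + tσ)^{⊗n} is proved as an identity of continuous
functionals on Φ^{⊙n}, checked on powers. The polynomial in t so obtained is differentiated term by
term. -/
lemma hasDerivAt_poly (σ ω : Φ.Dual) (p : Φ.Poly) :
    HasDerivAt (fun t : ℂ => (p : Φ.Dual → ℂ) (ω + t • σ))
      ((Φ.dirOp σ p : Φ.Dual → ℂ) ω) 0 := by
  let S : Submodule ℂ Φ.Poly :=
    { carrier := {p | HasDerivAt (fun t : ℂ => (p : Φ.Dual → ℂ) (ω + t • σ))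
        ((Φ.dirOp σ p : Φ.Dual → ℂ) ω) 0}
      zero_mem' := by
        have := hasDerivAt_const (0 : ℂ) (0 : ℂ)
        simpa using this
      add_mem' := by
        intro p q hp hq
        have := HasDerivAt.add hp hq
        rw [Set.mem_ofPred_eq, map_add]
        exact this
      smul_mem' := by
        intro c p hp
        have := HasDerivAt.const_smul c hp
        rw [Set.mem_ofPred_eq, map_smul]
        exact this }
  refine Φ.mem_of_monomial_mem (S := S) (fun n f => ?_) p
  -- The coefficient of t^j, that is ω^{⊗(n−j)} ⊙ σ^{⊗j} with its binomial weight.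
  let L : ℕ → (Φ.symPow n).Sp →L[ℂ] ℂ := fun j => (n.choose j : ℂ) •
    Φ.scalarL.comp (Φ.odot n (Φ.dualPow ω (n - j)) (Φ.dualPow σ j) : Φ.Op n 0)
  have hL : ∀ j ≤ n, ∀ ξ, L j (Φ.tpow n ξ) =
      n.choose j * (ω (Φ.toSp ξ) ^ (n - j) * σ (Φ.toSp ξ) ^ j) := by
    intro j hj ξ
    have := Φ.ev_odot (show n = (n - j) + j by omega) (Φ.dualPow ω (n - j)) (Φ.dualPow σ j) ξ ω
    rw [ev_zero, ev_zero, ev_zero, scalar_dualPow_tpow, scalar_dualPow_tpow] at this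
    rw [← this]
    rfl
  have h1 : ∀ t : ℂ, Φ.ev n (ω + t • σ) f = ∑ j ∈ Finset.range (n + 1), t ^ j * L j f := by
    intro t
    have : Φ.ev n (ω + t • σ) = ∑ j ∈ Finset.range (n + 1), t ^ j • L j := by
      refine Φ.ext_powers fun ξ => ?_
      rw [ev_tpow, _root_.sum_apply, _root_.add_apply, _root_.smul_apply, smul_eq_mul, add_comm,
        add_pow]
      refine Finset.sum_congr rfl fun j hj => ?_
      rw [_root_.smul_apply, hL j (Nat.lt_succ_iff.1 (Finset.mem_range.1 hj)), smul_eq_mul]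
      ring
    rw [this, _root_.sum_apply]
    rfl
  have h2 : (Φ.dirOp σ (Φ.monomial n f) : Φ.Dual → ℂ) ω =
      ∑ j ∈ Finset.range (n + 1), ((j : ℂ) * 0 ^ (j - 1)) * L j f := by
    have : (n : ℂ) • (Φ.ev (n - 1) ω).comp
        (Φ.odot n (ContinuousLinearMap.id ℂ (Φ.symPow (n - 1)).Sp) (Φ.dualPow σ 1) :
          Φ.Op n (n - 1)) = ∑ j ∈ Finset.range (n + 1), ((j : ℂ) * 0 ^ (j - 1)) • L j := by
      refine Φ.ext_powers fun ξ => ?_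
      cases n with
      | zero => simp
      | succ n =>
        rw [_root_.sum_apply, Finset.sum_eq_single 1]
        · rw [_root_.smul_apply, _root_.smul_apply, hL 1 (by omega), ContinuousLinearMap.comp_apply,
            Φ.odot_id_scalar (show n + 1 = (n + 1 - 1) + 1 by omega), map_smul, ev_tpow,
            scalar_dualPow_tpow, smul_eq_mul, smul_eq_mul, smul_eq_mul, Nat.choose_one_right]
          simp only [Nat.sub_self, pow_zero, Nat.cast_one]
          ring
        · intro j _ hj
          rcases j with _ | _ | j
          · simp
          · exact absurd rfl hj
          · simp
        · intro h
          simp at h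
    rw [dirOp_monomial]
    have := DFunLike.congr_fun this f
    rw [_root_.sum_apply] at this
    exact this
  change HasDerivAt (fun t : ℂ => Φ.ev n (ω + t • σ) f)
    ((Φ.dirOp σ (Φ.monomial n f) : Φ.Dual → ℂ) ω) 0
  rw [funext h1, h2]
  exact HasDerivAt.fun_sum fun j _ => (hasDerivAt_pow j (0 : ℂ)).mul_const _

lemma dirDeriv_coe (σ : Φ.Dual) (p : Φ.Poly) :
    Φ.dirDeriv σ (p : Φ.Dual → ℂ) = (Φ.dirOp σ p : Φ.Dual → ℂ) :=
  funext fun ω => (Φ.hasDerivAt_poly σ ω p).deriv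

/-- The iterated derivative, as an operator on polynomials. -/
def iterOp : (k : ℕ) → (Fin k → Φ.Dual) → Φ.PolyOp
  | 0, _ => 1
  | k + 1, σ => Φ.dirOp (σ 0) * iterOp k (Fin.tail σ)

lemma iterDeriv_coe (p : Φ.Poly) (k : ℕ) (σ : Fin k → Φ.Dual) :
    Φ.iterDeriv p k σ = (Φ.iterOp k σ p : Φ.Dual → ℂ) := by
  induction k with
  | zero => rfl
  | succ k ih => rw [iterDeriv, ih, dirDeriv_coe]; rfl

lemma continuous_iterOp (k : ℕ) (σ : Fin k → Φ.Dual) : Continuous (Φ.iterOp k σ) := by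
  induction k with
  | zero => exact continuous_id
  | succ k ih => exact (Φ.continuous_dirOp _).comp (ih _)

lemma iterOp_monomial_tpow (k : ℕ) (σ : Fin k → Φ.Dual) (n : ℕ) (ξ : Φ.E) :
    Φ.iterOp k σ (Φ.monomial n (Φ.tpow n ξ)) =
      ((n.descFactorial k : ℂ) * ∏ i, σ i (Φ.toSp ξ)) • Φ.monomial (n - k) (Φ.tpow (n - k) ξ) := by
  induction k with
  | zero => simp [iterOp]
  | succ k ih =>
    rw [iterOp, Module.End.mul_apply, ih, map_smul, dirOp_monomial_tpow, smul_smul, Nat.sub_sub,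
      Fin.prod_univ_succ, Nat.descFactorial_succ]
    congr 1
    push_cast
    simp only [Fin.tail]
    ring

/-- The `k`-th power of the gradient at `ω`, as a linear map. -/
def gradL (k : ℕ) (ω : Φ.Dual) : Φ.Poly →ₗ[ℂ] (Φ.symPow k).Sp :=
  Φ.polyLift fun n => (n.descFactorial k : ℂ) •
    (Φ.odot n (ContinuousLinearMap.id ℂ (Φ.symPow k).Sp) (Φ.dualPow ω (n - k)) :
      Φ.Op n k).toLinearMap

lemma gradL_monomial (k : ℕ) (ω : Φ.Dual) (n : ℕ) (f : (Φ.symPow n).Sp) :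
    Φ.gradL k ω (Φ.monomial n f) = (n.descFactorial k : ℂ) •
      (Φ.odot n (ContinuousLinearMap.id ℂ (Φ.symPow k).Sp) (Φ.dualPow ω (n - k)) :
        Φ.Op n k) f := by
  rw [gradL, polyLift_monomial]
  rfl

lemma continuous_evalPoly (ω : Φ.Dual) :
    Continuous fun p : Φ.Poly => (p : Φ.Dual → ℂ) ω :=
  continuous_of_finestLC (fun k => (Φ.symPow k).Sp) Φ.monomial
    (LinearMap.proj ω ∘ₗ Φ.Poly.subtype) fun k => (Φ.ev k ω).continuous

/-- For fixed degree n both sides are continuous in f, so powers suffice. There both equal n!/(n−k)!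
· ∏ σ_i(ξ) · ω(ξ)^{n−k}, and both are zero if n < k. -/
lemma iterDeriv_eq_gradL (p : Φ.Poly) (k : ℕ) (σ : Fin k → Φ.Dual) (ω : Φ.Dual) :
    Φ.iterDeriv p k σ ω = Φ.scalar (Φ.dualTensor σ (Φ.gradL k ω p)) := by
  rw [iterDeriv_coe]
  have : (LinearMap.proj ω ∘ₗ Φ.Poly.subtype ∘ₗ Φ.iterOp k σ : Φ.Poly →ₗ[ℂ] ℂ) =
      Φ.scalarL.toLinearMap ∘ₗ (Φ.dualTensor σ).toLinearMap ∘ₗ Φ.gradL k ω := by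
    refine Φ.polyHom_ext fun n f => ?_
    let C : (Φ.symPow n).Sp →L[ℂ] ℂ :=
      ⟨LinearMap.proj ω ∘ₗ Φ.Poly.subtype ∘ₗ Φ.iterOp k σ ∘ₗ Φ.monomial n,
        (Φ.continuous_evalPoly ω).comp ((Φ.continuous_iterOp k σ).comp (Φ.continuous_monomial n))⟩
    have hC : C = (n.descFactorial k : ℂ) • Φ.scalarL.comp ((Φ.dualTensor σ).comp
        (Φ.odot n (ContinuousLinearMap.id ℂ (Φ.symPow k).Sp) (Φ.dualPow ω (n - k)) :
          Φ.Op n k)) := by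
      refine Φ.ext_powers fun ξ => ?_
      change (Φ.iterOp k σ (Φ.monomial n (Φ.tpow n ξ)) : Φ.Dual → ℂ) ω = _
      rw [iterOp_monomial_tpow, _root_.smul_apply, ContinuousLinearMap.comp_apply,
        ContinuousLinearMap.comp_apply]
      rcases Nat.lt_or_ge n k with h | h
      · simp [Nat.descFactorial_eq_zero_iff_lt.2 h]
      · rw [Φ.odot_id_scalar (show n = k + (n - k) by omega), scalar_dualPow_tpow, map_smul,
          map_smul, scalarL_apply, scalar_dualTensor_tpow]
        change _ * Φ.ev (n - k) ω (Φ.tpow (n - k) ξ) = _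
        rw [ev_tpow, smul_eq_mul, smul_eq_mul]
        ring
    have := DFunLike.congr_fun hC f
    change _ = Φ.scalarL (Φ.dualTensor σ (Φ.gradL k ω (Φ.monomial n f)))
    rw [gradL_monomial, map_smul, map_smul]
    exact this
  exact DFunLike.congr_fun this p

lemma gradPow_coe (k : ℕ) (p : Φ.Poly) (ω : Φ.Dual) : Φ.gradPow k p ω = Φ.gradL k ω p := by
  have h := Classical.epsilon_spec (p := fun g : (Φ.symPow k).Sp =>
    ∀ σ : Fin k → Φ.Dual, Φ.iterDeriv p k σ ω = Φ.scalar (Φ.dualTensor σ g))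
    ⟨_, fun σ => Φ.iterDeriv_eq_gradL p k σ ω⟩
  exact Φ.ext_dualTensor fun σ => (h σ).symm.trans (Φ.iterDeriv_eq_gradL p k σ ω)

lemma gradL_eq_zero {k N : ℕ} (h : N ≤ k) (ω : Φ.Dual) {p : Φ.Poly} (hp : p ∈ Φ.polyLT N) :
    Φ.gradL k ω p = 0 :=
  Φ.polyLT_le (S := LinearMap.ker (Φ.gradL k ω)) (fun n hn f => by
    rw [LinearMap.mem_ker, gradL_monomial, Nat.descFactorial_eq_zero_iff_lt.2 (by omega),
      Nat.cast_zero, zero_smul]) hp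

/-- Sums over the powers of the gradient are finite and can be computed on monomials. -/
lemma finsum_gradPow_eq (ω : Φ.Dual) (L : ∀ k, (Φ.symPow k).Sp →ₗ[ℂ] ℂ) (T : Φ.Poly →ₗ[ℂ] ℂ)
    (h : ∀ n f, ∑ k ∈ Finset.range (n + 1), L k (Φ.gradL k ω (Φ.monomial n f)) =
      T (Φ.monomial n f)) (p : Φ.Poly) : ∑ᶠ k, L k (Φ.gradPow k p ω) = T p := by
  obtain ⟨N, hp⟩ := Φ.exists_mem_polyLT p
  have hs : (Function.support fun k => L k (Φ.gradPow k p ω)) ⊆ Finset.range N := by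
    intro k hk
    by_contra hkN
    refine hk ?_
    change L k _ = 0
    rw [gradPow_coe, Φ.gradL_eq_zero (by simpa using hkN) ω hp, map_zero]
  rw [finsum_eq_sum_of_support_subset _ hs]
  simp only [gradPow_coe]
  have := Φ.polyLT_le (n := N) (S := LinearMap.eqLocus
    (∑ k ∈ Finset.range N, L k ∘ₗ Φ.gradL k ω) T) (fun n hn f => by
      change (∑ k ∈ Finset.range N, L k ∘ₗ Φ.gradL k ω) _ = T _
      rw [← h, LinearMap.sum_apply]
      refine (Finset.sum_subset (Finset.range_mono hn) fun k _ hk => ?_).symm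
      rw [LinearMap.comp_apply, Φ.gradL_eq_zero (by simpa using hk) ω
        (Φ.monomial_mem_polyLT (Nat.lt_succ_self n) f), map_zero]) hp
  change (∑ k ∈ Finset.range N, L k ∘ₗ Φ.gradL k ω) p = T p at this
  rw [← this, LinearMap.sum_apply]
  rfl

lemma factorial_mul_inv {n k : ℕ} (h : k ≤ n) :
    (n.factorial : ℂ) * ((n - k).factorial : ℂ)⁻¹ = n.descFactorial k := by
  rw [← Nat.factorial_mul_descFactorial h]
  have : ((n - k).factorial : ℂ) ≠ 0 := by exact_mod_cast (n - k).factorial_ne_zero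
  push_cast
  field_simp

lemma vOp_monomial_apply (α : Φ.Series 0) (β : Φ.Series 1) (n : ℕ) (f : (Φ.symPow n).Sp)
    (ω : Φ.Dual) : (Φ.vOp α β (Φ.monomial n f) : Φ.Dual → ℂ) ω =
      ∑ i ∈ Finset.range (n + 1), Φ.ev i ω (Φ.vBlock α β i n f) := by
  rw [vOp_monomial, Submodule.coe_sum, Finset.sum_apply]
  rfl

/-- The k-th gradient of a monomial of degree n leaves degree n − k, so the sum over k is the sum
over the blocks i = n − k in reverse, with k!-free factor n!/(n−k)!. -/
lemma nablaOp_coe (α : Φ.Series 0) (p : Φ.Poly) :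
    Φ.nablaOp α p = (Φ.vOp α 0 p : Φ.Dual → ℂ) := by
  funext ω
  refine Φ.finsum_gradPow_eq ω (fun k => Φ.scalarL.toLinearMap ∘ₗ (α k).toLinearMap)
    (LinearMap.proj ω ∘ₗ Φ.Poly.subtype ∘ₗ Φ.vOp α 0) (fun n f => ?_) p
  refine Eq.trans ?_ (Φ.vOp_monomial_apply α 0 n f ω).symm
  rw [← Finset.sum_range_reflect (fun i => Φ.ev i ω (Φ.vBlock α 0 i n f))]
  refine Finset.sum_congr rfl fun k hk => ?_
  have hk' : k ≤ n := Nat.lt_succ_iff.1 (Finset.mem_range.1 hk)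
  rw [Nat.add_sub_cancel, vBlock, if_pos (Nat.sub_le n k), factorial_mul_inv hk', gradL_monomial]
  have hb : Φ.betaBlock 0 (n - k) n = 0 := by
    rcases hm : n - k with _ | m
    · rfl
    · rw [betaBlock, show (0 : Φ.Series 1) (n - m) = 0 from rfl, Φ.odot_zero_right (by omega),
        smul_zero]
  have : (Φ.scalarL.comp (α k)).comp
      (Φ.odot n (ContinuousLinearMap.id ℂ (Φ.symPow k).Sp) (Φ.dualPow ω (n - k)) : Φ.Op n k) =
      (Φ.ev (n - k) ω).comp (Φ.alphaBlock α (n - k) n) := by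
    refine Φ.ext_powers fun ξ => ?_
    rw [ContinuousLinearMap.comp_apply, ContinuousLinearMap.comp_apply,
      ContinuousLinearMap.comp_apply, Φ.odot_id_scalar (show n = k + (n - k) by omega), alphaBlock,
      Nat.sub_sub_self hk', Φ.odot_id_scalar (show n = (n - k) + k by omega), map_smul, map_smul,
      map_smul, scalar_dualPow_tpow, ev_tpow, scalarL_apply]
    exact mul_comm _ _
  rw [hb, add_zero (Φ.alphaBlock α (n - k) n), _root_.smul_apply, map_smul, map_smul]
  exact congrArg (fun z : ℂ => (n.descFactorial k : ℂ) • z) (DFunLike.congr_fun this f)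

lemma mulNablaOp_coe {β : Φ.Series 1} (hβ : β 0 = 0) (p : Φ.Poly) :
    Φ.mulNablaOp β p = (Φ.vOp 0 β p : Φ.Dual → ℂ) := by
  funext ω
  refine Φ.finsum_gradPow_eq ω (fun k => (Φ.ev 1 ω).toLinearMap ∘ₗ (β k).toLinearMap)
    (LinearMap.proj ω ∘ₗ Φ.Poly.subtype ∘ₗ Φ.vOp 0 β) (fun n f => ?_) p
  refine Eq.trans ?_ (Φ.vOp_monomial_apply 0 β n f ω).symm
  have ha : ∀ i ≤ n, Φ.alphaBlock 0 i n = 0 := fun i hi =>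
    Φ.odot_zero_right (by omega) _
  -- Multiplication by ω raises the degree, so k now corresponds to i = n − k + 1. The unmatched
  -- terms k = 0 and i = 0 drop out, because β_0 and the zeroth β-block vanish.
  rw [Finset.sum_range_succ', Finset.sum_range_succ', hβ, vBlock, if_pos (Nat.zero_le n),
    ha 0 (Nat.zero_le n), betaBlock, add_zero, smul_zero]
  refine congrArg₂ (· + ·) ?_ (show Φ.ev 1 ω 0 = Φ.ev 0 ω 0 by rw [map_zero, map_zero])
  rw [← Finset.sum_range_reflect (fun i => Φ.ev (i + 1) ω (Φ.vBlock 0 β (i + 1) n f))]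
  refine Finset.sum_congr rfl fun k hk => ?_
  have hk' : k < n := Finset.mem_range.1 hk
  obtain ⟨m, rfl⟩ : ∃ m, n = k + 1 + m := ⟨n - (k + 1), by omega⟩
  have hm : k + 1 + m - 1 - k = m := by omega
  rw [hm, vBlock, if_pos (by omega), ha _ (by omega), zero_add, gradL_monomial, betaBlock,
    show k + 1 + m - m = k + 1 by omega, show k + 1 + m - (k + 1) = m by omega]
  have : ((Φ.ev 1 ω).comp (β (k + 1))).comp
      (Φ.odot (k + 1 + m) (ContinuousLinearMap.id ℂ (Φ.symPow (k + 1)).Sp) (Φ.dualPow ω m) :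
        Φ.Op (k + 1 + m) (k + 1 + 0)) = (Φ.ev (m + 1) ω).comp
      (Φ.odot (k + 1 + m) (ContinuousLinearMap.id ℂ (Φ.symPow m).Sp) (β (k + 1))) := by
    refine Φ.ext_powers fun ξ => ?_
    rw [ContinuousLinearMap.comp_apply, ContinuousLinearMap.comp_apply,
      ContinuousLinearMap.comp_apply, Φ.odot_id_scalar rfl, Φ.ev_odot (by omega), map_smul,
      map_smul, scalar_dualPow_tpow, ContinuousLinearMap.id_apply, ev_tpow]
    rfl
  -- The factor m + 1 of the β-block turns n!/(m+1)! into n!/m!, the factor produced by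
  -- differentiating k + 1 times.
  have hc : ((k + 1 + m).factorial : ℂ) * ((m + 1).factorial : ℂ)⁻¹ * ((m + 1 : ℕ) : ℂ) =
      (k + 1 + m).descFactorial (k + 1) := by
    have h1 := factorial_mul_inv (n := k + 1 + m) (k := k + 1) (by omega)
    rw [show k + 1 + m - (k + 1) = m by omega] at h1
    rw [← h1, Nat.factorial_succ]
    have h2 : ((m + 1 : ℕ) : ℂ) ≠ 0 := by exact_mod_cast m.succ_ne_zero
    have h3 : (m.factorial : ℂ) ≠ 0 := by exact_mod_cast m.factorial_ne_zero
    push_cast at h2 ⊢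
    field_simp
  rw [smul_smul, hc, _root_.smul_apply, map_smul, map_smul]
  exact congrArg (fun z : ℂ => ((k + 1 + m).descFactorial (k + 1) : ℂ) • z)
    (DFunLike.congr_fun this f)

lemma diffOp_coe (α : Φ.Series 0) {β : Φ.Series 1} (hβ : β 0 = 0) (p : Φ.Poly) :
    Φ.diffOp α β p = (Φ.vOp α β p : Φ.Dual → ℂ) := by
  have := Φ.vOp_add α 0 0 β
  rw [add_zero, zero_add] at this
  rw [diffOp, nablaOp_coe, Φ.mulNablaOp_coe hβ, this]
  rfl

end LBSpace
end

/-! ### One-parameter subgroups of 𝓢(Φ): existence and uniqueness -/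

noncomputable section

namespace LBSpace

/-! ### The topologies of operators and series -/

section

variable (Φ : LBSpace.{u}) (Ψ : LBSpace.{v})

lemma isTopologicalAddGroup_homTopology :
    @IsTopologicalAddGroup (Φ.Sp →L[ℂ] Ψ.Sp) (homTopology Φ Ψ) _ := by
  refine topologicalAddGroup_iInf fun n => ?_
  let _ := stepHomTopology Φ Ψ n
  have : IsTopologicalAddGroup (Φ.step n →L[ℂ] Ψ.Sp) := isTopologicalAddGroup_finestLC _ _
  exact topologicalAddGroup_induced
    ({ toFun := fun A => A.comp (Φ.stepInclL n)
       map_zero' := rfl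
       map_add' := fun _ _ => rfl } : (Φ.Sp →L[ℂ] Ψ.Sp) →+ (Φ.step n →L[ℂ] Ψ.Sp))

lemma continuousSMul_homTopology :
    @ContinuousSMul ℂ (Φ.Sp →L[ℂ] Ψ.Sp) _ _ (homTopology Φ Ψ) := by
  refine continuousSMul_iInf fun n => ?_
  let _ := stepHomTopology Φ Ψ n
  have : @ContinuousSMul ℂ (Φ.step n →L[ℂ] Ψ.Sp) _ _ (stepHomTopology Φ Ψ n) :=
    continuousSMul_sInf fun _ ht => ht.2.1
  exact continuousSMul_induced
    ({ toFun := fun A => A.comp (Φ.stepInclL n)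
       map_add' := fun _ _ => rfl
       map_smul' := fun _ _ => rfl } : (Φ.Sp →L[ℂ] Ψ.Sp) →ₗ[ℂ] (Φ.step n →L[ℂ] Ψ.Sp))

/-- Evaluation at a point followed by a functional is continuous. -/
lemma continuous_homTopology_eval (f : Φ.Sp) (φ : Ψ.Dual) :
    @Continuous _ _ (homTopology Φ Ψ) _ fun A : Φ.Sp →L[ℂ] Ψ.Sp => φ (A f) := by
  obtain ⟨n, hn⟩ := Φ.exists_ofSp_mem f
  refine continuous_iInf_dom (i := n) ?_
  let x : Φ.step n := ⟨Φ.ofSp f, hn⟩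
  let T : (Φ.step n →L[ℂ] Ψ.Sp) →ₗ[ℂ] ℂ :=
    { toFun := fun A => φ (A x)
      map_add' := fun A B => by rw [_root_.add_apply, map_add]
      map_smul' := fun c A => by rw [_root_.smul_apply, map_smul]; rfl }
  have hT : @Continuous _ _ (stepHomTopology Φ Ψ n) _ T :=
    continuous_of_finestLC (fun m => Φ.step n →L[ℂ] Ψ.step m) _ T fun m =>
      (φ.comp (Ψ.stepInclL m)).continuous.comp (ContinuousLinearMap.apply ℂ (Ψ.step m) x).continuous
  let π : (Φ.Sp →L[ℂ] Ψ.Sp) → (Φ.step n →L[ℂ] Ψ.Sp) := fun A => A.comp (Φ.stepInclL n)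
  exact @Continuous.comp _ _ _ (TopologicalSpace.induced π (stepHomTopology Φ Ψ n))
    (stepHomTopology Φ Ψ n) _ π T hT continuous_induced_dom

end

variable (Φ : LBSpace.{u})

lemma tendsto_series_iff {ι : Type*} {l : Filter ι} {i : ℕ} {c : ι → Φ.Series i}
    {X : Φ.Series i} : Tendsto c l (𝓝 X) ↔
      ∀ k, Tendsto (fun a => c a k) l (@nhds _ (homTopology (Φ.symPow k) (Φ.symPow i)) (X k)) := by
  rw [nhds_iInf, tendsto_iInf]
  refine forall_congr' fun k => ?_
  let _ := homTopology (Φ.symPow k) (Φ.symPow i)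
  rw [nhds_induced, tendsto_comap_iff]
  rfl

/-! ### Derivatives of curves -/

lemma tendsto_ofReal_punctured :
    Tendsto (fun h : ℝ => (h : ℂ)) (𝓝[≠] 0) (𝓝[≠] 0) := by
  refine tendsto_nhdsWithin_of_tendsto_nhds_of_eventually_within _ ?_ ?_
  · have := Complex.continuous_ofReal.tendsto 0
    rw [Complex.ofReal_zero] at this
    exact this.mono_left nhdsWithin_le_nhds
  · filter_upwards [self_mem_nhdsWithin] with h hh
    exact Complex.ofReal_ne_zero.2 hh

lemma hasCurveDeriv_polynomial {V : Type*} [AddCommGroup V] [Module ℂ V] [TopologicalSpace V]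
    [IsTopologicalAddGroup V] [ContinuousSMul ℂ V] (N : ℕ) (x : ℕ → V) (t : ℝ) :
    HasCurveDeriv (fun s : ℝ => ∑ n ∈ Finset.range N, (s : ℂ) ^ n • x n)
      (∑ n ∈ Finset.range N, ((n : ℂ) * (t : ℂ) ^ (n - 1)) • x n) t := by
  have h : ∀ n : ℕ, Tendsto (fun h : ℝ => (h : ℂ)⁻¹ * (((t + h : ℝ) : ℂ) ^ n - (t : ℂ) ^ n))
      (𝓝[≠] 0) (𝓝 ((n : ℂ) * (t : ℂ) ^ (n - 1))) := by
    intro n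
    have := (hasDerivAt_iff_tendsto_slope_zero.1 (hasDerivAt_pow n (t : ℂ))).comp
      tendsto_ofReal_punctured
    refine this.congr fun h => ?_
    simp
  refine (tendsto_finsetSum _ fun n _ => (h n).smul_const (x n)).congr fun h => ?_
  rw [← Finset.sum_sub_distrib, Finset.smul_sum]
  refine Finset.sum_congr rfl fun n _ => ?_
  rw [← sub_smul, smul_smul]

variable {Φ}

lemma HasCurveDeriv.sub_const {V : Type*} [AddCommGroup V] [Module ℂ V] [TopologicalSpace V]
    {c : ℝ → V} {d : V} {t : ℝ} (h : HasCurveDeriv c d t) (x : V) :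
    HasCurveDeriv (fun s => c s - x) d t := by
  refine Tendsto.congr (fun h => ?_) h
  rw [sub_sub_sub_cancel_right]

lemma HasCurveDeriv.prodMk {V W : Type*} [AddCommGroup V] [Module ℂ V] [TopologicalSpace V]
    [AddCommGroup W] [Module ℂ W] [TopologicalSpace W]
    {c : ℝ → V} {d : V} {c' : ℝ → W} {d' : W} {t : ℝ} (h : HasCurveDeriv c d t)
    (h' : HasCurveDeriv c' d' t) : HasCurveDeriv (fun s => (c s, c' s)) (d, d') t :=
  Tendsto.prodMk_nhds h h'

/-- Each coefficient of exp(sT)X is a polynomial in s. Such a curve is differentiable in any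
topological vector space, so only compatibility of the operator topology with the vector operations
is used. -/
lemma IsRaising.hasCurveDeriv_expSer {i : ℕ} {T : Module.End ℂ (Φ.Series i)}
    (hT : Φ.IsRaising T) (X : Φ.Series i) (t : ℝ) :
    HasCurveDeriv (fun s : ℝ => expSer ((s : ℂ) • T) X) (expSer ((t : ℂ) • T) (T X)) t := by
  have hpow : ∀ (s : ℂ) (n : ℕ) (Y : Φ.Series i), ((s • T) ^ n) Y = s ^ n • (T ^ n) Y := by
    intro s n Y
    rw [smul_pow, LinearMap.smul_apply]
  refine Φ.tendsto_series_iff.2 fun k => ?_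
  let _ := homTopology (Φ.symPow k) (Φ.symPow i)
  have := isTopologicalAddGroup_homTopology (Φ.symPow k) (Φ.symPow i)
  have := continuousSMul_homTopology (Φ.symPow k) (Φ.symPow i)
  have h := hasCurveDeriv_polynomial (k + 1) (fun n => (n.factorial : ℂ)⁻¹ • (T ^ n) X k) t
  have hd : expSer ((t : ℂ) • T) (T X) k = ∑ n ∈ Finset.range (k + 1),
      ((n : ℂ) * (t : ℂ) ^ (n - 1)) • ((n.factorial : ℂ)⁻¹ • (T ^ n) X k) := by
    rw [expSer_apply, Finset.sum_range_succ, Finset.sum_range_succ']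
    -- Differentiation shortens the sum by one term; the surplus term of exp(tT)(TX) contains
    -- T^{k+1}X, which has no coefficient of order k.
    have h0 : (((t : ℂ) • T) ^ k) (T X) k = 0 := by
      rw [hpow, ← Module.End.mul_apply, ← pow_succ, series_smul_apply,
        hT.pow_apply X (Nat.lt_succ_self k), smul_zero]
    rw [h0, smul_zero, add_zero, Nat.cast_zero, zero_mul, zero_smul, add_zero]
    refine Finset.sum_congr rfl fun n _ => ?_
    rw [hpow, ← Module.End.mul_apply, ← pow_succ, series_smul_apply, smul_smul, smul_smul,
      Nat.add_sub_cancel, Nat.factorial_succ]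
    congr 1
    have h1 : ((n + 1 : ℕ) : ℂ) ≠ 0 := by exact_mod_cast n.succ_ne_zero
    have h2 : (n.factorial : ℂ) ≠ 0 := by exact_mod_cast n.factorial_ne_zero
    push_cast at h1 ⊢
    field_simp
  rw [hd]
  refine Tendsto.congr (fun r => ?_) h
  have hc : ∀ s : ℝ, expSer ((s : ℂ) • T) X k = ∑ n ∈ Finset.range (k + 1),
      (s : ℂ) ^ n • ((n.factorial : ℂ)⁻¹ • (T ^ n) X k) := by
    intro s
    rw [expSer_apply]
    refine Finset.sum_congr rfl fun n _ => ?_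
    rw [hpow, series_smul_apply, smul_comm]
  exact (congrArg₂ (fun a b => (r : ℂ)⁻¹ • (a - b)) (hc (t + r)) (hc t)).symm

/-- Functionals of the coefficients of a differentiable curve are differentiable. -/
lemma HasCurveDeriv.hasDerivAt_ev {i : ℕ} {c : ℝ → Φ.Series i} {d : Φ.Series i} {t : ℝ}
    (h : HasCurveDeriv c d t) (k : ℕ) (f : (Φ.symPow k).Sp) (ω : Φ.Dual) :
    HasDerivAt (fun s => Φ.ev i ω (c s k f)) (Φ.ev i ω (d k f)) t := by
  rw [hasDerivAt_iff_tendsto_slope_zero]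
  let _ := homTopology (Φ.symPow k) (Φ.symPow i)
  have h1 := ((continuous_homTopology_eval (Φ.symPow k) (Φ.symPow i) f (Φ.ev i ω)).tendsto
    (d k)).comp (Φ.tendsto_series_iff.1 h k)
  refine h1.congr fun r => ?_
  change Φ.ev i ω (((r : ℂ)⁻¹ • (c (t + r) k - c t k)) f) = _
  rw [_root_.smul_apply, _root_.sub_apply, map_smul, map_sub, ← Complex.ofReal_inv,
    Complex.real_smul, smul_eq_mul]

/-! ### One-parameter subgroups -/

variable (Φ)

lemma isOneParamSubgroup_flow {α : Φ.Series 0} (hα : α ∈ Φ.W0) {β : Φ.Series 1}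
    (hβ : β ∈ Φ.W1) :
    Φ.IsOneParamSubgroup (fun t : ℝ => (Φ.flowA α β t, Φ.flowB β t)) (α, β) := by
  refine ⟨fun t => ⟨Φ.flowA_mem_F0 α β t, Φ.flowB_mem_F1 hβ t⟩, ?_, fun s t => ?_,
    -- The n-th derivative of exp(tT)X is exp(tT)TⁿX; only for n = 0 is the base point of the
    -- parametrization subtracted.
    fun n t => (expSer ((t : ℂ) • Φ.dualL α β) ((Φ.dualL α β ^ n) Φ.oneS),
      expSer ((t : ℂ) • Φ.derivL β 1) ((Φ.derivL β 1 ^ n) Φ.idS)) -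
        if n = 0 then (Φ.oneS, Φ.idS) else 0, fun t => ?_, fun n t => ?_, ?_⟩
  · change (Φ.flowA α β ((0 : ℝ) : ℂ), Φ.flowB β ((0 : ℝ) : ℂ)) = _
    rw [Complex.ofReal_zero, flowA, flowB, expSer_zero_smul, expSer_zero_smul]
  · change (Φ.flowA α β ((s + t : ℝ) : ℂ), Φ.flowB β ((s + t : ℝ) : ℂ)) = _
    rw [Φ.mulPair_flow hα hβ, Complex.ofReal_add, add_comm, flowA, flowB,
      (Φ.isRaising_dualL hα hβ).expSer_add, (Φ.isRaising_derivL hβ 1).expSer_add]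
    rfl
  · simp only [if_true, pow_zero, Module.End.one_apply]
    rfl
  · have h := (((Φ.isRaising_dualL hα hβ).hasCurveDeriv_expSer ((Φ.dualL α β ^ n) Φ.oneS) t).prodMk
      ((Φ.isRaising_derivL hβ 1).hasCurveDeriv_expSer ((Φ.derivL β 1 ^ n) Φ.idS) t)).sub_const
      (if n = 0 then (Φ.oneS, Φ.idS) else 0)
    have h1 : Φ.dualL α β ((Φ.dualL α β ^ n) Φ.oneS) = (Φ.dualL α β ^ (n + 1)) Φ.oneS := by
      rw [pow_succ', Module.End.mul_apply]
    have h2 : Φ.derivL β 1 ((Φ.derivL β 1 ^ n) Φ.idS) = (Φ.derivL β 1 ^ (n + 1)) Φ.idS := by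
      rw [pow_succ', Module.End.mul_apply]
    rw [h1, h2] at h
    simpa using h
  · simp only [Complex.ofReal_zero, expSer_zero_smul, pow_one, dualL_oneS, derivL_apply,
      Φ.derivS_idS hβ.1]
    simp

lemma powS_congr {B B' : Φ.Series 1} {k : ℕ} (h : ∀ j ≤ k, B j = B' j) (l : ℕ) :
    ∀ j ≤ k, Φ.powS B l j = Φ.powS B' l j := by
  induction l with
  | zero => exact fun _ _ => rfl
  | succ l ih =>
    exact fun j hj => mulS_congr (fun a ha => ih a (by omega)) (fun a ha => h a (by omega))

lemma powS_succ_zero {B : Φ.Series 1} (hB : B 0 = 0) (l : ℕ) : Φ.powS B (l + 1) 0 = 0 := 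
  mulS_vanish (p := 0) (q := 1) (fun a ha => absurd ha (Nat.not_lt_zero a))
    (fun a ha => by rw [Nat.lt_one_iff.1 ha, hB]) 0 Nat.one_pos

/-- Since β starts in degree two, every occurrence of B in β(B) is multiplied by a series without
constant term, so its k-th coefficient cannot reach order k. The equation B' = β(B) is therefore
triangular. -/
lemma compS_congr_lt {β : Φ.Series 1} (hβ : β ∈ Φ.W1) {B B' : Φ.Series 1} (hB : B 0 = 0)
    (hB' : B' 0 = 0) {k : ℕ} (h : ∀ j < k, B j = B' j) : Φ.compS β B k = Φ.compS β B' k := by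
  refine Finset.sum_congr rfl fun l _ => ?_
  rcases l with _ | _ | l
  · rw [hβ.1, ContinuousLinearMap.zero_comp, ContinuousLinearMap.zero_comp]
  · rw [hβ.2, ContinuousLinearMap.zero_comp, ContinuousLinearMap.zero_comp]
  · refine congrArg (fun Z : Φ.Op k (l + 2) => (β (l + 2)).comp Z) ?_
    exact Φ.mulS_congr_lt (Φ.powS_succ_zero hB l) (Φ.powS_succ_zero hB' l) hB hB'
      (fun j hj => Φ.powS_congr (k := j) (fun m hm => h m (by omega)) _ j le_rfl) h

lemma hasDerivAt_translate {F : Type*} [NormedAddCommGroup F] [NormedSpace ℝ F] {φ : ℝ → F} {d : F}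
    {t : ℝ} (h : HasDerivAt (fun s => φ (s + t)) d 0) : HasDerivAt φ d t := by
  have := HasDerivAt.comp_sub_const t t (f := fun s => φ (s + t)) (f' := d) (by rwa [sub_self])
  simpa using this

variable {Φ}

lemma IsOneParamSubgroup.hasDerivAt_zero {γ : ℝ → Φ.Series 0 × Φ.Series 1}
    {v : Φ.Series 0 × Φ.Series 1} (h : Φ.IsOneParamSubgroup γ v) :
    HasCurveDeriv (fun t => (γ t).1) v.1 0 ∧ HasCurveDeriv (fun t => (γ t).2) v.2 0 := by
  obtain ⟨-, -, -, D, hD0, hD, hv⟩ := h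
  have h0 := hD 0 0
  rw [zero_add, hv] at h0
  have h1 : HasCurveDeriv γ v 0 := by
    refine Tendsto.congr (fun r => ?_) h0
    rw [hD0, hD0, sub_sub_sub_cancel_right]
  exact ⟨(continuous_fst.tendsto v).comp h1, (continuous_snd.tendsto v).comp h1⟩

lemma HasCurveDeriv.hasDerivAt_compS {i : ℕ} {c : ℝ → Φ.Series i} {d : Φ.Series i} {t : ℝ}
    (h : HasCurveDeriv c d t) (B : Φ.Series 1) (k : ℕ) (f : (Φ.symPow k).Sp) (ω : Φ.Dual) :
    HasDerivAt (fun s => Φ.ev i ω (Φ.compS (c s) B k f)) (Φ.ev i ω (Φ.compS d B k f)) t := by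
  simp only [compS, _root_.sum_apply, map_sum]
  exact HasDerivAt.fun_sum fun l _ => h.hasDerivAt_ev l _ ω

/-- Composition is linear in the outer series, so differentiating γ(s + t) = γ(s) * γ(t) at s = 0
gives B' = β(B). -/
lemma IsOneParamSubgroup.hasDerivAt_snd {γ : ℝ → Φ.Series 0 × Φ.Series 1}
    {v : Φ.Series 0 × Φ.Series 1} (h : Φ.IsOneParamSubgroup γ v) (t : ℝ) (k : ℕ)
    (f : (Φ.symPow k).Sp) (ω : Φ.Dual) :
    HasDerivAt (fun s => Φ.ev 1 ω ((γ s).2 k f)) (Φ.ev 1 ω (Φ.compS v.2 (γ t).2 k f)) t := by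
  refine hasDerivAt_translate ?_
  simp only [h.2.2.1, mulPair]
  exact h.hasDerivAt_zero.2.hasDerivAt_compS _ k f ω

lemma ev_mulS_zero_tpow (X Y : Φ.Series 0) (k : ℕ) (ξ : Φ.E) (ω : Φ.Dual) :
    Φ.ev 0 ω ((Φ.mulS X Y : Φ.Series 0) k (Φ.tpow k ξ)) =
      ∑ p ∈ Finset.HasAntidiagonal.antidiagonal k,
        Φ.ev 0 ω (X p.1 (Φ.tpow p.1 ξ)) * Φ.ev 0 ω (Y p.2 (Φ.tpow p.2 ξ)) := by
  rw [← coeff_gen, gen_mulS_zero, PowerSeries.coeff_mul]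
  simp only [coeff_gen]

/-- The same differentiation in the first component gives A' = α(B) A. -/
lemma IsOneParamSubgroup.hasDerivAt_fst {γ : ℝ → Φ.Series 0 × Φ.Series 1}
    {v : Φ.Series 0 × Φ.Series 1} (h : Φ.IsOneParamSubgroup γ v) (t : ℝ) (k : ℕ) (ξ : Φ.E)
    (ω : Φ.Dual) :
    HasDerivAt (fun s => Φ.ev 0 ω ((γ s).1 k (Φ.tpow k ξ)))
      (Φ.ev 0 ω ((Φ.mulS (Φ.compS v.1 (γ t).2) (γ t).1 : Φ.Series 0) k (Φ.tpow k ξ))) t := by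
  refine hasDerivAt_translate ?_
  simp only [h.2.2.1, mulPair, ev_mulS_zero_tpow]
  exact HasDerivAt.fun_sum fun p _ => (h.hasDerivAt_zero.1.hasDerivAt_compS _ _ _ ω).mul_const _

lemma eq_of_hasDerivAt {φ ψ d : ℝ → ℂ} (hφ : ∀ t, HasDerivAt φ (d t) t)
    (hψ : ∀ t, HasDerivAt ψ (d t) t) (h0 : φ 0 = ψ 0) (t : ℝ) : φ t = ψ t := by
  have h : ∀ t, HasDerivAt (φ - ψ) 0 t := fun t => by
    have := (hφ t).sub (hψ t)
    rwa [sub_self] at this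
  have := is_const_of_deriv_eq_zero (fun t => (h t).differentiableAt) (fun t => (h t).deriv) t 0
  simpa [h0, sub_eq_zero] using this

/-- Induction on the degree, first for B and then for A: the derivative of a coefficient involves
only coefficients already known to coincide, and the values at 0 are equal. Testing with ω and ξ
reduces this to scalar functions. -/
lemma IsOneParamSubgroup.unique {γ γ' : ℝ → Φ.Series 0 × Φ.Series 1} {α : Φ.Series 0}
    (hα : α ∈ Φ.W0) {β : Φ.Series 1} (hβ : β ∈ Φ.W1) (h : Φ.IsOneParamSubgroup γ (α, β))
    (h' : Φ.IsOneParamSubgroup γ' (α, β)) : γ = γ' := by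
  have hB : ∀ k t, (γ t).2 k = (γ' t).2 k := by
    intro k
    induction k using Nat.strong_induction_on with
    | _ k ih =>
      intro t
      refine Φ.op_ext fun ξ ω => ?_
      refine eq_of_hasDerivAt (ψ := fun t => Φ.ev 1 ω ((γ' t).2 k (Φ.tpow k ξ)))
        (h.hasDerivAt_snd · k (Φ.tpow k ξ) ω) (fun t => ?_) ?_ t
      · have := h'.hasDerivAt_snd t k (Φ.tpow k ξ) ω
        rwa [← Φ.compS_congr_lt hβ (h.1 t).2.1 (h'.1 t).2.1 fun j hj => ih j hj t] at this
      · rw [h.2.1, h'.2.1]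
  have hB' : ∀ t, (γ t).2 = (γ' t).2 := fun t => funext fun k => hB k t
  have hA : ∀ k t, (γ t).1 k = (γ' t).1 k := by
    intro k
    induction k using Nat.strong_induction_on with
    | _ k ih =>
      intro t
      refine Φ.op_ext fun ξ ω => ?_
      refine eq_of_hasDerivAt (ψ := fun t => Φ.ev 0 ω ((γ' t).1 k (Φ.tpow k ξ)))
        (h.hasDerivAt_fst · k ξ ω) (fun t => ?_) ?_ t
      · have := h'.hasDerivAt_fst t k ξ ω
        have hc : (Φ.mulS (Φ.compS α (γ t).2) (γ t).1 : Φ.Series 0) k =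
            (Φ.mulS (Φ.compS α (γ' t).2) (γ' t).1 : Φ.Series 0) k := by
          rw [← hB' t]
          refine Finset.sum_congr rfl fun p hp => ?_
          have hp' := Finset.HasAntidiagonal.mem_antidiagonal.1 hp
          rcases Nat.eq_zero_or_pos p.1 with h0 | h0
          -- α(B) has no constant term, so the k-th coefficient of A does not occur in its own
          -- derivative.
          · have : Φ.compS α (γ t).2 p.1 = 0 := by
              rw [h0]
              refine Finset.sum_eq_zero fun l hl => ?_
              have : l = 0 := by simpa using hl
              subst this
              rw [show α 0 = 0 from hα, ContinuousLinearMap.zero_comp]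
            rw [this, Φ.odot_zero_left (by omega), Φ.odot_zero_left (by omega)]
          · rw [ih p.2 (by omega) t]
        rwa [← hc] at this
      · rw [h.2.1, h'.2.1]
  exact funext fun t => Prod.ext (funext fun k => hA k t) (hB' t)

variable (Φ)

lemma EXP_eq {α : Φ.Series 0} (hα : α ∈ Φ.W0) {β : Φ.Series 1} (hβ : β ∈ Φ.W1) :
    Φ.EXP (α, β) = (Φ.flowA α β 1, Φ.flowB β 1) := by
  have hf := Φ.isOneParamSubgroup_flow hα hβ
  have h := Classical.epsilon_spec
    (p := fun γ : ℝ → Φ.Series 0 × Φ.Series 1 => Φ.IsOneParamSubgroup γ (α, β)) ⟨_, hf⟩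
  rw [EXP, h.unique hα hβ hf]
  change (Φ.flowA α β ((1 : ℝ) : ℂ), Φ.flowB β ((1 : ℝ) : ℂ)) = _
  rw [Complex.ofReal_one]

lemma R_eq_vOp {α : Φ.Series 0} (hα : α ∈ Φ.W0) {β : Φ.Series 1} (hβ : β ∈ Φ.W1) :
    Φ.R α β = Φ.vOp α β := by
  rw [R, Φ.EXP_eq hα hβ, Φ.shefferOp_flow hα hβ, logOp_expOp (Φ.vOp_mem_lowering hα hβ)]

end LBSpace
end

/-! ### The expansion of log(exp(sV) exp(tW)) in commuting scalars s and t -/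

noncomputable section

/-! ### Polynomials in two scalar variables with noncommuting coefficients -/

section TwoVariables

open Polynomial

/-- Linear functionals reduce this to a scalar polynomial that vanishes everywhere; no topology on M
is involved. -/
lemma eq_zero_of_forall_sum_pow_smul {M : Type*} [AddCommGroup M] [Module ℂ M] {N : ℕ} {x : ℕ → M}
    (h : ∀ s : ℂ, ∑ n ∈ Finset.range N, s ^ n • x n = 0) {n : ℕ} (hn : n < N) : x n = 0 := by
  rw [← Module.forall_dual_apply_eq_zero_iff ℂ]
  intro φ
  have hP : ∑ n ∈ Finset.range N, Polynomial.monomial n (φ (x n)) = 0 := by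
    refine Polynomial.funext fun s => ?_
    rw [Polynomial.eval_finsetSum, Polynomial.eval_zero, ← map_zero φ, ← h s, map_sum]
    refine Finset.sum_congr rfl fun n _ => ?_
    rw [Polynomial.eval_monomial, map_smul, smul_eq_mul, mul_comm]
  have := congrArg (fun P => Polynomial.coeff P n) hP
  simpa [Polynomial.finsetSum_coeff, Polynomial.coeff_monomial, hn] using this

variable {A : Type*} [Ring A]

lemma exists_coeff_bound (Q : A[X][X]) : ∃ n, (∀ a ≥ n, Q.coeff a = 0) ∧
    ∀ a, ∀ b ≥ n, (Q.coeff a).coeff b = 0 := by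
  set d := Q.natDegree + 1
  set m := (Finset.range d).sup fun a => (Q.coeff a).natDegree + 1
  have h1 : ∀ a ≥ d, Q.coeff a = 0 := fun a ha =>
    Polynomial.coeff_eq_zero_of_natDegree_lt (by omega)
  refine ⟨max d m, fun a ha => h1 a (le_of_max_le_left ha), fun a b hb => ?_⟩
  rcases Nat.lt_or_ge a d with h | h
  · have h2 : (Q.coeff a).natDegree + 1 ≤ m :=
      Finset.le_sup (f := fun a => (Q.coeff a).natDegree + 1) (Finset.mem_range.2 h)
    exact Polynomial.coeff_eq_zero_of_natDegree_lt
      (lt_of_lt_of_le (Nat.lt_succ_self _) (h2.trans (le_of_max_le_right hb)))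
  · rw [h1 a h, Polynomial.coeff_zero]

variable [Algebra ℂ A]

/-- Evaluation of a polynomial with noncommuting coefficients at a scalar. -/
def evalScalar (t : ℂ) : A[X] →+* A :=
  Polynomial.eval₂RingHom' (RingHom.id A) (algebraMap ℂ A t) fun a => (Algebra.commutes t a).symm

/-- Evaluation of a polynomial in two variables with noncommuting coefficients at scalars. -/
def evalScalars (s t : ℂ) : A[X][X] →+* A :=
  Polynomial.eval₂RingHom' (evalScalar t) (algebraMap ℂ A s) fun a =>
    (Algebra.commutes s (evalScalar t a)).symm

lemma evalScalar_eq_sum (t : ℂ) (Q : A[X]) {m : ℕ} (hm : ∀ b ≥ m, Q.coeff b = 0) :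
    evalScalar t Q = ∑ b ∈ Finset.range m, t ^ b • Q.coeff b := by
  change Polynomial.eval₂ (RingHom.id A) (algebraMap ℂ A t) Q = _
  rw [Polynomial.eval₂_eq_sum, Polynomial.sum_over_range' _ (by simp) (max m (Q.natDegree + 1))
    (by omega), ← Finset.sum_subset (Finset.range_mono (le_max_left m (Q.natDegree + 1)))]
  · refine Finset.sum_congr rfl fun b _ => ?_
    rw [RingHom.id_apply, ← map_pow, ← Algebra.commutes, ← Algebra.smul_def]
  · intro b _ hb
    rw [hm b (by simpa using hb), map_zero, zero_mul]

lemma evalScalars_eq_sum (s t : ℂ) (Q : A[X][X]) {n m : ℕ} (hn : ∀ a ≥ n, Q.coeff a = 0)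
    (hm : ∀ a, ∀ b ≥ m, (Q.coeff a).coeff b = 0) :
    evalScalars s t Q =
      ∑ a ∈ Finset.range n, s ^ a • ∑ b ∈ Finset.range m, t ^ b • (Q.coeff a).coeff b := by
  change Polynomial.eval₂ (evalScalar t) (algebraMap ℂ A s) Q = _
  rw [Polynomial.eval₂_eq_sum, Polynomial.sum_over_range' _ (by simp) (max n (Q.natDegree + 1))
    (by omega), ← Finset.sum_subset (Finset.range_mono (le_max_left n (Q.natDegree + 1)))]
  · refine Finset.sum_congr rfl fun a _ => ?_
    rw [evalScalar_eq_sum t _ (hm a), ← map_pow, ← Algebra.commutes, ← Algebra.smul_def]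
  · intro a _ ha
    rw [hn a (by simpa using ha), map_zero, zero_mul]

/-- The coefficients of a polynomial are determined by its values. -/
lemma apply_coeff_eq_zero {M : Type*} [AddCommGroup M] [Module ℂ M] (T : A →ₗ[ℂ] M) (Q : A[X][X])
    (h : ∀ s t, T (evalScalars s t Q) = 0) (a b : ℕ) : T ((Q.coeff a).coeff b) = 0 := by
  obtain ⟨n, h1, h2⟩ := exists_coeff_bound Q
  rcases Nat.lt_or_ge a n with ha | ha
  · rcases Nat.lt_or_ge b n with hb | hb
    · refine eq_zero_of_forall_sum_pow_smul (N := n)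
        (x := fun b => T ((Q.coeff a).coeff b)) (fun t => ?_) hb
      refine eq_zero_of_forall_sum_pow_smul (N := n) (x := fun a => ∑ b ∈ Finset.range n,
        t ^ b • T ((Q.coeff a).coeff b)) (fun s => ?_) ha
      rw [← h s t, evalScalars_eq_sum s t Q h1 h2, map_sum]
      refine Finset.sum_congr rfl fun a _ => ?_
      rw [map_smul, map_sum]
      simp only [map_smul]
    · rw [h2 a b hb, map_zero]
  · rw [h1 a ha, Polynomial.coeff_zero, map_zero]

/-- In the quotient by S the polynomial has only zero values, hence zero coefficients. Membership of
the Taylor coefficients in 𝔰(Φ) will come from membership of the values. -/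
lemma coeff_mem_of_evalScalars_mem (S : Submodule ℂ A) (Q : A[X][X])
    (h : ∀ s t, evalScalars s t Q ∈ S) (a b : ℕ) : (Q.coeff a).coeff b ∈ S :=
  (Submodule.Quotient.mk_eq_zero S).1 (apply_coeff_eq_zero S.mkQ Q
    (fun s t => (Submodule.Quotient.mk_eq_zero S).2 (h s t)) a b)

/-- The truncation of `exp(s V) exp(t W)`. -/
def expExpPoly (V W : A) (N : ℕ) : A[X][X] :=
  (∑ a ∈ Finset.range N, C (C ((a.factorial : ℂ)⁻¹ • V ^ a)) * X ^ a) *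
    C (∑ b ∈ Finset.range N, C ((b.factorial : ℂ)⁻¹ • W ^ b) * X ^ b)

/-- The truncation of `log(exp(s V) exp(t W))`. -/
def logExpPoly (V W : A) (N : ℕ) : A[X][X] :=
  ∑ n ∈ Finset.range N,
    C (C (algebraMap ℂ A ((-1) ^ n / (n + 1 : ℂ)))) * (expExpPoly V W N - 1) ^ (n + 1)

lemma evalScalars_C (s t : ℂ) (Q : A[X]) : evalScalars s t (C Q) = evalScalar t Q :=
  Polynomial.eval₂_C _ _

lemma evalScalar_C (t : ℂ) (a : A) : evalScalar t (C a) = a := Polynomial.eval₂_C _ _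

lemma evalScalars_X (s t : ℂ) : evalScalars s t (X : A[X][X]) = algebraMap ℂ A s :=
  Polynomial.eval₂_X _ _

lemma evalScalar_X (t : ℂ) : evalScalar t (X : A[X]) = algebraMap ℂ A t :=
  Polynomial.eval₂_X _ _

lemma evalScalars_expExpPoly (V W : A) (N : ℕ) (s t : ℂ) : evalScalars s t (expExpPoly V W N) =
    (∑ n ∈ Finset.range N, (n.factorial : ℂ)⁻¹ • (s • V) ^ n) *
      ∑ n ∈ Finset.range N, (n.factorial : ℂ)⁻¹ • (t • W) ^ n := by
  have h : ∀ (s : ℂ) (V : A) (n : ℕ), (n.factorial : ℂ)⁻¹ • V ^ n * algebraMap ℂ A s ^ n =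
      (n.factorial : ℂ)⁻¹ • (s • V) ^ n := by
    intro s V n
    rw [← map_pow, ← Algebra.commutes, ← Algebra.smul_def, smul_comm, _root_.smul_pow]
  rw [expExpPoly, map_mul, evalScalars_C, map_sum, map_sum]
  simp only [map_mul, map_pow, evalScalars_C, evalScalar_C, evalScalars_X, evalScalar_X, h]

lemma evalScalars_logExpPoly (V W : A) (N : ℕ) (s t : ℂ) : evalScalars s t (logExpPoly V W N) =
    ∑ n ∈ Finset.range N, ((-1) ^ n / (n + 1 : ℂ)) •
      (evalScalars s t (expExpPoly V W N) - 1) ^ (n + 1) := by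
  rw [logExpPoly, map_sum]
  simp only [map_mul, map_pow, evalScalars_C, evalScalar_C, map_sub, map_one, Algebra.smul_def]

lemma coeff_expExpPoly (V W : A) {N a b : ℕ} (ha : a < N) (hb : b < N) :
    ((expExpPoly V W N).coeff a).coeff b =
      ((a.factorial : ℂ)⁻¹ • V ^ a) * ((b.factorial : ℂ)⁻¹ • W ^ b) := by
  rw [expExpPoly, Polynomial.coeff_mul_C, Polynomial.finsetSum_coeff]
  simp only [Polynomial.coeff_C_mul_X_pow]
  rw [Finset.sum_ite_eq, if_pos (Finset.mem_range.2 ha), Polynomial.coeff_C_mul,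
    Polynomial.finsetSum_coeff]
  simp only [Polynomial.coeff_C_mul_X_pow]
  rw [Finset.sum_ite_eq, if_pos (Finset.mem_range.2 hb)]

/-- U = exp(sV) exp(tW) − 1 has no constant term, so st occurs only in U and U². These contribute VW
and −½(VW + WV). -/
lemma coeff_logExpPoly (V W : A) {N : ℕ} (hN : 2 ≤ N) :
    ((logExpPoly V W N).coeff 1).coeff 1 = V * W - (2 : ℂ)⁻¹ • (V * W + W * V) := by
  obtain ⟨M, rfl⟩ := Nat.exists_eq_add_of_le' hN
  set U := expExpPoly V W (M + 2) - 1 with hU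
  have h00 : (U.coeff 0).coeff 0 = 0 := by
    rw [hU, Polynomial.coeff_sub, Polynomial.coeff_sub, coeff_expExpPoly V W (by omega) (by omega)]
    simp
  have h10 : (U.coeff 1).coeff 0 = V := by
    rw [hU, Polynomial.coeff_sub, Polynomial.coeff_sub, coeff_expExpPoly V W (by omega) (by omega)]
    simp [Polynomial.coeff_one]
  have h01 : (U.coeff 0).coeff 1 = W := by
    rw [hU, Polynomial.coeff_sub, Polynomial.coeff_sub, coeff_expExpPoly V W (by omega) (by omega)]
    simp [Polynomial.coeff_one]
  have h11 : (U.coeff 1).coeff 1 = V * W := by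
    rw [hU, Polynomial.coeff_sub, Polynomial.coeff_sub, coeff_expExpPoly V W (by omega) (by omega)]
    simp [Polynomial.coeff_one]
  have hmul : ∀ P Q : A[X][X], ((P * Q).coeff 1).coeff 1 =
      (P.coeff 0).coeff 0 * (Q.coeff 1).coeff 1 + (P.coeff 0).coeff 1 * (Q.coeff 1).coeff 0 +
      ((P.coeff 1).coeff 0 * (Q.coeff 0).coeff 1 + (P.coeff 1).coeff 1 * (Q.coeff 0).coeff 0) := by
    intro P Q
    rw [Polynomial.mul_coeff_one, Polynomial.coeff_add, Polynomial.mul_coeff_one,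
      Polynomial.mul_coeff_one]
  -- Second and higher powers of U have no terms 1, s or t; one more factor U then removes st.
  have hlow : ∀ n, ((U ^ (n + 2)).coeff 0).coeff 0 = 0 ∧ ((U ^ (n + 2)).coeff 1).coeff 0 = 0 ∧
      ((U ^ (n + 2)).coeff 0).coeff 1 = 0 := by
    intro n
    have hn : ((U ^ (n + 1)).coeff 0).coeff 0 = 0 := by
      rw [pow_succ, Polynomial.mul_coeff_zero, Polynomial.mul_coeff_zero, h00, mul_zero]
    rw [pow_succ]
    refine ⟨?_, ?_, ?_⟩
    · rw [Polynomial.mul_coeff_zero, Polynomial.mul_coeff_zero, h00, mul_zero]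
    · rw [Polynomial.mul_coeff_one, Polynomial.coeff_add, Polynomial.mul_coeff_zero,
        Polynomial.mul_coeff_zero, hn, h00, zero_mul, mul_zero, add_zero]
    · rw [Polynomial.mul_coeff_zero, Polynomial.mul_coeff_one, hn, h00, zero_mul, mul_zero,
        add_zero]
  have h2 : ((U ^ 2).coeff 1).coeff 1 = V * W + W * V := by
    rw [pow_two, hmul, h00, h10, h01, h11]
    simp only [zero_mul, mul_zero, add_zero, zero_add]
    abel
  have h3 : ∀ n, ((U ^ (n + 3)).coeff 1).coeff 1 = 0 := by
    intro n
    obtain ⟨a, b, c⟩ := hlow n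
    rw [pow_succ, hmul, a, b, c, h00]
    simp
  rw [logExpPoly, Polynomial.finsetSum_coeff, Polynomial.finsetSum_coeff, Finset.sum_range_succ',
    Finset.sum_range_succ']
  simp only [Polynomial.coeff_C_mul]
  have h1 : ((U ^ 1).coeff 1).coeff 1 = V * W := by rw [pow_one, h11]
  have hc : (-1 : ℂ) ^ 1 / (((1 : ℕ) : ℂ) + 1) = -2⁻¹ := by norm_num
  have hc0 : (-1 : ℂ) ^ 0 / (((0 : ℕ) : ℂ) + 1) = 1 := by norm_num
  rw [Finset.sum_eq_zero fun n _ => by rw [← hU, h3, mul_zero], ← hU, zero_add, zero_add, h2,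
    h1, hc, hc0, map_one, one_mul, map_neg, neg_mul, ← Algebra.smul_def, sub_eq_add_neg, add_comm]

end TwoVariables

/-! ### Uniqueness of power series expansions in two variables -/

lemma eq_zero_of_hasSum_pow_mul {x : ℕ → ℂ} (h : ∀ s : ℂ, HasSum (fun n => s ^ n * x n) 0) (n : ℕ) :
    x n = 0 := by
  have hp : HasFPowerSeriesAt (fun _ : ℂ => (0 : ℂ)) (FormalMultilinearSeries.ofScalars ℂ x) 0 := by
    rw [hasFPowerSeriesAt_iff]
    refine Eventually.of_forall fun z => ?_
    simpa [FormalMultilinearSeries.coeff_ofScalars] using h z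
  have := congrArg (fun p => FormalMultilinearSeries.coeff p n) hp.eq_zero
  rw [FormalMultilinearSeries.coeff_ofScalars] at this
  exact this

/-- Summation over the second index turns the double series into a power series in s for each fixed
t; uniqueness in one variable is applied twice. -/
lemma eq_zero_of_hasSum_pow_mul_pow {d : ℕ × ℕ → ℂ}
    (h : ∀ s t : ℂ, HasSum (fun m : ℕ × ℕ => s ^ m.1 * t ^ m.2 * d m) 0) : d = 0 := by
  -- Setting s = 1 removes the weights s^a, so every row is summable.
  have hsum : ∀ (t : ℂ) (a : ℕ), Summable fun b => t ^ b * d (a, b) := fun t a => by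
    simpa using (h 1 t).summable.prod_factor a
  have h1 : ∀ (t : ℂ) (a : ℕ), ∑' b, t ^ b * d (a, b) = 0 := fun t a => by
    refine eq_zero_of_hasSum_pow_mul (x := fun a => ∑' b, t ^ b * d (a, b)) (fun s => ?_) a
    refine (h s t).prod_fiberwise fun a => ?_
    simpa only [mul_assoc] using (hsum t a).hasSum.mul_left (s ^ a)
  funext ⟨a, b⟩
  refine eq_zero_of_hasSum_pow_mul (x := fun b => d (a, b)) (fun t => ?_) b
  have := (hsum t a).hasSum
  rwa [h1] at this
end

/-! ### The Lie bracket of 𝔰(Φ) -/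

noncomputable section

namespace LBSpace

variable (Φ : LBSpace.{u})

/-! ### Components and blocks -/

/-- The homogeneous component of degree `i` of a polynomial. -/
def component (i : ℕ) : Φ.Poly →ₗ[ℂ] (Φ.symPow i).Sp :=
  Φ.polyLift fun k =>
    (DFinsupp.lapply i : (Π₀ k, (Φ.symPow k).Sp) →ₗ[ℂ] (Φ.symPow i).Sp) ∘ₗ
      DFinsupp.lsingle (M := fun k => (Φ.symPow k).Sp) k

lemma component_monomial (i k : ℕ) (f : (Φ.symPow k).Sp) :
    Φ.component i (Φ.monomial k f) =
      (DFinsupp.single k f : Π₀ k, (Φ.symPow k).Sp) i := by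
  rw [component, polyLift_monomial]
  rfl

lemma component_sum_monomial (g : ∀ i, (Φ.symPow i).Sp) (n i : ℕ) :
    Φ.component i (∑ j ∈ Finset.range n, Φ.monomial j (g j)) = if i < n then g i else 0 := by
  rw [map_sum]
  simp only [component_monomial]
  split_ifs with h
  · rw [Finset.sum_eq_single i, DFinsupp.single_eq_same]
    · exact fun j _ hj => DFinsupp.single_eq_of_ne hj.symm
    · exact fun hi => absurd (Finset.mem_range.2 h) hi
  · refine Finset.sum_eq_zero fun j hj => DFinsupp.single_eq_of_ne ?_
    have := Finset.mem_range.1 hj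
    omega

/-- `block` is a choice. On 𝔰(Φ) the blocks `vBlock` show that a block matrix exists, and the direct
sum decomposition determines it; in particular `block` is additive and homogeneous there. -/
lemma block_apply {V : Φ.PolyOp} (hV : V ∈ Φ.lieS) (i k : ℕ) (f : (Φ.symPow k).Sp) :
    Φ.block V i k f = Φ.component i (V (Φ.monomial k f)) := by
  obtain ⟨α, -, β, -, rfl⟩ := Φ.mem_lieS_iff.1 hV
  obtain ⟨h1, h2⟩ := Classical.epsilon_spec (p := fun B : ∀ i k : ℕ, Φ.Op k i =>
    (∀ i k, k < i → B i k = 0) ∧ ∀ (k : ℕ) (f : (Φ.symPow k).Sp),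
      Φ.vOp α β (Φ.monomial k f) = ∑ i ∈ Finset.range (k + 1), Φ.monomial i (B i k f))
    ⟨Φ.vBlock α β, fun i k h => Φ.vBlock_of_lt h α β, Φ.vOp_monomial α β⟩
  have := Φ.component_sum_monomial (fun j => Φ.block (Φ.vOp α β) j k f) (k + 1) i
  have h2' : Φ.vOp α β (Φ.monomial k f) = ∑ i ∈ Finset.range (k + 1),
      Φ.monomial i (Φ.block (Φ.vOp α β) i k f) := h2 k f
  rw [← h2'] at this
  rw [this]
  split_ifs with h
  · rfl
  · have h3 : Φ.block (Φ.vOp α β) i k = 0 := h1 i k (by omega)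
    rw [h3, _root_.zero_apply]

lemma lieS_ext {V W : Φ.PolyOp} (hV : V ∈ Φ.lieS) (hW : W ∈ Φ.lieS)
    (h : ∀ i k, Φ.block V i k = Φ.block W i k) : V = W := by
  obtain ⟨α, -, β, -, rfl⟩ := Φ.mem_lieS_iff.1 hV
  obtain ⟨α', -, β', -, rfl⟩ := Φ.mem_lieS_iff.1 hW
  refine Φ.polyHom_ext fun k f => ?_
  rw [vOp_monomial, vOp_monomial]
  refine Finset.sum_congr rfl fun i hi => ?_
  have h1 := DFunLike.congr_fun (h i k) f
  rw [Φ.block_apply hV, Φ.block_apply hW, vOp_monomial, vOp_monomial,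
    component_sum_monomial Φ (fun i => Φ.vBlock α β i k f),
    component_sum_monomial Φ (fun i => Φ.vBlock α' β' i k f), if_pos (Finset.mem_range.1 hi),
    if_pos (Finset.mem_range.1 hi)] at h1
  rw [h1]

/-! ### The Lie algebra as a space of operators -/

lemma vOp_zero : Φ.vOp 0 0 = 0 := by
  have := Φ.vOp_smul 0 0 0
  rwa [smul_zero, smul_zero, zero_smul] at this

lemma add_mem_W0 {α α' : Φ.Series 0} (h : α ∈ Φ.W0) (h' : α' ∈ Φ.W0) : α + α' ∈ Φ.W0 := by
  change α 0 + α' 0 = 0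
  rw [show α 0 = 0 from h, show α' 0 = 0 from h', add_zero]

lemma add_mem_W1 {β β' : Φ.Series 1} (h : β ∈ Φ.W1) (h' : β' ∈ Φ.W1) : β + β' ∈ Φ.W1 := by
  constructor
  · rw [series_add_apply, h.1, h'.1, add_zero]
  · rw [series_add_apply, h.2, h'.2, add_zero]

lemma smul_mem_W0 (c : ℂ) {α : Φ.Series 0} (h : α ∈ Φ.W0) : c • α ∈ Φ.W0 := by
  change c • α 0 = 0
  rw [show α 0 = 0 from h, smul_zero]

lemma smul_mem_W1 (c : ℂ) {β : Φ.Series 1} (h : β ∈ Φ.W1) : c • β ∈ Φ.W1 := by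
  constructor
  · rw [series_smul_apply, h.1, smul_zero]
  · rw [series_smul_apply, h.2, smul_zero]

/-- The operators that agree with an element of the Lie algebra on polynomials of degree less
than `N`. -/
def lieLT (N : ℕ) : Submodule ℂ Φ.PolyOp where
  carrier := {X | ∃ α ∈ Φ.W0, ∃ β ∈ Φ.W1, ∀ p ∈ Φ.polyLT N, X p = Φ.vOp α β p}
  zero_mem' := ⟨0, rfl, 0, ⟨rfl, rfl⟩, fun p _ => by rw [vOp_zero]⟩
  add_mem' := by
    rintro X Y ⟨α, hα, β, hβ, h⟩ ⟨α', hα', β', hβ', h'⟩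
    refine ⟨_, Φ.add_mem_W0 hα hα', _, Φ.add_mem_W1 hβ hβ', fun p hp => ?_⟩
    rw [vOp_add, LinearMap.add_apply, LinearMap.add_apply, h p hp, h' p hp]
  smul_mem' := by
    rintro c X ⟨α, hα, β, hβ, h⟩
    refine ⟨_, Φ.smul_mem_W0 c hα, _, Φ.smul_mem_W1 c hβ, fun p hp => ?_⟩
    rw [vOp_smul, LinearMap.smul_apply, LinearMap.smul_apply, h p hp]

variable {Φ}

lemma vOp_congr {α α' : Φ.Series 0} {β β' : Φ.Series 1} {N : ℕ} (hα : ∀ k < N, α k = α' k)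
    (hβ : ∀ k < N, β k = β' k) {p : Φ.Poly} (hp : p ∈ Φ.polyLT N) :
    Φ.vOp α β p = Φ.vOp α' β' p :=
  Φ.polyLT_le (S := LinearMap.eqLocus (Φ.vOp α β) (Φ.vOp α' β')) (fun k hk f => by
    change Φ.vOp α β _ = Φ.vOp α' β' _
    rw [vOp_monomial, vOp_monomial]
    refine Finset.sum_congr rfl fun i _ => ?_
    have : Φ.vBlock α β i k = Φ.vBlock α' β' i k := by
      rw [vBlock, vBlock, alphaBlock, alphaBlock, hα (k - i) (by omega)]
      cases i with
      | zero => rfl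
      | succ i => rw [betaBlock, betaBlock, hβ (k - i) (by omega)]
    rw [this]) hp

lemma scalar_eq_of_vOp_eq {α α' : Φ.Series 0} {β β' : Φ.Series 1} {k : ℕ}
    {f : (Φ.symPow k).Sp} (h : Φ.vOp α β (Φ.monomial k f) = Φ.vOp α' β' (Φ.monomial k f))
    (F : Φ.Series 0) : Φ.scalar (Φ.dualL α β F k f) = Φ.scalar (Φ.dualL α' β' F k f) := by
  have h1 := congrArg (Φ.pairing F) h
  rw [pairing_vOp, pairing_vOp, pairing_monomial, pairing_monomial] at h1
  exact mul_left_cancel₀ (by exact_mod_cast k.factorial_ne_zero) h1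

/-- The coefficients are determined by the operator. -/
lemma coeff_eq_of_vOp_eq {α α' : Φ.Series 0} {β β' : Φ.Series 1} (hβ : β 0 = 0) (hβ' : β' 0 = 0)
    {N : ℕ} (h : ∀ p ∈ Φ.polyLT N, Φ.vOp α β p = Φ.vOp α' β' p) :
    (∀ k < N, α k = α' k) ∧ ∀ k < N, β k = β' k := by
  have hα : ∀ k < N, α k = α' k := by
    intro k hk
    ext1 f
    -- The transpose maps the series 1 to α, which isolates α; below, the series ⟨ω, ξ⟩ is mapped to
    -- ⟨ω, ξ⟩α + ⟨ω, β⟩, which then isolates β.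
    have := scalar_eq_of_vOp_eq (h _ (Φ.monomial_mem_polyLT hk f)) Φ.oneS
    rw [dualL_oneS, dualL_oneS] at this
    exact Φ.scalar_injective this
  refine ⟨hα, fun k hk => ?_⟩
  ext1 f
  refine Φ.ext_ev fun ω => ?_
  have h1 := scalar_eq_of_vOp_eq (h _ (Φ.monomial_mem_polyLT hk f)) (Φ.pairS ω Φ.idS)
  rw [dualL_apply, dualL_apply, series_add_apply, series_add_apply, _root_.add_apply,
    _root_.add_apply, scalar_add, scalar_add, mulS_congr (Y' := α') (fun _ _ => rfl)
      (fun a ha => hα a (lt_of_le_of_lt ha hk))] at h1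
  have h2 := add_left_cancel h1
  rw [pairS_eq, derivS_compOp, derivS_compOp, Φ.derivS_idS hβ, Φ.derivS_idS hβ'] at h2
  exact h2

/-- The coefficients are determined by the operator, so those found for different degree bounds are
compatible. The k-th one is read off from the bound k + 1, the first that sees it. -/
lemma mem_lieS_of_forall_mem_lieLT {X : Φ.PolyOp} (h : ∀ N, X ∈ Φ.lieLT N) : X ∈ Φ.lieS := by
  choose α hα β hβ hX using h
  have hmono : ∀ M N, M ≤ N → (∀ k < M, α M k = α N k) ∧ ∀ k < M, β M k = β N k :=
    fun M N hMN => coeff_eq_of_vOp_eq (hβ M).1 (hβ N).1 fun p hp => by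
      rw [← hX M p hp, hX N p (Φ.polyLT_mono hMN hp)]
  refine Φ.mem_lieS_iff.2 ⟨fun k => α (k + 1) k, hα 1, fun k => β (k + 1) k,
    ⟨(hβ 1).1, (hβ 2).2⟩, LinearMap.ext fun p => ?_⟩
  obtain ⟨N, hp⟩ := Φ.exists_mem_polyLT p
  rw [hX N p hp]
  exact vOp_congr (fun k hk => ((hmono (k + 1) N hk).1 k (Nat.lt_succ_self k)).symm)
    (fun k hk => ((hmono (k + 1) N hk).2 k (Nat.lt_succ_self k)).symm) hp

lemma mem_lieLT_of_mem_lieS {X : Φ.PolyOp} (h : X ∈ Φ.lieS) (N : ℕ) : X ∈ Φ.lieLT N := by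
  obtain ⟨α, hα, β, hβ, rfl⟩ := Φ.mem_lieS_iff.1 h
  exact ⟨α, hα, β, hβ, fun _ _ => rfl⟩

variable (Φ)

/-- The Lie algebra is a linear space. -/
def lieSubmodule : Submodule ℂ Φ.PolyOp where
  carrier := Φ.lieS
  zero_mem' := mem_lieS_of_forall_mem_lieLT fun _ => Submodule.zero_mem _
  add_mem' h h' := mem_lieS_of_forall_mem_lieLT fun N =>
    Submodule.add_mem _ (mem_lieLT_of_mem_lieS h N) (mem_lieLT_of_mem_lieS h' N)
  smul_mem' c _ h := mem_lieS_of_forall_mem_lieLT fun N =>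
    Submodule.smul_mem _ c (mem_lieLT_of_mem_lieS h N)

variable {Φ}

lemma lieS_subset_lowering {V : Φ.PolyOp} (hV : V ∈ Φ.lieS) : V ∈ Φ.lowering := by
  obtain ⟨α, hα, β, hβ, rfl⟩ := Φ.mem_lieS_iff.1 hV
  exact Φ.vOp_mem_lowering hα hβ

lemma expOp_mem_SS {V : Φ.PolyOp} (hV : V ∈ Φ.lieS) : Φ.expOp V ∈ Φ.SS := by
  obtain ⟨α, hα, β, hβ, rfl⟩ := Φ.mem_lieS_iff.1 hV
  exact Φ.expOp_vOp_mem_SS hα hβ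

lemma logOp_expOp_mul_expOp_mem {V W : Φ.PolyOp} (hV : V ∈ Φ.lieS) (hW : W ∈ Φ.lieS) :
    Φ.logOp (Φ.expOp V * Φ.expOp W) ∈ Φ.lieS :=
  ⟨_, Φ.SS_mul_mem (expOp_mem_SS hV) (expOp_mem_SS hW), rfl⟩

/-! ### The expansion of the logarithm of a product of exponentials -/

/-- On polynomials of degree below N both exponentials and the logarithm are finite sums, so
truncation at N changes nothing. -/
lemma logOp_eq_evalScalars {V W : Φ.PolyOp} (hV : V ∈ Φ.lowering) (hW : W ∈ Φ.lowering) (s t : ℂ)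
    {N : ℕ} {p : Φ.Poly} (hp : p ∈ Φ.polyLT N) :
    Φ.logOp (Φ.expOp (s • V) * Φ.expOp (t • W)) p =
      evalScalars s t (logExpPoly V W N) p := by
  have hsV := Submodule.smul_mem _ s hV
  have htW := Submodule.smul_mem _ t hW
  have hP : Φ.expOp (s • V) * Φ.expOp (t • W) - 1 ∈ Φ.lowering :=
    mul_sub_one_mem_lowering (expOp_sub_one_mem_lowering hsV) (expOp_sub_one_mem_lowering htW)
  set P := Φ.expOp (s • V) * Φ.expOp (t • W)
  have hE : ∀ q ∈ Φ.polyLT N, P q = evalScalars s t (expExpPoly V W N) q := by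
    intro q hq
    -- The exponential does not raise the degree, so the same truncation serves the second factor
    -- applied to its image.
    have hq' : Φ.expOp (t • W) q ∈ Φ.polyLT N := by
      have := Submodule.add_mem _ (Φ.polyLT_mono (Nat.sub_le N 1)
        (lowering_apply_mem (expOp_sub_one_mem_lowering htW) hq)) hq
      rwa [LinearMap.sub_apply, Module.End.one_apply, sub_add_cancel] at this
    rw [evalScalars_expExpPoly, Module.End.mul_apply, Module.End.mul_apply,
      expOp_apply hsV hq', expOp_apply htW hq, LinearMap.sum_apply, LinearMap.sum_apply]
    rfl
  have hpow : ∀ n : ℕ, ((P - 1) ^ n : Φ.PolyOp) p =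
      ((evalScalars s t (expExpPoly V W N) - 1) ^ n : Φ.PolyOp) p := by
    intro n
    induction n with
    | zero => rfl
    | succ n ih =>
      have := Φ.polyLT_mono (Nat.sub_le N n) (lowering_pow_apply_mem hP hp n)
      rw [pow_succ', Module.End.mul_apply, pow_succ', Module.End.mul_apply, ← ih,
        LinearMap.sub_apply, LinearMap.sub_apply, hE _ this]
  rw [logOp_apply hP hp, evalScalars_logExpPoly, LinearMap.sum_apply]
  refine Finset.sum_congr rfl fun n _ => ?_
  rw [hpow, LinearMap.smul_apply]

/-- The coefficients of the expansion of `log(exp(s V) exp(t W))`. -/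
def bchCoeff (V W : Φ.PolyOp) (m : ℕ × ℕ) : Φ.PolyOp :=
  Φ.polyLift fun k => ((logExpPoly V W (k + 1)).coeff m.1).coeff m.2 ∘ₗ Φ.monomial k

/-- On a monomial of degree k < N the truncations at N and at k + 1 have equal values for all s and
t, so their coefficients act equally on it. `bchCoeff` therefore does not depend on the truncation.
-/
lemma coeff_logExpPoly_apply {V W : Φ.PolyOp} (hV : V ∈ Φ.lowering) (hW : W ∈ Φ.lowering) {N : ℕ}
    {p : Φ.Poly} (hp : p ∈ Φ.polyLT N) (m : ℕ × ℕ) :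
    ((logExpPoly V W N).coeff m.1).coeff m.2 p = bchCoeff V W m p :=
  Φ.polyLT_le (S := LinearMap.eqLocus (((logExpPoly V W N).coeff m.1).coeff m.2)
    (bchCoeff V W m)) (fun k hk f => by
    change ((logExpPoly V W N).coeff m.1).coeff m.2 (Φ.monomial k f) = bchCoeff V W m _
    rw [bchCoeff, polyLift_monomial, LinearMap.comp_apply, ← sub_eq_zero, ← LinearMap.sub_apply,
      ← Polynomial.coeff_sub, ← Polynomial.coeff_sub]
    let T : Φ.PolyOp →ₗ[ℂ] Φ.Poly :=
      { toFun := fun Q => Q (Φ.monomial k f)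
        map_add' := fun _ _ => rfl
        map_smul' := fun _ _ => rfl }
    refine (apply_coeff_eq_zero (A := Φ.PolyOp) T
      (logExpPoly V W N - logExpPoly V W (k + 1)) (fun s t => ?_) m.1 m.2 :)
    change evalScalars s t (logExpPoly V W N - logExpPoly V W (k + 1)) (Φ.monomial k f) = 0
    rw [map_sub, LinearMap.sub_apply, ← logOp_eq_evalScalars hV hW s t (Φ.monomial_mem_polyLT hk f),
      ← logOp_eq_evalScalars hV hW s t (Φ.monomial_mem_polyLT (Nat.lt_succ_self k) f),
      sub_self]) hp

/-- 𝕊(Φ) is closed under products, so for every s and t the logarithm lies in 𝔰(Φ). Below each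
degree it is a polynomial in s and t with values in a linear space, which then contains the
coefficients. -/
lemma bchCoeff_mem_lieS {V W : Φ.PolyOp} (hV : V ∈ Φ.lieS) (hW : W ∈ Φ.lieS) (m : ℕ × ℕ) :
    bchCoeff V W m ∈ Φ.lieS := by
  have hV' := lieS_subset_lowering hV
  have hW' := lieS_subset_lowering hW
  refine mem_lieS_of_forall_mem_lieLT fun N => ?_
  have h : ((logExpPoly V W N).coeff m.1).coeff m.2 ∈ Φ.lieLT N := by
    refine coeff_mem_of_evalScalars_mem (A := Φ.PolyOp) (Φ.lieLT N) _ (fun s t => ?_) m.1 m.2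
    obtain ⟨α, hα, β, hβ, h⟩ := Φ.mem_lieS_iff.1 (logOp_expOp_mul_expOp_mem
      (Φ.lieSubmodule.smul_mem s hV) (Φ.lieSubmodule.smul_mem t hW))
    exact ⟨α, hα, β, hβ, fun p hp => by rw [← h, logOp_eq_evalScalars hV' hW' s t hp]⟩
  obtain ⟨α, hα, β, hβ, h⟩ := h
  exact ⟨α, hα, β, hβ, fun p hp => by rw [← h p hp, coeff_logExpPoly_apply hV' hW' hp]⟩

lemma bchCoeff_one_one {V W : Φ.PolyOp} (hV : V ∈ Φ.lowering) (hW : W ∈ Φ.lowering) :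
    bchCoeff V W (1, 1) = V * W - (2 : ℂ)⁻¹ • (V * W + W * V) := by
  refine LinearMap.ext fun p => ?_
  obtain ⟨N, hp⟩ := Φ.exists_mem_polyLT p
  rw [← coeff_logExpPoly_apply hV hW (Φ.polyLT_mono (Nat.le_add_right N 2) hp),
    coeff_logExpPoly V W (by omega)]

/-- Each block of the partial sums is eventually constant, so no estimate in the operator topologies
is needed. -/
lemma hasSum_opTopology {c : ℕ × ℕ → Φ.PolyOp} {X : Φ.PolyOp} (hc : ∀ m, c m ∈ Φ.lieS)
    (hX : X ∈ Φ.lieS) (h : ∀ k, ∃ S : Finset (ℕ × ℕ), ∀ F, S ⊆ F → ∀ f,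
      (∑ m ∈ F, c m) (Φ.monomial k f) = X (Φ.monomial k f)) :
    @HasSum _ _ _ Φ.opTopology c X (SummationFilter.unconditional _) := by
  let _ : TopologicalSpace Φ.PolyOp := Φ.opTopology
  rw [HasSum, SummationFilter.unconditional_filter, nhds_iInf, tendsto_iInf]
  intro i
  rw [nhds_iInf, tendsto_iInf]
  intro k
  let _ := homTopology (Φ.symPow k) (Φ.symPow i)
  rw [nhds_induced, tendsto_comap_iff]
  obtain ⟨S, hS⟩ := h k
  refine tendsto_const_nhds.congr' ?_
  filter_upwards [eventually_ge_atTop S] with F hF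
  ext1 f
  change Φ.block X i k f = Φ.block (∑ m ∈ F, c m) i k f
  rw [Φ.block_apply hX, Φ.block_apply (Φ.lieSubmodule.sum_mem fun m _ => hc m), hS F hF]

lemma isMixedCoeff_bchCoeff {V W : Φ.PolyOp} (hV : V ∈ Φ.lieS) (hW : W ∈ Φ.lieS) :
    Φ.IsMixedCoeff V W (V * W - (2 : ℂ)⁻¹ • (V * W + W * V)) := by
  have hV' := lieS_subset_lowering hV
  have hW' := lieS_subset_lowering hW
  refine ⟨bchCoeff V W, bchCoeff_mem_lieS hV hW, fun s t => ?_, bchCoeff_one_one hV' hW'⟩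
  refine hasSum_opTopology (fun m => Φ.lieSubmodule.smul_mem _ (bchCoeff_mem_lieS hV hW m))
    (logOp_expOp_mul_expOp_mem (Φ.lieSubmodule.smul_mem s hV) (Φ.lieSubmodule.smul_mem t hW))
    fun k => ?_
  obtain ⟨n, h1, h2⟩ := exists_coeff_bound (logExpPoly V W (k + 1))
  refine ⟨Finset.range n ×ˢ Finset.range n, fun F hF f => ?_⟩
  have hk := Φ.monomial_mem_polyLT (Nat.lt_succ_self k) f
  rw [logOp_eq_evalScalars hV' hW' s t hk, evalScalars_eq_sum s t _ h1 h2, LinearMap.sum_apply,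
    ← Finset.sum_subset hF, Finset.sum_product, LinearMap.sum_apply]
  · refine Finset.sum_congr rfl fun a _ => ?_
    rw [LinearMap.smul_apply, LinearMap.sum_apply, Finset.smul_sum]
    refine Finset.sum_congr rfl fun b _ => ?_
    rw [LinearMap.smul_apply, LinearMap.smul_apply, smul_smul,
      ← coeff_logExpPoly_apply hV' hW' hk]
  · intro m _ hm
    rw [LinearMap.smul_apply, ← coeff_logExpPoly_apply hV' hW' hk]
    rcases Nat.lt_or_ge m.1 n with h | h
    · have h3 : n ≤ m.2 := by
        by_contra h3
        exact hm (Finset.mem_product.2 ⟨Finset.mem_range.2 h, Finset.mem_range.2 (by omega)⟩)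
      rw [h2 _ _ h3, LinearMap.zero_apply, smul_zero]
    · rw [h1 _ h, Polynomial.coeff_zero, LinearMap.zero_apply, smul_zero]

lemma hasSum_ev_block {c : ℕ × ℕ → Φ.PolyOp} {X : Φ.PolyOp} (hc : ∀ m, c m ∈ Φ.lieS)
    (h : @HasSum _ _ _ Φ.opTopology c X (SummationFilter.unconditional _)) (i k : ℕ)
    (f : (Φ.symPow k).Sp) (ω : Φ.Dual) :
    HasSum (fun m => Φ.ev i ω (Φ.block (c m) i k f)) (Φ.ev i ω (Φ.block X i k f)) := by
  let _ : TopologicalSpace Φ.PolyOp := Φ.opTopology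
  rw [HasSum, SummationFilter.unconditional_filter, nhds_iInf, tendsto_iInf] at h
  have h1 := h i
  rw [nhds_iInf, tendsto_iInf] at h1
  have h2 := h1 k
  let _ := homTopology (Φ.symPow k) (Φ.symPow i)
  rw [nhds_induced, tendsto_comap_iff] at h2
  have h3 := ((continuous_homTopology_eval (Φ.symPow k) (Φ.symPow i) f (Φ.ev i ω)).tendsto
    (Φ.block X i k)).comp h2
  rw [HasSum, SummationFilter.unconditional_filter]
  refine h3.congr fun F => ?_
  change Φ.ev i ω (Φ.block (∑ m ∈ F, c m) i k f) = _
  rw [Φ.block_apply (Φ.lieSubmodule.sum_mem fun m _ => hc m), LinearMap.sum_apply, map_sum,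
    map_sum]
  exact Finset.sum_congr rfl fun m _ => by rw [Φ.block_apply (hc m)]

/-- Evaluating a block at f and ω is continuous, so two expansions become scalar double power series
with the same sum everywhere and hence the same coefficients. Elements of 𝔰(Φ) are recovered from
these values. -/
lemma IsMixedCoeff.unique {V W b b' : Φ.PolyOp} (h : Φ.IsMixedCoeff V W b)
    (h' : Φ.IsMixedCoeff V W b') : b = b' := by
  obtain ⟨c, hc, hs, rfl⟩ := h
  obtain ⟨c', hc', hs', rfl⟩ := h'
  refine Φ.lieS_ext (hc _) (hc' _) fun i k => ?_
  ext1 f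
  refine Φ.ext_ev fun ω => ?_
  have hsmul : ∀ (z : ℂ) {Q : Φ.PolyOp}, Q ∈ Φ.lieS →
      Φ.ev i ω (Φ.block (z • Q) i k f) = z * Φ.ev i ω (Φ.block Q i k f) := by
    intro z Q hQ
    rw [Φ.block_apply (Φ.lieSubmodule.smul_mem z hQ), Φ.block_apply hQ, LinearMap.smul_apply,
      map_smul, map_smul, smul_eq_mul]
  have hd := eq_zero_of_hasSum_pow_mul_pow
    (d := fun m => Φ.ev i ω (Φ.block (c m) i k f) - Φ.ev i ω (Φ.block (c' m) i k f)) fun s t => by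
      have h1 := hasSum_ev_block (fun m => Φ.lieSubmodule.smul_mem _ (hc m)) (hs s t) i k f ω
      have h2 := hasSum_ev_block (fun m => Φ.lieSubmodule.smul_mem _ (hc' m)) (hs' s t) i k f ω
      have h3 := h1.sub h2
      rw [sub_self] at h3
      refine h3.congr_fun fun m => ?_
      rw [hsmul _ (hc m), hsmul _ (hc' m), mul_sub]
  exact sub_eq_zero.1 (congrFun hd (1, 1))

/-- The half-anticommutator in the mixed coefficient is symmetric in V and W and cancels in b(V, W)
− b(W, V). -/
lemma isLieBracket_iff {V W : Φ.PolyOp} (hV : V ∈ Φ.lieS) (hW : W ∈ Φ.lieS) (X : Φ.PolyOp) :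
    Φ.IsLieBracket V W X ↔ X = V * W - W * V := by
  have h1 := isMixedCoeff_bchCoeff hV hW
  have h2 := isMixedCoeff_bchCoeff hW hV
  have h3 : (V * W - (2 : ℂ)⁻¹ • (V * W + W * V)) - (W * V - (2 : ℂ)⁻¹ • (W * V + V * W)) =
      V * W - W * V := by
    rw [add_comm (W * V)]
    exact sub_sub_sub_cancel_right (V * W) (W * V) _
  constructor
  · rintro ⟨b, b', hb, hb', rfl⟩
    rw [hb.unique h1, hb'.unique h2, h3]
  · rintro rfl
    exact ⟨_, _, h1, h2, h3.symm⟩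

lemma commutator_mem_lieS {V W : Φ.PolyOp} (hV : V ∈ Φ.lieS) (hW : W ∈ Φ.lieS) :
    V * W - W * V ∈ Φ.lieS := by
  obtain ⟨α₁, hα₁, β₁, hβ₁, rfl⟩ := Φ.mem_lieS_iff.1 hV
  obtain ⟨α₂, hα₂, β₂, hβ₂, rfl⟩ := Φ.mem_lieS_iff.1 hW
  rw [Φ.vOp_commutator hβ₁ hβ₂]
  exact Φ.mem_lieS_iff.2 ⟨_, Φ.sub_mem_W0 (Φ.derivS_mem_W0 hα₁ hβ₂) (Φ.derivS_mem_W0 hα₂ hβ₁), _,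
    Φ.sub_mem_W1 (Φ.derivS_mem_W1 hβ₂ hβ₁) (Φ.derivS_mem_W1 hβ₁ hβ₂), rfl⟩

end LBSpace

/-! ### The theorem -/

theorem theorem4p8 (Φ : LBSpace.{u}) :
    (∀ α ∈ Φ.W0, ∀ β ∈ Φ.W1, Φ.R α β ∈ Φ.lieS ∧
      ∀ p : Φ.Poly, (Φ.R α β p : Φ.Dual → ℂ) = Φ.diffOp α β p) ∧
    (∀ V ∈ Φ.lieS, ∀ W ∈ Φ.lieS, V * W - W * V ∈ Φ.lieS ∧
      ∀ X : Φ.PolyOp, Φ.IsLieBracket V W X ↔ X = V * W - W * V) ∧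
    (∀ α₁ ∈ Φ.W0, ∀ β₁ ∈ Φ.W1, ∀ α₂ ∈ Φ.W0, ∀ β₂ ∈ Φ.W1, ∀ p : Φ.Poly,
      Φ.diffOp α₁ β₁ (Φ.diffOp α₂ β₂ p) - Φ.diffOp α₂ β₂ (Φ.diffOp α₁ β₁ p) =
        Φ.nablaOp (Φ.derivS β₂ α₁) p - Φ.nablaOp (Φ.derivS β₁ α₂) p +
          Φ.mulNablaOp (Φ.derivS β₂ β₁ - Φ.derivS β₁ β₂) p) := by
  refine ⟨fun α hα β hβ => ?_, fun V hV W hW => ⟨LBSpace.commutator_mem_lieS hV hW,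
    LBSpace.isLieBracket_iff hV hW⟩, fun α₁ _ β₁ hβ₁ α₂ _ β₂ hβ₂ p => ?_⟩
  · rw [Φ.R_eq_vOp hα hβ]
    exact ⟨Φ.mem_lieS_iff.2 ⟨α, hα, β, hβ, rfl⟩, fun p => (Φ.diffOp_coe α hβ.1 p).symm⟩
  · have hβ := Φ.sub_mem_W1 (Φ.derivS_mem_W1 hβ₂ hβ₁) (Φ.derivS_mem_W1 hβ₁ hβ₂)
    have hsub : Φ.vOp (Φ.derivS β₂ α₁ - Φ.derivS β₁ α₂) 0 =
        Φ.vOp (Φ.derivS β₂ α₁) 0 - Φ.vOp (Φ.derivS β₁ α₂) 0 := by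
      refine @eq_sub_of_add_eq Φ.PolyOp _ _ _ _ ?_
      rw [← Φ.vOp_add, sub_add_cancel, add_zero]
    have h := congrArg (fun Q : Φ.PolyOp => (Q p : Φ.Dual → ℂ))
      (Φ.vOp_commutator (α₁ := α₁) (α₂ := α₂) hβ₁ hβ₂)
    -- Linearity of `vOp` separates the α-part from the β-part, since the statement is in terms of
    -- the individual differential operators.
    have hadd := Φ.vOp_add (Φ.derivS β₂ α₁ - Φ.derivS β₁ α₂) 0 0
      (Φ.derivS β₂ β₁ - Φ.derivS β₁ β₂)
    rw [add_zero, zero_add, hsub] at hadd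
    rw [hadd] at h
    rw [Φ.diffOp_coe α₂ hβ₂.1, Φ.diffOp_coe α₁ hβ₁.1, Φ.diffOp_coe α₁ hβ₁.1,
      Φ.diffOp_coe α₂ hβ₂.1, Φ.nablaOp_coe, Φ.nablaOp_coe, Φ.mulNablaOp_coe hβ.1]
    exact h
end
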